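/- **Model.** For $\sigma\in\{\pm1\}^n$, $p\in[0,1]$, $\zeta\in(0,\tfrac12)$, the censored block model $\mathrm{CBM}(\sigma,p,\zeta)$ is the law of the symmetric random matrix $A$ with zero diagonal whose entries $A_{ij}\in\{-1,0,1\}$, $i<j$, are independent with $\Pr(A_{ij}=\sigma_i\sigma_j)=p(1-\zeta)$, $\Pr(A_{ij}=-\sigma_i\sigma_j)=p\zeta$, $\Pr(A_{ij}=0)=1-p$. **Non-private estimator.** $\hat\sigma(A)\in\{\pm1\}^n$ is obtained from a maximizer $Y$ of $\operatorname{tr}(AY)$ subject to $Y\succeq0$, $Y_{ii}=1$ for all $i$, by rounding: the maximizer and the rounding may be chosen in any deterministic way, except that the first label of $\hat\sigma(A)$ is $+1$ (which fixes the global sign) and that $\hat\sigma(A)\in\{\sigma,-\sigma\}$ if the chosen maximizer is $Y=\sigma\sigma^T$ with $\sigma\in\{\pm1\}^n$. **Mechanism** (parameters $n\ge2$, $\varepsilon,\delta>0$). Put $q=\min\{\varepsilon/(32\log n),1\}$ and $m=\lceil\log(n/\delta)/q^2\rceil$. Form $m$ subgraphs $A_1,\dots,A_m$ of the input $A$ by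 keeping in each of them every edge independently with probability $q$ (otherwise the entry is set to $0$). Let $\mathrm{count}(s)=|\{k:\hat\sigma(A_k)=s\}|$ for $s\in\{\pm1\}^n$, let $\mathrm{count}_{(1)}\ge\mathrm{count}_{(2)}$ be its two largest values (with multiplicity), and let $\hat d=(\mathrm{count}_{(1)}-\mathrm{count}_{(2)})/(4mq)-1$ and $\tilde d=\hat d+L$, where $L$ is Laplace noise with mean $0$ and scale $1/\varepsilon$. If $\tilde d>\log(1/\delta)/\varepsilon$, output the mode, i.e. an $s$ with $\mathrm{count}(s)=\mathrm{count}_{(1)}$; otherwise output a uniformly random element of $\{\pm1\}^n$. The subsampling, the noise and the random label vector are independent of each other and of $A$. **Theorem.** (1) For all $n\ge2$, $\varepsilon>0$, $\delta>0$ the mechanism $M$ satisfies $(\varepsilon,2\delta)$-edge central differential privacy: for all adjacency matrices $A,A'$ that differ in exactly one edge (one pair $\{i,j\}$) and every set $S\subseteq\{\pm1\}^n$, $$\Pr(M(A)\in S)\le e^{\varepsilon}\Pr(M(A')\in S)+2\delta ,$$ where the probabilities are over the randomness of the mechanism only. (2) Let $\zeta\in(0,\tfrac12)$ be fixed and let $\varepsilon_n>0$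 with $\limsup_n \varepsilon_n/\log n<6$ (for example, $\varepsilon_n=\varepsilon$ constant). Let $p_n=a_n\log n/n$ with $p_n\le1$ and $$a_n\bigl(\sqrt{1-\zeta}-\sqrt{\zeta}\bigr)^2>\max\Bigl\{\frac{32\log n}{\varepsilon_n},\,1\Bigr\}$$ for all sufficiently large $n$. Then the mechanism with $\varepsilon=\varepsilon_n$ and $\delta=n^{-2}$ achieves exact recovery up to a global flip: for all $\sigma^*_n\in\{\pm1\}^n$, if $A\sim\mathrm{CBM}(\sigma^*_n,p_n,\zeta)$, then $\Pr(M(A)\in\{\sigma^*_n,-\sigma^*_n\})\to1$ as $n\to\infty$, where the probability is over both $A$ and the randomness of the mechanism. -/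

import Mathlib

open MeasureTheory Filter Topology

noncomputable section

namespace CensoredBlockModel

/-- Community labellings of `n` vertices, i.e. elements of `{-1, +1}ⁿ`. -/
abbrev Labeling (n : ℕ) : Type := Fin n → ℤˣ

/-- Unordered pairs of distinct vertices, written `(i, j)` with `i < j`. -/
abbrev VertexPair (n : ℕ) : Type := {e : Fin n × Fin n // e.1 < e.2}

/-- A censored graph: every pair of vertices carries a value in `{-1, 0, +1}`
(`0` means that there is no edge). These are the upper triangles of the adjacency matrices. -/
abbrev CensoredGraph (n : ℕ) : Type := VertexPair n → SignType

instance : MeasurableSpace SignType := ⊤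

instance : DiscreteMeasurableSpace SignType := ⟨fun _ => trivial⟩

instance : DiscreteMeasurableSpace ℤˣ :=
  ⟨fun s => ⟨Units.val '' s, MeasurableSet.of_discrete, Set.preimage_image_eq s Units.val_injective⟩⟩

/-- The symmetric adjacency matrix with zero diagonal and entries in `{-1, 0, +1}`. -/
def adjMatrix {n : ℕ} (A : CensoredGraph n) : Matrix (Fin n) (Fin n) ℝ :=
  Matrix.of fun i j =>
    if h : i < j then ((A ⟨(i, j), h⟩ : SignType) : ℝ)
    else if h : j < i then ((A ⟨(j, i), h⟩ : SignType) : ℝ)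
    else 0

/-! ### The censored block model -/

/-- The law of one entry of the adjacency matrix, for a pair with `σᵢ σⱼ = s`. -/
def edgeMeasure (s : ℤˣ) (p ζ : ℝ) : Measure SignType :=
  ENNReal.ofReal (p * (1 - ζ)) • Measure.dirac (SignType.sign (s : ℤ)) +
    ENNReal.ofReal (p * ζ) • Measure.dirac (-SignType.sign (s : ℤ)) +
    ENNReal.ofReal (1 - p) • Measure.dirac 0

/-- The law `CBM(σ, p, ζ)`: the entries above the diagonal are independent. -/
def cbm {n : ℕ} (σ : Labeling n) (p ζ : ℝ) : Measure (CensoredGraph n) :=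
  Measure.pi fun e => edgeMeasure (σ e.1.1 * σ e.1.2) p ζ

/-! ### The semidefinite relaxation of the maximum likelihood estimator -/

/-- The feasible set of the semidefinite program: `Y ≽ 0` and `Y i i = 1` for all `i`. -/
def elliptope (n : ℕ) : Set (Matrix (Fin n) (Fin n) ℝ) :=
  {Y | Y.PosSemidef ∧ ∀ i, Y i i = 1}

/-- `Y` maximizes `tr (A Y)` over the feasible set. -/
def IsSDPSolution {n : ℕ} (A : CensoredGraph n) (Y : Matrix (Fin n) (Fin n) ℝ) : Prop :=
  Y ∈ elliptope n ∧ ∀ Z ∈ elliptope n, (adjMatrix A * Z).trace ≤ (adjMatrix A * Y).trace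

/-- The rank one matrix `σ σᵀ`. -/
def outer {n : ℕ} (σ : Labeling n) : Matrix (Fin n) (Fin n) ℝ :=
  Matrix.of fun i j => (((σ i * σ j : ℤˣ) : ℤ) : ℝ)

/-- `s` is the sign representative (of the pair `{s, -s}`) whose first entry is `+1`. -/
def IsNormalized {n : ℕ} (s : Labeling n) : Prop := ∀ i : Fin n, (i : ℕ) = 0 → s i = 1

/-- `s` is an admissible value of the relaxed estimator on `A`: it is obtained by rounding a
solution `Y` of the semidefinite program. Rounding returns the (normalized) labelling `σ` when
`Y = σ σᵀ`, and may be done in any way when `Y` is not of this form. -/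
def IsSDPEstimate {n : ℕ} (A : CensoredGraph n) (s : Labeling n) : Prop :=
  IsNormalized s ∧
    ∃ Y, IsSDPSolution A Y ∧ ∀ σ : Labeling n, Y = outer σ → s = σ ∨ s = -σ

theorem exists_isSDPSolution {n : ℕ} (A : CensoredGraph n) : ∃ Y, IsSDPSolution A Y := by
  have hent : ∀ Y ∈ elliptope n, ∀ i j, Y i j ∈ Set.Icc (-1 : ℝ) 1 := by
    intro Y hY i j
    by_cases hij : i = j
    · subst hij; rw [hY.2 i]; norm_num
    have hs : Y j i = Y i j := by simpa using hY.1.isHermitian.apply i j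
    have h1 := hY.1.dotProduct_mulVec_nonneg (Pi.single i 1 + Pi.single j 1)
    have h2 := hY.1.dotProduct_mulVec_nonneg (Pi.single i 1 - Pi.single j 1)
    simp [Matrix.mulVec_add, Matrix.mulVec_sub, hY.2, hs] at h1 h2
    constructor <;> linarith
  have hclosed : IsClosed (elliptope n) := by
    have : elliptope n = {Y : Matrix (Fin n) (Fin n) ℝ | Y.transpose = Y} ∩
        (⋂ x : Fin n → ℝ, {Y | 0 ≤ x ⬝ᵥ (Y.mulVec x)}) ∩ ⋂ i, {Y | Y i i = 1} := by
      ext Y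
      simp [elliptope, Matrix.posSemidef_iff_dotProduct_mulVec, Matrix.IsHermitian, Matrix.conjTranspose_eq_transpose_of_trivial]
    rw [this]
    refine ((isClosed_eq (by fun_prop) (by fun_prop)).inter
      (isClosed_iInter fun x => isClosed_le continuous_const ?_)).inter
      (isClosed_iInter fun i => isClosed_eq ?_ continuous_const)
    · fun_prop
    · fun_prop
  have hcompact : IsCompact (elliptope n) := by
    refine IsCompact.of_isClosed_subset
      (isCompact_univ_pi fun _ : Fin n => isCompact_univ_pi fun _ : Fin n =>
        (isCompact_Icc : IsCompact (Set.Icc (-1 : ℝ) 1))) hclosed ?_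
    intro Y hY i _ j _
    exact hent Y hY i j
  obtain ⟨Y, hY, hmax⟩ := hcompact.exists_isMaxOn
    (f := fun Y : Matrix (Fin n) (Fin n) ℝ => (adjMatrix A * Y).trace)
    ⟨1, Matrix.PosSemidef.one, by simp⟩ (by fun_prop)
  exact ⟨Y, hY, fun Z hZ => hmax hZ⟩

/-- Every graph has an SDP estimate: solve the program and take the signs of the first row. -/
theorem exists_isSDPEstimate {n : ℕ} (A : CensoredGraph n) : ∃ s, IsSDPEstimate A s := by
  obtain ⟨Y, hY⟩ := exists_isSDPSolution A
  rcases n with _ | n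
  · exact ⟨1, fun i => i.elim0, Y, hY, fun σ _ => Or.inl (funext fun i => i.elim0)⟩
  · refine ⟨fun i => if Y 0 i < 0 then -1 else 1, ?_, Y, hY, ?_⟩
    · intro i hi
      obtain rfl : i = 0 := Fin.ext hi
      simp [hY.1.2]
    · rintro σ rfl
      rcases Int.units_eq_one_or (σ 0) with h0 | h0
      · left; funext i
        rcases Int.units_eq_one_or (σ i) with h | h <;> simp [outer, h0, h]
      · right; funext i
        rcases Int.units_eq_one_or (σ i) with h | h <;> simp [outer, h0, h]

/-! ### The subsampling stability mechanism -/

/-- `count s`: the number of votes for the labelling `s`. -/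
def count {n m : ℕ} (v : Fin m → Labeling n) (s : Labeling n) : ℕ :=
  (Finset.univ.filter fun k => v k = s).card

theorem exists_mode {n m : ℕ} (v : Fin m → Labeling n) :
    ∃ s : Labeling n, ∀ t, count v t ≤ count v s := by
  obtain ⟨s, -, hs⟩ := Finset.exists_max_image (Finset.univ : Finset (Labeling n)) (count v)
    Finset.univ_nonempty
  exact ⟨s, fun t => hs t (Finset.mem_univ t)⟩

/-- A most frequent labelling. -/
def mode {n m : ℕ} (v : Fin m → Labeling n) : Labeling n := (exists_mode v).choose

/-- The largest bin of the histogram. -/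
def count₁ {n m : ℕ} (v : Fin m → Labeling n) : ℕ := count v (mode v)

/-- The second largest bin of the histogram (equal to the largest one in case of a tie). -/
def count₂ {n m : ℕ} (v : Fin m → Labeling n) : ℕ :=
  (Finset.univ.erase (mode v)).sup (count v)

/-- The edge sampling probability `ε / (32 log n)`, capped at `1`. -/
def sampleProb (n : ℕ) (ε : ℝ) : ℝ := min (ε / (32 * Real.log n)) 1

/-- The number `log (n / δ) / q²` of subgraphs, rounded up. -/
def numSubgraphs (n : ℕ) (ε δ : ℝ) : ℕ := ⌈Real.log (n / δ) / sampleProb n ε ^ 2⌉₊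

/-- The centred Laplace distribution `Lap(0, b)`. -/
def laplace (b : ℝ) : Measure ℝ :=
  volume.withDensity fun x => ENNReal.ofReal ((2 * b)⁻¹ * Real.exp (-|x| / b))

/-- The internal randomness of the mechanism: the edges kept in each of the `m` subgraphs, the
noise, and the random label vector that replaces the answer `⊥`. -/
abbrev Randomness (n m : ℕ) : Type := (Fin m → VertexPair n → Bool) × ℝ × Labeling n

/-- In every subgraph, each edge is kept independently with probability `q`. -/
def maskMeasure (n m : ℕ) (q : ℝ) : Measure (Fin m → VertexPair n → Bool) :=
  Measure.pi fun _ => Measure.pi fun _ =>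
    ENNReal.ofReal q • Measure.dirac true + ENNReal.ofReal (1 - q) • Measure.dirac false

/-- The three sources of randomness are independent; the noise is `Lap(0, 1 / ε)` and the random
label vector is uniform on `{-1, +1}ⁿ`. -/
def mechanismMeasure (n : ℕ) (ε δ : ℝ) : Measure (Randomness n (numSubgraphs n ε δ)) :=
  (maskMeasure n (numSubgraphs n ε δ) (sampleProb n ε)).prod
    ((laplace (1 / ε)).prod (PMF.uniformOfFintype (Labeling n)).toMeasure)

/-- The subgraph of `A` that consists of the kept edges. -/
def subsample {n : ℕ} (A : CensoredGraph n) (keep : VertexPair n → Bool) : CensoredGraph n :=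
  fun e => if keep e then A e else 0

/-- The proxy `(count₁ - count₂) / (4 m q) - 1` for the distance to instability. -/
def stabilityProxy {n m : ℕ} (q : ℝ) (v : Fin m → Labeling n) : ℝ :=
  ((count₁ v : ℝ) - count₂ v) / (4 * m * q) - 1

open Classical in
/-- The output of the mechanism with the non-private estimator `est` on the graph `A`, as a
function of the internal randomness: the mode of the estimates on the subgraphs if the noisy
stability proxy exceeds `log (1 / δ) / ε`, and the random label vector otherwise. -/
def mechanism {n : ℕ} (est : CensoredGraph n → Labeling n) (ε δ : ℝ) (A : CensoredGraph n)
    (ω : Randomness n (numSubgraphs n ε δ)) : Labeling n :=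
  let v : Fin (numSubgraphs n ε δ) → Labeling n := fun k => est (subsample A (ω.1 k))
  if Real.log (1 / δ) / ε < stabilityProxy (sampleProb n ε) v + ω.2.1 then mode v else ω.2.2

/-! ### Privacy and exact recovery -/

/-- `(ε, δ)`-edge central differential privacy of a randomized estimator `M` with internal
randomness `ω` distributed according to `μ`: the bound holds for all pairs of graphs that differ
in exactly one edge and for all sets of outputs. -/
def IsEdgeCDP {n : ℕ} {Ω : Type*} [MeasurableSpace Ω] (μ : Measure Ω)
    (M : CensoredGraph n → Ω → Labeling n) (ε δ : ℝ) : Prop :=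
  ∀ A A' : CensoredGraph n, hammingDist A A' = 1 → ∀ S : Set (Labeling n),
    μ {ω | M A ω ∈ S} ≤
      ENNReal.ofReal (Real.exp ε) * μ {ω | M A' ω ∈ S} + ENNReal.ofReal δ

/-- The probability, over the graph `A ∼ CBM(σ, p, ζ)` and over the internal randomness, that the
randomized estimator `M` returns the true labels `σ` up to a global flip. -/
def recoveryProb {n : ℕ} {Ω : Type*} [MeasurableSpace Ω] (μ : Measure Ω)
    (M : CensoredGraph n → Ω → Labeling n) (σ : Labeling n) (p ζ : ℝ) : ℝ :=
  ((cbm σ p ζ).prod μ).real {x | M x.1 x.2 = σ ∨ M x.1 x.2 = -σ}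

end CensoredBlockModel

end

namespace CensoredBlockModel

/-! ### The Laplace distribution -/

/-! Privacy uses nothing about the estimator. Run the mechanism on two neighbouring graphs with the
same masks. By Hoeffding and the choice of `m`, the differing pair is kept in at most `2mq`
subgraphs outside an event of probability at most `δ` (`maskMeasure_card_gt_le`), so at most `2mq`
votes change. If the mode is the same, the gap between the two largest counts moves by at most `4mq`
and the proxy by at most `1`; if the modes differ, the gap was at most `4mq` and the proxy was
nonpositive. In the first case Laplace noise costs a factor `exp ε`; in the second a mode is
released with probability at most `δ` (`noisy_threshold_le`). The two `δ` add up.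

For recovery, a single gauged subsample is a homogeneous model with density `q p`
(`measurePreserving_gauge_subsample`). The program has `σ σᵀ` as its only solution once the signed
Laplacian of the gauged graph is positive definite modulo constants (`eq_outer_of_isRigid`). Put `d
= n q p` and `H = (√(1-ζ) - √ζ)²`; the assumption on `a` says `log n ≤ H d`, with no margin.

Rigidity is deduced from deterministic conditions (`isRigid_of_pseudorandom`). On vertices of signed
degree at least `κ d` the degrees dominate the quadratic form: its small entries are controlled by
discrepancy against sign vectors, its large ones by local sparsity and the maximal degree. The
vertices of lower signed degree are few, pairwise nonadjacent and without common neighbours, so a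
large constant lower bound on their signed degrees suffices. That bound is the only condition
without slack: Chernoff and a union bound give just `n exp(-H d) ≤ 1`. The missing decay comes from
the point probabilities of the optimally tilted signed degree, which are small by a Fejér-kernel
estimate (`measureReal_signedDegree_eq_le`).

Finally, Markov's inequality for the number of nonrigid subgraphs, which needs no independence
between them, makes all but a small fraction of the votes agree. The proxy is then close to `8 log n
/ ε - 1`, while the threshold is `2 log n / ε`; the difference explains the constant `6`
(`one_sub_le_recoveryProb`). -/

theorem laplace_eq {ε : ℝ} (hε : 0 < ε) :
    laplace (1 / ε) =
      volume.withDensity fun x => ENNReal.ofReal (ε / 2 * Real.exp (-(ε * |x|))) := by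
  unfold laplace
  congr 1
  funext x
  congr 2
  · field_simp
  · congr 1; field_simp

theorem measurable_laplace_density (ε : ℝ) :
    Measurable fun x : ℝ => ENNReal.ofReal (ε / 2 * Real.exp (-(ε * |x|))) := by
  fun_prop

theorem isProbabilityMeasure_laplace {ε : ℝ} (hε : 0 < ε) :
    IsProbabilityMeasure (laplace (1 / ε)) := by
  constructor
  rw [laplace_eq hε, withDensity_apply _ MeasurableSet.univ, setLIntegral_univ]
  have h1 : ∫ x : ℝ, ε / 2 * Real.exp (-(ε * |x|)) = 1 := by
    rw [integral_const_mul, integral_comp_abs (f := fun x => Real.exp (-(ε * x))),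
      integral_comp_mul_left_Ioi (fun x => Real.exp (-x)) 0 hε, mul_zero,
      integral_exp_neg_Ioi_zero]
    simp; field_simp
  -- The Bochner integral of a nonintegrable function is `0` by convention, so the value `1` already
  -- proves integrability.
  have hint : Integrable fun x : ℝ => ε / 2 * Real.exp (-(ε * |x|)) := by
    by_contra h
    rw [integral_undef h] at h1
    exact zero_ne_one h1
  rw [← ofReal_integral_eq_lintegral_ofReal hint (Eventually.of_forall fun x => by positivity), h1,
    ENNReal.ofReal_one]

/-- Translating the Laplace distribution by `h` changes probabilities by a factor at most
`exp (ε |h|)`. -/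
theorem laplace_shift_le {ε : ℝ} (hε : 0 < ε) (h : ℝ) {s t : Set ℝ} (hs : MeasurableSet s)
    (ht : MeasurableSet t) (hst : ∀ x ∈ s, x + h ∈ t) :
    laplace (1 / ε) s ≤ ENNReal.ofReal (Real.exp (ε * |h|)) * laplace (1 / ε) t := by
  -- Only the integral on the right is translated by `h`; the densities at `x` and `x + h` can then
  -- be compared pointwise.
  rw [laplace_eq hε, withDensity_apply _ hs, withDensity_apply _ ht, ← lintegral_indicator hs,
    ← lintegral_indicator ht, ← lintegral_const_mul _ (by
      exact (measurable_laplace_density ε).indicator ht),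
    ← lintegral_add_right_eq_self (fun x => ENNReal.ofReal (Real.exp (ε * |h|)) *
      t.indicator (fun x => ENNReal.ofReal (ε / 2 * Real.exp (-(ε * |x|)))) x) h]
  refine lintegral_mono fun x => ?_
  by_cases hx : x ∈ s
  · rw [Set.indicator_of_mem hx, Set.indicator_of_mem (hst x hx),
      ← ENNReal.ofReal_mul (by positivity)]
    refine ENNReal.ofReal_le_ofReal ?_
    rw [mul_left_comm, ← Real.exp_add]
    have : |x + h| ≤ |x| + |h| := abs_add_le _ _
    gcongr
    nlinarith
  · rw [Set.indicator_of_notMem hx]; exact zero_le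

/-- On the positive half-line, translation by `t` multiplies the density by exactly `exp (-(ε t))`.
The exact factor `1/2` is dropped. -/
theorem laplace_Ioi_le {ε : ℝ} (hε : 0 < ε) {t : ℝ} (ht : 0 ≤ t) :
    laplace (1 / ε) (Set.Ioi t) ≤ ENNReal.ofReal (Real.exp (-(ε * t))) := by
  have hprob := isProbabilityMeasure_laplace hε
  calc laplace (1 / ε) (Set.Ioi t)
      ≤ ENNReal.ofReal (Real.exp (-(ε * t))) * laplace (1 / ε) (Set.Ioi 0) := by
        rw [laplace_eq hε, withDensity_apply _ measurableSet_Ioi,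
          withDensity_apply _ measurableSet_Ioi, ← lintegral_indicator measurableSet_Ioi,
          ← lintegral_indicator measurableSet_Ioi, ← lintegral_const_mul _ (by
            exact (measurable_laplace_density ε).indicator measurableSet_Ioi),
          ← lintegral_add_right_eq_self _ t]
        refine lintegral_mono fun x => ?_
        by_cases hx : 0 < x
        · rw [Set.indicator_of_mem (by simpa using hx), Set.indicator_of_mem (by simpa using hx),
            ← ENNReal.ofReal_mul (by positivity), mul_left_comm, ← Real.exp_add,
            abs_of_nonneg (by linarith), abs_of_pos hx]
          refine ENNReal.ofReal_le_ofReal (le_of_eq ?_)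
          ring_nf
        · rw [Set.indicator_of_notMem (by simpa using hx)]; exact zero_le
    _ ≤ _ := mul_le_of_le_one_right' prob_le_one

theorem laplace_Iic_neg_le {ε : ℝ} (hε : 0 < ε) {t : ℝ} (ht : 0 ≤ t) :
    laplace (1 / ε) (Set.Iic (-t)) ≤ ENNReal.ofReal (Real.exp (-(ε * t))) := by
  have hneg : laplace (1 / ε) (Set.Iic (-t)) = laplace (1 / ε) (Set.Ici t) := by
    rw [laplace_eq hε, withDensity_apply _ measurableSet_Iic,
      withDensity_apply _ measurableSet_Ici, ← lintegral_indicator measurableSet_Iic,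
      ← lintegral_indicator measurableSet_Ici, ← lintegral_neg_eq_self]
    refine lintegral_congr fun x => ?_
    simp only [Set.indicator, Set.mem_Iic, Set.mem_Ici, neg_le_neg_iff, abs_neg]
  have hIci : laplace (1 / ε) (Set.Ici t) = laplace (1 / ε) (Set.Ioi t) := by
    rw [laplace_eq hε, withDensity_apply _ measurableSet_Ici,
      withDensity_apply _ measurableSet_Ioi, setLIntegral_congr Ioi_ae_eq_Ici]
  rw [hneg, hIci]
  exact laplace_Ioi_le hε ht

/-! ### Sampling of edges -/

theorem sampleProb_pos {n : ℕ} (hn : 2 ≤ n) {ε : ℝ} (hε : 0 < ε) : 0 < sampleProb n ε := by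
  have : 0 < Real.log n := Real.log_pos (by exact_mod_cast hn)
  unfold sampleProb
  positivity

theorem sampleProb_le_one (n : ℕ) (ε : ℝ) : sampleProb n ε ≤ 1 := min_le_right _ _

theorem isProbabilityMeasure_bernoulli {q : ℝ} (h0 : 0 ≤ q) (h1 : q ≤ 1) :
    IsProbabilityMeasure
      (ENNReal.ofReal q • Measure.dirac true + ENNReal.ofReal (1 - q) • Measure.dirac false) := by
  constructor
  simp only [Measure.coe_add, Measure.coe_smul, Pi.add_apply, Pi.smul_apply, measure_univ,
    smul_eq_mul, mul_one]
  rw [← ENNReal.ofReal_add h0 (by linarith)]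
  simp

theorem isProbabilityMeasure_maskMeasure {q : ℝ} (h0 : 0 ≤ q) (h1 : q ≤ 1) (n m : ℕ) :
    IsProbabilityMeasure (maskMeasure n m q) := by
  have := isProbabilityMeasure_bernoulli h0 h1
  unfold maskMeasure
  infer_instance

theorem isProbabilityMeasure_mechanismMeasure {n : ℕ} (hn : 2 ≤ n) {ε : ℝ} (hε : 0 < ε) (δ : ℝ) :
    IsProbabilityMeasure (mechanismMeasure n ε δ) := by
  have := isProbabilityMeasure_maskMeasure (sampleProb_pos hn hε).le (sampleProb_le_one n ε) n
    (numSubgraphs n ε δ)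
  have := isProbabilityMeasure_laplace hε
  unfold mechanismMeasure
  infer_instance

open ProbabilityTheory in
/-- Hoeffding's bound for the number of subgraphs that contain a given edge. -/
theorem maskMeasure_card_gt_le {q : ℝ} (h0 : 0 < q) (h1 : q ≤ 1) {n m : ℕ} (hm : 0 < m)
    (e : VertexPair n) :
    maskMeasure n m q {g | 2 * m * q < ((Finset.univ.filter fun k => g k e = true).card : ℝ)} ≤
      ENNReal.ofReal (Real.exp (-(2 * m * q ^ 2))) := by
  have hb := isProbabilityMeasure_bernoulli h0.le h1
  have hprob := isProbabilityMeasure_maskMeasure h0.le h1 n m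
  set β : Measure Bool :=
    ENNReal.ofReal q • Measure.dirac true + ENNReal.ofReal (1 - q) • Measure.dirac false with hβ
  set ν : Measure (VertexPair n → Bool) := Measure.pi fun _ => β with hν
  have hmask : maskMeasure n m q = Measure.pi fun _ : Fin m => ν := rfl
  set Y : (VertexPair n → Bool) → ℝ := fun h => if h e = true then 1 else 0 with hY
  have hYm : Measurable Y := Measurable.of_discrete
  have hYmean : ∫ h, Y h ∂ν = q := by
    have : ∫ h, Y h ∂ν = ∫ b, (if b = true then (1 : ℝ) else 0) ∂β := by
      exact integral_comp_eval (μ := fun _ : VertexPair n => β) (i := e)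
        (f := fun b : Bool => if b = true then (1 : ℝ) else 0)
        Measurable.of_discrete.aestronglyMeasurable
    have hf1 : IsFiniteMeasure (ENNReal.ofReal q • Measure.dirac true) :=
      Measure.smul_finite _ ENNReal.ofReal_ne_top
    have hf2 : IsFiniteMeasure (ENNReal.ofReal (1 - q) • Measure.dirac false) :=
      Measure.smul_finite _ ENNReal.ofReal_ne_top
    rw [this, hβ, integral_add_measure .of_finite .of_finite, integral_smul_measure,
      integral_smul_measure, integral_dirac, integral_dirac]
    simp [ENNReal.toReal_ofReal h0.le]
  have hindep : iIndepFun (fun (k : Fin m) (g : Fin m → VertexPair n → Bool) => Y (g k) - q)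
      (maskMeasure n m q) := by
    rw [hmask]
    exact iIndepFun_pi (X := fun _ h => Y h - q)
      (fun k => (hYm.sub_const q).aemeasurable)
  have hsub : ∀ k ∈ (Finset.univ : Finset (Fin m)),
      HasSubgaussianMGF (fun g : Fin m → VertexPair n → Bool => Y (g k) - q)
        ((‖(1 : ℝ) - 0‖₊ / 2) ^ 2) (maskMeasure n m q) := by
    intro k _
    have hmean : ∫ g, Y (g k) ∂(maskMeasure n m q) = q := by
      rw [hmask, ← hYmean]
      exact integral_comp_eval (μ := fun _ : Fin m => ν) hYm.aestronglyMeasurable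
    have := hasSubgaussianMGF_of_mem_Icc (μ := maskMeasure n m q)
      (X := fun g : Fin m → VertexPair n → Bool => Y (g k)) (a := 0) (b := 1)
      (hYm.comp (measurable_pi_apply k)).aemeasurable
      (Eventually.of_forall fun g => by
        simp only [hY]; split_ifs <;> simp)
    rwa [hmean] at this
  -- The deviation `m q` equals the mean, so the count doubles. Each summand lies in an interval of
  -- length one, hence has variance proxy `1/4`, and the exponent is `2 (m q)² / m`.
  have hH := HasSubgaussianMGF.measure_sum_ge_le_of_iIndepFun hindep hsub
    (ε := m * q) (by positivity)
  have hmR : (0 : ℝ) < m := by exact_mod_cast hm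
  calc _ ≤ maskMeasure n m q {g | m * q ≤ ∑ k ∈ (Finset.univ : Finset (Fin m)), (Y (g k) - q)} := by
        refine measure_mono fun g hg => ?_
        simp only [Set.mem_ofPred_eq] at hg ⊢
        rw [Finset.sum_sub_distrib]
        simp only [hY, Finset.sum_boole, Finset.sum_const, Finset.card_univ, Fintype.card_fin,
          nsmul_eq_mul]
        linarith
    _ ≤ _ := by
        rw [← ofReal_measureReal]
        refine ENNReal.ofReal_le_ofReal (hH.trans (le_of_eq ?_))
        congr 1
        simp
        field_simp

/-! ### Sensitivity of the histogram -/

theorem count_le_count₁ {n m : ℕ} (v : Fin m → Labeling n) (s : Labeling n) :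
    count v s ≤ count₁ v := (exists_mode v).choose_spec s

theorem count_le_count₂ {n m : ℕ} (v : Fin m → Labeling n) {s : Labeling n} (h : s ≠ mode v) :
    count v s ≤ count₂ v :=
  Finset.le_sup (f := count v) (Finset.mem_erase.2 ⟨h, Finset.mem_univ s⟩)

theorem count_le_add {n m : ℕ} (v w : Fin m → Labeling n) (s : Labeling n) :
    count v s ≤ count w s + (Finset.univ.filter fun k => v k ≠ w k).card := by
  unfold count
  refine (Finset.card_le_card fun k hk => ?_).trans (Finset.card_union_le _ _)
  simp only [Finset.mem_filter, Finset.mem_univ, true_and, Finset.mem_union] at hk ⊢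
  by_cases h : v k = w k
  · exact Or.inl (h ▸ hk)
  · exact Or.inr h

theorem count₁_le_add {n m : ℕ} (v w : Fin m → Labeling n) :
    count₁ v ≤ count₁ w + (Finset.univ.filter fun k => v k ≠ w k).card :=
  (count_le_add v w (mode v)).trans (by gcongr; exact count_le_count₁ w _)

theorem count₂_le_add {n m : ℕ} {v w : Fin m → Labeling n} (h : mode v = mode w) :
    count₂ v ≤ count₂ w + (Finset.univ.filter fun k => v k ≠ w k).card := by
  refine Finset.sup_le fun s hs => (count_le_add v w s).trans ?_
  gcongr
  exact count_le_count₂ w (h ▸ (Finset.mem_erase.1 hs).1)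

/-- Pass from `v` to `w`, use that `mode w` wins there, and pass back: each passage costs the number
of changed votes, and `mode w` is a runner-up for `v`. -/
theorem count₁_le_of_mode_ne {n m : ℕ} {v w : Fin m → Labeling n} (h : mode v ≠ mode w) :
    count₁ v ≤ count₂ v + 2 * (Finset.univ.filter fun k => v k ≠ w k).card := by
  have h1 := count_le_add v w (mode v)
  have h2 : count w (mode v) ≤ count w (mode w) := count_le_count₁ w _
  have h3 := count_le_add w v (mode w)
  have h4 := count_le_count₂ v h.symm
  have h5 : (Finset.univ.filter fun k => w k ≠ v k) = Finset.univ.filter fun k => v k ≠ w k := by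
    simp only [ne_comm]
  rw [h5] at h3
  unfold count₁
  omega

/-- Both of the largest counts move by at most `2mq`, in opposite directions at worst; this is why
the proxy is normalized by `4mq`. A common mode is needed so that `count₂` maximizes over the same
labellings. -/
theorem stabilityProxy_le_add_one {n m : ℕ} {q : ℝ} (hm : 0 < m) (hq : 0 < q)
    {v w : Fin m → Labeling n} (hmode : mode v = mode w)
    (hd : ((Finset.univ.filter fun k => v k ≠ w k).card : ℝ) ≤ 2 * m * q) :
    stabilityProxy q v ≤ stabilityProxy q w + 1 := by
  have hm' : (0 : ℝ) < m := by exact_mod_cast hm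
  have h1 : (count₁ v : ℝ) ≤ count₁ w + (Finset.univ.filter fun k => v k ≠ w k).card := by
    exact_mod_cast count₁_le_add v w
  have h2 : (count₂ w : ℝ) ≤ count₂ v + (Finset.univ.filter fun k => v k ≠ w k).card := by
    have := count₂_le_add hmode.symm
    simp only [ne_comm (a := w _)] at this
    exact_mod_cast this
  unfold stabilityProxy
  have : ((count₁ v : ℝ) - count₂ v) / (4 * m * q) ≤
      (count₁ w - count₂ w + 4 * m * q) / (4 * m * q) := by
    gcongr
    linarith
  rw [add_div, div_self (by positivity)] at this
  linarith

theorem stabilityProxy_nonpos {n m : ℕ} {q : ℝ} (hm : 0 < m) (hq : 0 < q)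
    {v w : Fin m → Labeling n} (hmode : mode v ≠ mode w)
    (hd : ((Finset.univ.filter fun k => v k ≠ w k).card : ℝ) ≤ 2 * m * q) :
    stabilityProxy q v ≤ 0 := by
  have hm' : (0 : ℝ) < m := by exact_mod_cast hm
  have h1 : (count₁ v : ℝ) ≤ count₂ v + 2 * (Finset.univ.filter fun k => v k ≠ w k).card := by
    exact_mod_cast count₁_le_of_mode_ne hmode
  unfold stabilityProxy
  rw [sub_nonpos, div_le_one (by positivity)]
  linarith

/-! ### Privacy -/

theorem measurable_mechanism {n : ℕ} (est : CensoredGraph n → Labeling n) (ε δ : ℝ)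
    (A : CensoredGraph n) : Measurable (mechanism est ε δ A) := by
  unfold mechanism
  refine Measurable.ite (measurableSet_lt measurable_const ?_) ?_ ?_
  · exact (Measurable.of_discrete (f := fun g : Fin (numSubgraphs n ε δ) → VertexPair n → Bool =>
      stabilityProxy (sampleProb n ε) fun k => est (subsample A (g k)))).comp measurable_fst
      |>.add (measurable_fst.comp measurable_snd)
  · exact (Measurable.of_discrete (f := fun g : Fin (numSubgraphs n ε δ) → VertexPair n → Bool =>
      mode fun k => est (subsample A (g k)))).comp measurable_fst
  · exact measurable_snd.comp measurable_snd

open Classical in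
/-- The law of the output for a given histogram with mode `s` and stability proxy `d`. -/
theorem noisy_threshold_apply {n : ℕ} {ε : ℝ} (hε : 0 < ε) (c d : ℝ) (s : Labeling n)
    (S : Set (Labeling n)) (U : Measure (Labeling n)) [IsProbabilityMeasure U] :
    ((laplace (1 / ε)).prod U) {x | (if c < d + x.1 then s else x.2) ∈ S} =
      (if s ∈ S then laplace (1 / ε) (Set.Ioi (c - d)) else 0) +
        laplace (1 / ε) (Set.Iic (c - d)) * U S := by
  have hprob := isProbabilityMeasure_laplace hε
  have hset : {x : ℝ × Labeling n | (if c < d + x.1 then s else x.2) ∈ S} =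
      Set.Ioi (c - d) ×ˢ {_u | s ∈ S} ∪ Set.Iic (c - d) ×ˢ S := by
    ext ⟨x, u⟩
    simp only [Set.mem_ofPred_eq, Set.mem_union, Set.mem_prod, Set.mem_Ioi, Set.mem_Iic]
    by_cases h : c < d + x
    · have h1 : c - d < x := by linarith
      simp [h, h1, not_le.2 h1]
    · have h1 : x ≤ c - d := by linarith
      simp [h, h1, not_lt.2 h1]
  rw [hset, measure_union _ (measurableSet_Iic.prod MeasurableSet.of_discrete), Measure.prod_prod,
    Measure.prod_prod]
  · by_cases h : s ∈ S <;> simp [h]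
  · rw [Set.disjoint_left]
    rintro ⟨x, u⟩ ⟨h1, -⟩ ⟨h2, -⟩
    simp only [Set.mem_Ioi, Set.mem_Iic] at h1 h2
    linarith

open Classical in
-- This is the privacy of the release step for fixed masks. Translating the noise by `d - d'`
-- compares both branches when the modes agree. When they differ, only the fallback branch is
-- compared, and the release branch is charged to `δ`: with `d ≤ 0` it needs noise above `log (1/δ)
-- / ε`.
theorem noisy_threshold_le {n : ℕ} {ε δ : ℝ} (hε : 0 < ε) (hδ : 0 < δ) (hδ1 : δ ≤ 1)
    {d d' : ℝ} {s s' : Labeling n} (S : Set (Labeling n)) (U : Measure (Labeling n))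
    [IsProbabilityMeasure U] (hd : |d - d'| ≤ 1) (hdiff : s ≠ s' → d ≤ 0) :
    ((laplace (1 / ε)).prod U)
        {x | (if Real.log (1 / δ) / ε < d + x.1 then s else x.2) ∈ S} ≤
      ENNReal.ofReal (Real.exp ε) * ((laplace (1 / ε)).prod U)
        {x | (if Real.log (1 / δ) / ε < d' + x.1 then s' else x.2) ∈ S} + ENNReal.ofReal δ := by
  have hprob := isProbabilityMeasure_laplace hε
  set c := Real.log (1 / δ) / ε with hc
  have hc0 : 0 ≤ c := by
    refine div_nonneg (Real.log_nonneg ?_) hε.le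
    rw [le_div_iff₀ hδ]; linarith
  have hcδ : Real.exp (-(ε * c)) = δ := by
    rw [hc, mul_div_cancel₀ _ hε.ne', one_div, Real.log_inv, neg_neg, Real.exp_log hδ]
  have hshift : ENNReal.ofReal (Real.exp (ε * |d - d'|)) ≤ ENNReal.ofReal (Real.exp ε) :=
    ENNReal.ofReal_le_ofReal (Real.exp_le_exp.2 (by nlinarith))
  have hIoi : laplace (1 / ε) (Set.Ioi (c - d)) ≤
      ENNReal.ofReal (Real.exp ε) * laplace (1 / ε) (Set.Ioi (c - d')) := by
    refine (laplace_shift_le hε (d - d') measurableSet_Ioi measurableSet_Ioi ?_).trans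
      (mul_le_mul_left hshift _)
    intro x hx
    simp only [Set.mem_Ioi] at hx ⊢
    linarith
  have hIic : laplace (1 / ε) (Set.Iic (c - d)) ≤
      ENNReal.ofReal (Real.exp ε) * laplace (1 / ε) (Set.Iic (c - d')) := by
    refine (laplace_shift_le hε (d - d') measurableSet_Iic measurableSet_Iic ?_).trans
      (mul_le_mul_left hshift _)
    intro x hx
    simp only [Set.mem_Iic] at hx ⊢
    linarith
  rw [noisy_threshold_apply hε, noisy_threshold_apply hε, mul_add, ← mul_assoc]
  by_cases hs : s = s'
  · subst hs
    refine le_add_right (add_le_add ?_ (mul_le_mul_left hIic _))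
    split_ifs
    · exact hIoi
    · simp
  · have htail : laplace (1 / ε) (Set.Ioi (c - d)) ≤ ENNReal.ofReal δ := by
      have hd0 := hdiff hs
      refine (measure_mono (Set.Ioi_subset_Ioi (by linarith : c ≤ c - d))).trans ?_
      rw [← hcδ]
      exact laplace_Ioi_le hε hc0
    rw [add_comm]
    refine add_le_add (le_add_left (mul_le_mul_left hIic _)) ?_
    split_ifs
    · exact htail
    · simp

theorem count₂_le_count₁ {n m : ℕ} (v : Fin m → Labeling n) : count₂ v ≤ count₁ v :=
  Finset.sup_le fun s _ => count_le_count₁ v s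

theorem neg_one_le_stabilityProxy {n m : ℕ} {q : ℝ} (hq : 0 ≤ q) (v : Fin m → Labeling n) :
    -1 ≤ stabilityProxy q v := by
  have h : (count₂ v : ℝ) ≤ count₁ v := by exact_mod_cast count₂_le_count₁ v
  have : 0 ≤ ((count₁ v : ℝ) - count₂ v) / (4 * m * q) :=
    div_nonneg (by linarith) (by positivity)
  unfold stabilityProxy
  linarith

/-- If the modes differ, both proxies lie in `[-1, 0]`, so the sensitivity is still at most one
although `count₂` itself is not compared. -/
theorem abs_stabilityProxy_sub_le {n m : ℕ} {q : ℝ} (hm : 0 < m) (hq : 0 < q)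
    {v w : Fin m → Labeling n}
    (hd : ((Finset.univ.filter fun k => v k ≠ w k).card : ℝ) ≤ 2 * m * q) :
    |stabilityProxy q v - stabilityProxy q w| ≤ 1 := by
  have hd' : ((Finset.univ.filter fun k => w k ≠ v k).card : ℝ) ≤ 2 * m * q := by
    simpa only [ne_comm] using hd
  rw [abs_le]
  by_cases h : mode v = mode w
  · have := stabilityProxy_le_add_one hm hq h hd
    have := stabilityProxy_le_add_one hm hq h.symm hd'
    constructor <;> linarith
  · have := stabilityProxy_nonpos hm hq h hd
    have := stabilityProxy_nonpos hm hq (Ne.symm h) hd'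
    have := neg_one_le_stabilityProxy hq.le v
    have := neg_one_le_stabilityProxy hq.le w
    constructor <;> linarith

theorem subsample_congr {n : ℕ} {A A' : CensoredGraph n} {e : VertexPair n}
    (hA : ∀ e' ≠ e, A e' = A' e') {g : VertexPair n → Bool} (hg : g e ≠ true) :
    subsample A g = subsample A' g := by
  funext e'
  unfold subsample
  by_cases h : e' = e
  · subst h; simp [hg]
  · rw [hA e' h]

/-- The subsampling stability mechanism is private for every non-private estimator. -/
theorem isEdgeCDP_mechanism {n : ℕ} (hn : 2 ≤ n) (est : CensoredGraph n → Labeling n) {ε δ : ℝ}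
    (hε : 0 < ε) (hδ : 0 < δ) :
    IsEdgeCDP (mechanismMeasure n ε δ) (mechanism est ε δ) ε (2 * δ) := by
  intro A A' hAA' S
  have hprob := isProbabilityMeasure_mechanismMeasure hn hε δ
  -- For `2δ ≥ 1` the claim is trivial; otherwise `n / δ > 1`, which makes the number of subgraphs
  -- positive.
  rcases le_or_gt (1 / 2) δ with hδ2 | hδ2
  · refine prob_le_one.trans (le_add_left ?_)
    rw [← ENNReal.ofReal_one]
    exact ENNReal.ofReal_le_ofReal (by linarith)
  set q := sampleProb n ε with hq
  set m := numSubgraphs n ε δ with hm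
  have hq0 : 0 < q := sampleProb_pos hn hε
  have hq1 : q ≤ 1 := sampleProb_le_one n ε
  have hn' : (2 : ℝ) ≤ n := by exact_mod_cast hn
  have hlog : 0 < Real.log (n / δ) := by
    refine Real.log_pos ?_
    rw [lt_div_iff₀ hδ]; linarith
  have hmq : Real.log (n / δ) ≤ m * q ^ 2 := by
    have := Nat.le_ceil (Real.log (n / δ) / q ^ 2)
    rwa [div_le_iff₀ (by positivity)] at this
  have hm0 : 0 < m := Nat.ceil_pos.2 (by positivity)
  obtain ⟨e, he⟩ : ∃ e, ∀ e' ≠ e, A e' = A' e' := by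
    unfold hammingDist at hAA'
    obtain ⟨e, he⟩ := Finset.card_eq_one.1 hAA'
    refine ⟨e, fun e' h => ?_⟩
    by_contra hne
    have : e' ∈ ({e} : Finset _) := he ▸ (by simp [hne])
    exact h (by simpa using this)
  -- Only subgraphs that keep the differing pair can change their estimate. The bad masks keep it
  -- more than twice as often as expected.
  set bad : Set (Fin m → VertexPair n → Bool) :=
    {g | 2 * m * q < ((Finset.univ.filter fun k => g k e = true).card : ℝ)} with hbad
  have hbadle : maskMeasure n m q bad ≤ ENNReal.ofReal δ := by
    refine (maskMeasure_card_gt_le hq0 hq1 hm0 e).trans (ENNReal.ofReal_le_ofReal ?_)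
    calc Real.exp (-(2 * m * q ^ 2)) ≤ Real.exp (-Real.log (n / δ)) :=
          Real.exp_le_exp.2 (by nlinarith)
      _ = δ / n := by
          rw [Real.exp_neg, Real.exp_log (by positivity), inv_div]
      _ ≤ δ := div_le_self hδ.le (by linarith)
  set κ := (laplace (1 / ε)).prod (PMF.uniformOfFintype (Labeling n)).toMeasure with hκ
  have hlap := isProbabilityMeasure_laplace hε
  have hmask := isProbabilityMeasure_maskMeasure hq0.le hq1 n m
  -- Conditioning on the masks couples the two runs: the comparison is made mask by mask.
  have hslice : ∀ B : CensoredGraph n, mechanismMeasure n ε δ {ω | mechanism est ε δ B ω ∈ S} =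
      ∫⁻ g, κ {x | mechanism est ε δ B (g, x) ∈ S} ∂(maskMeasure n m q) := fun B =>
    Measure.prod_apply (measurable_mechanism est ε δ B MeasurableSet.of_discrete)
  have hpt : ∀ g, κ {x | mechanism est ε δ A (g, x) ∈ S} ≤
      ENNReal.ofReal (Real.exp ε) * κ {x | mechanism est ε δ A' (g, x) ∈ S} +
        (ENNReal.ofReal δ + bad.indicator 1 g) := by
    intro g
    by_cases hg : g ∈ bad
    · refine prob_le_one.trans (le_add_left (le_add_left ?_))
      simp [hg]
    · have hcard : ((Finset.univ.filter fun k => est (subsample A (g k)) ≠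
          est (subsample A' (g k))).card : ℝ) ≤ 2 * m * q := by
        refine le_trans ?_ (not_lt.1 hg)
        gcongr with k
        intro hk
        by_contra h
        exact hk (by rw [subsample_congr he h])
      rw [Set.indicator_of_notMem hg, add_zero]
      exact noisy_threshold_le hε hδ (by linarith) S _
        (abs_stabilityProxy_sub_le hm0 hq0 hcard)
        (fun h => stabilityProxy_nonpos hm0 hq0 h hcard)
  rw [hslice, hslice]
  calc _ ≤ ∫⁻ g, (ENNReal.ofReal (Real.exp ε) * κ {x | mechanism est ε δ A' (g, x) ∈ S} +
        (ENNReal.ofReal δ + bad.indicator 1 g)) ∂(maskMeasure n m q) := lintegral_mono hpt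
    _ = ENNReal.ofReal (Real.exp ε) *
          (∫⁻ g, κ {x | mechanism est ε δ A' (g, x) ∈ S} ∂(maskMeasure n m q)) +
        (ENNReal.ofReal δ + maskMeasure n m q bad) := by
        rw [lintegral_add_left .of_discrete, lintegral_add_left .of_discrete,
          lintegral_const_mul _ .of_discrete, lintegral_const, measure_univ, mul_one,
          lintegral_indicator_one .of_discrete]
    _ ≤ _ := by
        rw [two_mul, ENNReal.ofReal_add hδ.le hδ.le]
        gcongr

/-! ### A dual certificate for the semidefinite program -/

/-- The signed Laplacian of `a` is positive definite modulo the constant vectors. -/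
def IsRigid {n : ℕ} (a : Matrix (Fin n) (Fin n) ℝ) : Prop :=
  ∀ x : Fin n → ℝ, (∃ i j, x i ≠ x j) → 0 < ∑ i, ∑ j, a i j * (x i - x j) ^ 2

/-- Multiplication of the entries `A i j` by `σ i * σ j`. -/
noncomputable def gauge {n : ℕ} (σ : Labeling n) (A : CensoredGraph n) : CensoredGraph n :=
  fun e => SignType.sign ((σ e.1.1 * σ e.1.2 : ℤˣ) : ℤ) * A e

theorem adjMatrix_symm {n : ℕ} (A : CensoredGraph n) (i j : Fin n) :
    adjMatrix A i j = adjMatrix A j i := by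
  unfold adjMatrix
  rcases lt_trichotomy i j with h | h | h
  · simp [h, not_lt.2 h.le]
  · subst h; rfl
  · simp [h, not_lt.2 h.le]

theorem adjMatrix_self {n : ℕ} (A : CensoredGraph n) (i : Fin n) : adjMatrix A i i = 0 := by
  simp [adjMatrix]

theorem coe_sign_units (u : ℤˣ) : ((SignType.sign (u : ℤ) : SignType) : ℝ) = ((u : ℤ) : ℝ) := by
  rcases Int.units_eq_one_or u with rfl | rfl <;> simp

theorem adjMatrix_gauge {n : ℕ} (σ : Labeling n) (A : CensoredGraph n) (i j : Fin n) :
    adjMatrix (gauge σ A) i j = outer σ i j * adjMatrix A i j := by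
  unfold adjMatrix gauge outer
  simp only [Matrix.of_apply]
  split_ifs
  · rw [SignType.coe_mul, coe_sign_units]
  · rw [SignType.coe_mul, coe_sign_units, mul_comm (σ i)]
  · simp

theorem outer_mul_self {n : ℕ} (σ : Labeling n) (i j : Fin n) : outer σ i j * outer σ i j = 1 := by
  simp only [outer, Matrix.of_apply]
  rcases Int.units_eq_one_or (σ i * σ j) with h | h <;> simp [h]

theorem outer_mem_elliptope {n : ℕ} (σ : Labeling n) : outer σ ∈ elliptope n := by
  constructor
  · have : outer σ = Matrix.vecMulVec (fun i => ((σ i : ℤ) : ℝ)) (star fun i => ((σ i : ℤ) : ℝ)) := by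
      ext i j
      simp [outer, Matrix.vecMulVec_apply]
    rw [this]
    exact Matrix.posSemidef_vecMulVec_self_star _
  · intro i
    rcases Int.units_eq_one_or (σ i) with h | h <;> simp [outer, h]

theorem trace_adjMatrix_mul {n : ℕ} (A : CensoredGraph n) (Y : Matrix (Fin n) (Fin n) ℝ) :
    (adjMatrix A * Y).trace = ∑ i, ∑ j, adjMatrix A i j * Y j i := by
  simp [Matrix.trace, Matrix.mul_apply]

/-- If the signed Laplacian of the gauged graph is positive definite, then `σ σᵀ` is the only
solution of the semidefinite program. -/
theorem eq_outer_of_isRigid {n : ℕ} {A : CensoredGraph n} {σ : Labeling n}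
    (h : IsRigid (adjMatrix (gauge σ A))) {Y : Matrix (Fin n) (Fin n) ℝ}
    (hY : IsSDPSolution A Y) : Y = outer σ := by
  obtain ⟨⟨hpsd, hdiag⟩, hmax⟩ := hY
  -- Write `Y` as a sum of rank one matrices and gauge the vectors by `σ`; if every gauged vector is
  -- constant, then `Y` is `σ σᵀ`.
  obtain ⟨m, b, hb⟩ := Matrix.posSemidef_iff_eq_sum_vecMulVec.1 hpsd
  set x : Fin m → Fin n → ℝ := fun k i => b k i * ((σ i : ℤ) : ℝ) with hx
  have hYx : ∀ i j, outer σ i j * Y i j = ∑ k, x k i * x k j := by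
    intro i j
    rw [hb, Matrix.sum_apply, Finset.mul_sum]
    refine Finset.sum_congr rfl fun k _ => ?_
    simp only [hx, outer, Matrix.of_apply, Matrix.vecMulVec_apply, star_trivial, Units.val_mul,
      Int.cast_mul]
    ring
  have hself : ∀ i, ∑ k, x k i * x k i = 1 := by
    intro i
    rw [← hYx, hdiag]
    rcases Int.units_eq_one_or (σ i) with h | h <;> simp [outer, h]
  have hYsymm : ∀ i j, Y j i = Y i j := fun i j => by
    simpa using hpsd.isHermitian.apply i j
  have htr : (adjMatrix A * Y).trace =
      ∑ i, ∑ j, adjMatrix (gauge σ A) i j * ∑ k, x k i * x k j := by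
    rw [trace_adjMatrix_mul]
    refine Finset.sum_congr rfl fun i _ => Finset.sum_congr rfl fun j _ => ?_
    rw [adjMatrix_gauge, ← hYx, hYsymm]
    linear_combination (-(adjMatrix A i j * Y i j)) * outer_mul_self σ i j
  have htr' : (adjMatrix A * outer σ).trace = ∑ i, ∑ j, adjMatrix (gauge σ A) i j := by
    rw [trace_adjMatrix_mul]
    refine Finset.sum_congr rfl fun i _ => Finset.sum_congr rfl fun j _ => ?_
    rw [adjMatrix_gauge, mul_comm]
    simp [outer, mul_comm]
  -- Since the diagonal of `Y` is one, the Laplacian forms of the vectors add up to twice the loss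
  -- of `Y` against `σ σᵀ`. Optimality makes this nonpositive, and rigidity makes every nonconstant
  -- vector contribute a positive amount.
  have hsum : ∑ k, ∑ i, ∑ j, adjMatrix (gauge σ A) i j * (x k i - x k j) ^ 2 =
      2 * ((adjMatrix A * outer σ).trace - (adjMatrix A * Y).trace) := by
    rw [htr, htr', ← Finset.sum_sub_distrib, Finset.mul_sum, Finset.sum_comm]
    refine Finset.sum_congr rfl fun i _ => ?_
    rw [← Finset.sum_sub_distrib, Finset.mul_sum, Finset.sum_comm]
    refine Finset.sum_congr rfl fun j _ => ?_
    rw [← Finset.mul_sum]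
    have : ∑ k, (x k i - x k j) ^ 2 =
        ∑ k, x k i * x k i + ∑ k, x k j * x k j - 2 * ∑ k, x k i * x k j := by
      rw [Finset.mul_sum, ← Finset.sum_add_distrib, ← Finset.sum_sub_distrib]
      exact Finset.sum_congr rfl fun k _ => by ring
    rw [this, hself, hself]
    ring
  have hconst : ∀ k i j, x k i = x k j := by
    by_contra! hne
    obtain ⟨k₀, hk₀⟩ := hne
    have hnn : ∀ k, 0 ≤ ∑ i, ∑ j, adjMatrix (gauge σ A) i j * (x k i - x k j) ^ 2 := by
      intro k
      by_cases hk : ∃ i j, x k i ≠ x k j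
      · exact (h _ hk).le
      · push Not at hk
        refine le_of_eq (Eq.symm ?_)
        exact Finset.sum_eq_zero fun i _ => Finset.sum_eq_zero fun j _ => by rw [hk i j]; simp
    have : 0 < ∑ k, ∑ i, ∑ j, adjMatrix (gauge σ A) i j * (x k i - x k j) ^ 2 :=
      Finset.sum_pos' (fun k _ => hnn k) ⟨k₀, Finset.mem_univ _, h _ hk₀⟩
    have := hmax _ (outer_mem_elliptope σ)
    linarith
  ext i j
  have h1 : outer σ i j * Y i j = 1 := by
    rw [hYx, ← hself i]
    exact Finset.sum_congr rfl fun k _ => by rw [hconst k i j]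
  linear_combination outer σ i j * h1 - Y i j * outer_mul_self σ i j

/-! ### Quadratic forms -/

/-- A form without diagonal terms that is bounded on the vertices of a cube is bounded on it. -/
theorem quadForm_le_of_signs {n : ℕ} {M : Fin n → Fin n → ℝ} (hM : ∀ i, M i i = 0) {t : ℝ}
    (h : ∀ s : Fin n → ℝ, (∀ i, s i = 1 ∨ s i = -1) → ∑ i, ∑ j, M i j * (s i * s j) ≤ t)
    {x : Fin n → ℝ} (hx : ∀ i, |x i| ≤ 1) : ∑ i, ∑ j, M i j * (x i * x j) ≤ t := by
  suffices H : ∀ F : Finset (Fin n), ∀ x : Fin n → ℝ, (∀ i, |x i| ≤ 1) →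
      (∀ i ∉ F, x i = 1 ∨ x i = -1) → ∑ i, ∑ j, M i j * (x i * x j) ≤ t from
    H Finset.univ x hx fun i hi => absurd (Finset.mem_univ i) hi
  intro F
  induction F using Finset.induction_on with
  | empty => exact fun x _ hs => h x fun i => hs i (Finset.notMem_empty i)
  | insert v F hv ih =>
    intro x hx hs
    -- Without diagonal terms the form is affine in each coordinate, so it is the average of its
    -- values at `x v = 1` and `x v = -1` with weights `(1 ± x v) / 2`.
    have haff : ∑ i, ∑ j, M i j * (x i * x j) =
        (1 + x v) / 2 * ∑ i, ∑ j, M i j * (Function.update x v 1 i * Function.update x v 1 j) +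
        (1 - x v) / 2 *
          ∑ i, ∑ j, M i j * (Function.update x v (-1) i * Function.update x v (-1) j) := by
      rw [Finset.mul_sum, Finset.mul_sum, ← Finset.sum_add_distrib]
      refine Finset.sum_congr rfl fun i _ => ?_
      rw [Finset.mul_sum, Finset.mul_sum, ← Finset.sum_add_distrib]
      refine Finset.sum_congr rfl fun j _ => ?_
      by_cases hi : i = v
      · subst hi
        by_cases hj : j = i
        · subst hj; simp [hM]
        · simp [Function.update_of_ne hj]; ring
      · by_cases hj : j = v
        · subst hj; simp [Function.update_of_ne hi]; ring
        · simp [Function.update_of_ne hi, Function.update_of_ne hj]; ring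
    have hb : ∀ u : ℝ, u = 1 ∨ u = -1 → ∑ i, ∑ j, M i j *
        (Function.update x v u i * Function.update x v u j) ≤ t := by
      intro u hu
      refine ih _ (fun i => ?_) fun i hi => ?_
      · by_cases hiv : i = v
        · subst hiv; rcases hu with rfl | rfl <;> simp
        · rw [Function.update_of_ne hiv]; exact hx i
      · by_cases hiv : i = v
        · subst hiv; simpa using hu
        · rw [Function.update_of_ne hiv]; exact hs i (by simp [hiv, hi])
    have h1 := hb 1 (Or.inl rfl)
    have h2 := hb (-1) (Or.inr rfl)
    have h3 := abs_le.1 (hx v)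
    rw [haff]
    nlinarith

theorem quadForm_le_of_signs_of_abs_le {n : ℕ} {M : Fin n → Fin n → ℝ} (hM : ∀ i, M i i = 0)
    {t : ℝ}
    (h : ∀ s : Fin n → ℝ, (∀ i, s i = 1 ∨ s i = -1) → ∑ i, ∑ j, M i j * (s i * s j) ≤ t)
    {θ : ℝ} (hθ : 0 ≤ θ) {x : Fin n → ℝ} (hx : ∀ i, |x i| ≤ θ) :
    ∑ i, ∑ j, M i j * (x i * x j) ≤ θ ^ 2 * t := by
  rcases hθ.eq_or_lt with rfl | hθ
  · have : ∀ i, x i = 0 := fun i => abs_nonpos_iff.1 (hx i)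
    simp [this]
  have := quadForm_le_of_signs hM h (x := fun i => x i / θ) fun i => by
    rw [abs_div, abs_of_pos hθ, div_le_one hθ]; exact hx i
  have h2 : ∑ i, ∑ j, M i j * (x i * x j) =
      θ ^ 2 * ∑ i, ∑ j, M i j * (x i / θ * (x j / θ)) := by
    simp only [Finset.mul_sum]
    refine Finset.sum_congr rfl fun i _ => Finset.sum_congr rfl fun j _ => ?_
    field_simp
  rw [h2]
  gcongr

/-- Layer-cake bound for hereditarily sparse weights. -/
theorem sum_mul_min_le {ι : Type*} [DecidableEq ι] {b : ι → ι → ℝ} {C : ℝ} (S : Finset ι)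
    (hS : ∀ R ⊆ S, ∑ i ∈ R, ∑ j ∈ R, b i j ≤ C * R.card) (w : ι → ℝ) (hw : ∀ i ∈ S, 0 ≤ w i) :
    ∑ i ∈ S, ∑ j ∈ S, b i j * min (w i) (w j) ≤ C * ∑ i ∈ S, w i := by
  induction S using Finset.strongInduction generalizing w with
  | H S ih =>
    rcases S.eq_empty_or_nonempty with rfl | hne
    · simp
    obtain ⟨v, hv, hmin⟩ := S.exists_min_image w hne
    have hsub : S.erase v ⊂ S := Finset.erase_ssubset hv
    have hih := ih (S.erase v) hsub (fun R hR => hS R (hR.trans hsub.subset))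
      (fun i => w i - w v) fun i hi => sub_nonneg.2 (hmin i (Finset.mem_of_mem_erase hi))
    -- Peel off the lowest layer: subtract the minimal weight everywhere. The vertex `v` attaining
    -- it then drops out of the sum, and the removed layer is controlled by the sparsity of `S`
    -- itself.
    have h1 : ∑ i ∈ S, ∑ j ∈ S, b i j * min (w i) (w j) =
        ∑ i ∈ S.erase v, ∑ j ∈ S.erase v, b i j * min (w i - w v) (w j - w v) +
          w v * ∑ i ∈ S, ∑ j ∈ S, b i j := by
      have h2 : ∑ i ∈ S, ∑ j ∈ S, b i j * min (w i - w v) (w j - w v) =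
          ∑ i ∈ S.erase v, ∑ j ∈ S.erase v, b i j * min (w i - w v) (w j - w v) := by
        symm
        have hz : ∀ i ∈ S, ∑ j ∈ S.erase v, b i j * min (w i - w v) (w j - w v) =
            ∑ j ∈ S, b i j * min (w i - w v) (w j - w v) := fun i hi =>
          Finset.sum_erase _ (by
            rw [sub_self, min_eq_right (sub_nonneg.2 (hmin i hi)), mul_zero])
        rw [Finset.sum_congr rfl fun i hi => hz i (Finset.mem_of_mem_erase hi)]
        refine Finset.sum_erase _ (Finset.sum_eq_zero fun j hj => ?_)
        rw [sub_self, min_eq_left (sub_nonneg.2 (hmin j hj)), mul_zero]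
      rw [← h2, Finset.mul_sum, ← Finset.sum_add_distrib]
      refine Finset.sum_congr rfl fun i _ => ?_
      rw [Finset.mul_sum, ← Finset.sum_add_distrib]
      refine Finset.sum_congr rfl fun j _ => ?_
      rw [min_sub_sub_right]
      ring
    have h3 : ∑ i ∈ S.erase v, (w i - w v) = ∑ i ∈ S, w i - S.card * w v := by
      rw [Finset.sum_erase _ (sub_self _), Finset.sum_sub_distrib, Finset.sum_const, nsmul_eq_mul]
    have h4 := mul_le_mul_of_nonneg_left (hS S subset_rfl) (hw v hv)
    rw [h1]
    rw [h3] at hih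
    linarith

/-- The bound for a product in which at least one factor is not small. -/
theorem abs_mul_le_of_large {T u v θ : ℝ} (hT : 1 ≤ T) (huv : θ < u ^ 2 ∨ θ < v ^ 2) :
    |u * v| ≤ (if θ < T ^ 2 * u ^ 2 ∧ θ < T ^ 2 * v ^ 2 then T * min (u ^ 2) (v ^ 2) else 0) +
      (u ^ 2 + v ^ 2) / T := by
  wlog hle : |u| ≤ |v| generalizing u v
  · have := this huv.symm (le_of_not_ge hle)
    simpa only [mul_comm, min_comm, add_comm, and_comm] using this
  have hT0 : 0 < T := by linarith
  have hsq : u ^ 2 ≤ v ^ 2 := sq_le_sq.2 hle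
  have hv : θ < v ^ 2 := huv.elim (fun h => h.trans_le hsq) id
  have hv' : θ < T ^ 2 * v ^ 2 := 
    hv.trans_le (le_mul_of_one_le_left (sq_nonneg v) (one_le_pow₀ hT))
  have hu2 : |u| ^ 2 = u ^ 2 := sq_abs u
  have hv2 : |v| ^ 2 = v ^ 2 := sq_abs v
  rw [abs_mul]
  -- If the smaller factor is within a factor `T` of the cutoff, the arithmetic-geometric mean
  -- inequality applies. Otherwise `T |u| ≤ |v|`, and the product is at most `v² / T`.
  split_ifs with hif
  · rw [min_eq_left hsq, ← hu2, ← hv2]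
    have : |u| * |v| ≤ T * |u| ^ 2 + |v| ^ 2 / T := by
      rw [← sub_nonneg]
      have : T * |u| ^ 2 + |v| ^ 2 / T - |u| * |v| =
          ((T * |u| - |v|) ^ 2 + T * |u| * |v|) / T := by field_simp; ring
      rw [this]; positivity
    have : 0 ≤ |u| ^ 2 / T := by positivity
    rw [add_div]; linarith
  · have hu : T ^ 2 * u ^ 2 ≤ θ := by
      by_contra h; exact hif ⟨not_le.1 h, hv'⟩
    have hTu : T * |u| ≤ |v| := by
      refine le_of_sq_le_sq ?_ (abs_nonneg v)
      rw [mul_pow, hu2, hv2]; linarith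
    rw [zero_add, le_div_iff₀ hT0]
    nlinarith [abs_nonneg u, abs_nonneg v, sq_nonneg u]

/-- Bound for the quadratic form of a matrix with spread-out and locally sparse entries, on vectors
`y` with a prescribed bound on the sum of their small entries. -/
theorem quadForm_le_of_sparse {n : ℕ} {a : Fin n → Fin n → ℝ} {μ t Δ C θ T : ℝ}
    (hdiag : ∀ i, a i i = 0) (hsymm : ∀ i j, a i j = a j i) (hμ : 0 ≤ μ) (hθ : 0 ≤ θ) (hT : 1 ≤ T)
    (hcut : ∀ s : Fin n → ℝ, (∀ i, s i = 1 ∨ s i = -1) →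
      ∑ i, ∑ j, (a i j - if i = j then 0 else μ) * (s i * s j) ≤ t)
    (hdeg : ∀ i, ∑ j, |a i j| ≤ Δ) (y : Fin n → ℝ)
    (hsparse : ∀ R ⊆ Finset.univ.filter fun i => θ < T ^ 2 * y i ^ 2,
      ∑ i ∈ R, ∑ j ∈ R, |a i j| ≤ C * R.card) (hC : 0 ≤ C) :
    ∑ i, ∑ j, a i j * (y i * y j) ≤
      θ * t + μ * (∑ i, if θ < y i ^ 2 then 0 else y i) ^ 2 + (T * C + 2 * Δ / T) * ∑ i, y i ^ 2 := by
  have hT0 : 0 < T := by linarith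
  set s : Fin n → ℝ := fun i => if θ < y i ^ 2 then 0 else y i with hs
  set b : Fin n → Fin n → ℝ := fun i j =>
    if θ < T ^ 2 * y i ^ 2 ∧ θ < T ^ 2 * y j ^ 2 then T * min (y i ^ 2) (y j ^ 2) else 0 with hb
  -- Pairs of small entries are centred by `μ`; pairs with a large entry go through
  -- `abs_mul_le_of_large`. Centring acts off the diagonal only, so the diagonal of the rank one
  -- term is subtracted; it is nonnegative and is dropped later.
  have hpt : ∀ i j, a i j * (y i * y j) ≤ (a i j - if i = j then 0 else μ) * (s i * s j) +
      μ * (s i * s j) + (|a i j| * b i j + |a i j| * (y i ^ 2 + y j ^ 2) / T) -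
        if i = j then μ * (s i * s j) else 0 := by
    intro i j
    have hrest : a i j * (y i * y j) ≤ a i j * (s i * s j) +
        (|a i j| * b i j + |a i j| * (y i ^ 2 + y j ^ 2) / T) := by
      by_cases hij : θ < y i ^ 2 ∨ θ < y j ^ 2
      · have hz : s i * s j = 0 := by
          rcases hij with h | h <;> simp [hs, h]
        have h1 := abs_mul_le_of_large hT hij
        have h2 : a i j * (y i * y j) ≤ |a i j| * |y i * y j| := by
          rw [← abs_mul]; exact le_abs_self _
        have h3 := mul_le_mul_of_nonneg_left h1 (abs_nonneg (a i j))
        rw [hz, mul_zero, zero_add]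
        refine h2.trans (h3.trans (le_of_eq ?_))
        rw [mul_add, mul_div_assoc]
      · push Not at hij
        have h1 : s i = y i := by simp [hs, hij.1]
        have h2 : s j = y j := by simp [hs, hij.2]
        rw [h1, h2]
        have : 0 ≤ b i j := by simp only [hb]; split_ifs <;> positivity
        have : 0 ≤ |a i j| * b i j + |a i j| * (y i ^ 2 + y j ^ 2) / T := by positivity
        linarith
    by_cases hij : i = j
    · subst hij
      simp only [if_true, sub_zero]
      linarith
    · simp only [hij, if_false, sub_zero]
      linarith
  have hsum : ∑ i, ∑ j, a i j * (y i * y j) ≤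
      ∑ i, ∑ j, (a i j - if i = j then 0 else μ) * (s i * s j) + μ * (∑ i, s i) ^ 2 +
      (∑ i, ∑ j, |a i j| * b i j + ∑ i, ∑ j, |a i j| * (y i ^ 2 + y j ^ 2) / T) := by
    have h1 := Finset.sum_le_sum fun i (_ : i ∈ Finset.univ) =>
      Finset.sum_le_sum fun j (_ : j ∈ Finset.univ) => hpt i j
    simp only [Finset.sum_add_distrib, Finset.sum_sub_distrib, Finset.sum_ite_eq,
      Finset.mem_univ, if_true] at h1
    have h2 : ∑ i, ∑ j, μ * (s i * s j) = μ * (∑ i, s i) ^ 2 := by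
      rw [sq, Finset.sum_mul_sum, Finset.mul_sum]
      exact Finset.sum_congr rfl fun i _ => by rw [Finset.mul_sum]
    have h3 : 0 ≤ ∑ i, μ * (s i * s i) :=
      Finset.sum_nonneg fun i _ => mul_nonneg hμ (mul_self_nonneg _)
    rw [h2] at h1
    linarith
  have hsmall : ∑ i, ∑ j, (a i j - if i = j then 0 else μ) * (s i * s j) ≤ θ * t := by
    have := quadForm_le_of_signs_of_abs_le (M := fun i j => a i j - if i = j then 0 else μ)
      (fun i => by simp [hdiag]) hcut (Real.sqrt_nonneg θ) (x := s) fun i => by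
        refine Real.le_sqrt_of_sq_le ?_
        rw [sq_abs]
        simp only [hs]
        split_ifs with h
        · simpa using hθ
        · exact not_lt.1 h
    rwa [Real.sq_sqrt hθ] at this
  have hmin : ∑ i, ∑ j, |a i j| * b i j ≤ T * C * ∑ i, y i ^ 2 := by
    set S := Finset.univ.filter fun i => θ < T ^ 2 * y i ^ 2 with hS
    have h1 := sum_mul_min_le (b := fun i j => |a i j|) S hsparse (fun i => y i ^ 2)
      fun i _ => sq_nonneg _
    have h2 : ∑ i, ∑ j, |a i j| * b i j =
        T * ∑ i ∈ S, ∑ j ∈ S, |a i j| * min (y i ^ 2) (y j ^ 2) := by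
      rw [hS, Finset.sum_filter, Finset.mul_sum]
      refine Finset.sum_congr rfl fun i _ => ?_
      by_cases hi : θ < T ^ 2 * y i ^ 2
      · rw [if_pos hi, Finset.sum_filter, Finset.mul_sum]
        refine Finset.sum_congr rfl fun j _ => ?_
        by_cases hj : θ < T ^ 2 * y j ^ 2
        · simp only [hb, hi, hj, and_self, if_true]; ring
        · simp [hb, hj]
      · simp [hb, hi]
    have h3 : ∑ i ∈ S, y i ^ 2 ≤ ∑ i, y i ^ 2 :=
      Finset.sum_le_univ_sum_of_nonneg fun i => sq_nonneg _
    rw [h2, mul_assoc]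
    exact mul_le_mul_of_nonneg_left (h1.trans (mul_le_mul_of_nonneg_left h3 hC)) hT0.le
  have hmax : ∑ i, ∑ j, |a i j| * (y i ^ 2 + y j ^ 2) / T ≤ 2 * Δ / T * ∑ i, y i ^ 2 := by
    have h1 : ∑ i, ∑ j, |a i j| * y j ^ 2 = ∑ i, ∑ j, |a i j| * y i ^ 2 := by
      rw [Finset.sum_comm]
      exact Finset.sum_congr rfl fun i _ => Finset.sum_congr rfl fun j _ => by rw [hsymm]
    have h2 : ∑ i, ∑ j, |a i j| * y i ^ 2 ≤ Δ * ∑ i, y i ^ 2 := by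
      rw [Finset.mul_sum]
      refine Finset.sum_le_sum fun i _ => ?_
      rw [← Finset.sum_mul]
      exact mul_le_mul_of_nonneg_right (hdeg i) (sq_nonneg _)
    have h3 : ∑ i, ∑ j, |a i j| * (y i ^ 2 + y j ^ 2) / T =
        (2 * ∑ i, ∑ j, |a i j| * y i ^ 2) / T := by
      simp only [← Finset.sum_div, mul_add, Finset.sum_add_distrib]
      rw [h1]; ring
    rw [h3, div_mul_eq_mul_div, mul_assoc]
    gcongr
  have h0 : (T * C + 2 * Δ / T) * ∑ i, y i ^ 2 =
      T * C * ∑ i, y i ^ 2 + 2 * Δ / T * ∑ i, y i ^ 2 := by ring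
  rw [h0]
  linarith

/-- The cross terms between a set `B` of vertices with disjoint neighbourhoods and its
complement. -/
theorem cross_le {n : ℕ} {a : Fin n → Fin n → ℝ} {Δ α : ℝ} (hα : 0 < α)
    (habs : ∀ i j, |a i j| ≤ 1) (hdeg : ∀ i, ∑ j, |a i j| ≤ Δ) {B : Finset (Fin n)}
    (hdisj : ∀ i ∈ B, ∀ k ∈ B, i ≠ k → ∀ j, a i j = 0 ∨ a k j = 0) (x y : Fin n → ℝ) :
    2 * ∑ i ∈ B, ∑ j, a i j * (x i * y j) ≤
      α * Δ * ∑ i ∈ B, x i ^ 2 + (∑ j, y j ^ 2) / α := by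
  -- Each column meets at most one vertex of `B`, so the terms in `y` do not pick up a degree
  -- factor.
  have hcol : ∀ j, ∑ i ∈ B, |a i j| ≤ 1 := by
    intro j
    by_cases h : ∃ i ∈ B, a i j ≠ 0
    · obtain ⟨i, hi, hij⟩ := h
      rw [Finset.sum_eq_single_of_mem i hi fun k hk hki => by
        rw [(hdisj i hi k hk (Ne.symm hki) j).resolve_left hij, abs_zero]]
      exact habs i j
    · push Not at h
      rw [Finset.sum_eq_zero fun i hi => by rw [h i hi, abs_zero]]
      exact zero_le_one
  have hpt : ∀ i j, 2 * (a i j * (x i * y j)) ≤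
      α * |a i j| * x i ^ 2 + |a i j| * y j ^ 2 / α := by
    intro i j
    have h1 : a i j * (x i * y j) ≤ |a i j| * (|x i| * |y j|) := by
      rw [← abs_mul, ← abs_mul]; exact le_abs_self _
    have h2 : 2 * (|x i| * |y j|) ≤ α * x i ^ 2 + y j ^ 2 / α := by
      rw [← sub_nonneg, ← sq_abs (x i), ← sq_abs (y j)]
      have : α * |x i| ^ 2 + |y j| ^ 2 / α - 2 * (|x i| * |y j|) =
          (α * |x i| - |y j|) ^ 2 / α := by field_simp; ring
      rw [this]; positivity
    have h3 := mul_le_mul_of_nonneg_left h2 (abs_nonneg (a i j))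
    have h4 : |a i j| * (α * x i ^ 2 + y j ^ 2 / α) =
      α * |a i j| * x i ^ 2 + |a i j| * y j ^ 2 / α := by ring
    linarith
  calc 2 * ∑ i ∈ B, ∑ j, a i j * (x i * y j)
      = ∑ i ∈ B, ∑ j, 2 * (a i j * (x i * y j)) := by simp only [Finset.mul_sum]
    _ ≤ ∑ i ∈ B, ∑ j, (α * |a i j| * x i ^ 2 + |a i j| * y j ^ 2 / α) :=
        Finset.sum_le_sum fun i _ => Finset.sum_le_sum fun j _ => hpt i j
    _ = ∑ i ∈ B, α * (∑ j, |a i j|) * x i ^ 2 + (∑ j, (∑ i ∈ B, |a i j|) * y j ^ 2) / α := by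
        simp only [Finset.sum_add_distrib]
        congr 1
        · refine Finset.sum_congr rfl fun i _ => ?_
          rw [Finset.mul_sum, Finset.sum_mul]
        · rw [Finset.sum_comm, Finset.sum_div]
          refine Finset.sum_congr rfl fun j _ => ?_
          rw [Finset.sum_mul, Finset.sum_div]
    _ ≤ _ := by
        refine add_le_add ?_ ?_
        · rw [Finset.mul_sum]
          refine Finset.sum_le_sum fun i _ => ?_
          have := hdeg i
          gcongr
        · gcongr with j
          exact mul_le_of_le_one_left (sq_nonneg _) (hcol j)

/-- Deterministic conditions for positivity of the signed Laplacian. -/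
theorem isRigid_of_pseudorandom {n : ℕ} {a : Matrix (Fin n) (Fin n) ℝ} {κ η d μ : ℝ}
    (hsymm : ∀ i j, a i j = a j i) (hdiag : ∀ i, a i i = 0) (habs : ∀ i j, |a i j| ≤ 1)
    (hκ : 0 < κ) (hκ1 : κ ≤ 1) (hη : 0 < η) (hηκ : η ≤ κ / 32) (hd : 64 / (κ * η) ≤ √d)
    (hμ : 0 ≤ μ) (hμd : μ * n ≤ d)
    (hcut : ∀ s : Fin n → ℝ, (∀ i, s i = 1 ∨ s i = -1) →
      ∑ i, ∑ j, (a i j - if i = j then 0 else μ) * (s i * s j) ≤ 4 * n * √d)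
    (hsparse : ∀ R : Finset (Fin n), (R.card : ℝ) ≤ η * (128 / κ) ^ 2 * n →
      ∑ i ∈ R, ∑ j ∈ R, |a i j| ≤ κ ^ 2 / 2048 * d * R.card)
    (hdeg : ∀ i, ∑ j, |a i j| ≤ 4 * d)
    (hindep : ∀ i k, ∑ j, a i j < κ * d → ∑ j, a k j < κ * d → a i k = 0)
    (hdisj : ∀ i k, i ≠ k → ∑ j, a i j < κ * d → ∑ j, a k j < κ * d → ∀ j, a i j = 0 ∨ a k j = 0)
    (hmin : ∀ i, 64 / κ + 2 ≤ ∑ j, a i j)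
    (hcard : 2 * μ * (Finset.univ.filter fun i => ∑ j, a i j < κ * d).card ≤ 1) :
    IsRigid a := by
  set B := Finset.univ.filter fun i => ∑ j, a i j < κ * d with hB
  have hd0 : 0 < d := by
    rw [← Real.sqrt_pos]; exact lt_of_lt_of_le (by positivity) hd
  -- The Laplacian form ignores constants, so `x` may be centred; it is then twice the degree form
  -- minus the adjacency form.
  suffices H : ∀ x : Fin n → ℝ, ∑ i, x i = 0 → (∃ i, x i ≠ 0) →
      ∑ i, ∑ j, a i j * (x i * x j) < ∑ i, (∑ j, a i j) * x i ^ 2 by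
    intro x ⟨i₀, j₀, hij⟩
    have hn : (0 : ℝ) < n := by exact_mod_cast (Fin.pos i₀)
    set c := (∑ i, x i) / n with hc
    have h1 := H (fun i => x i - c) (by
        rw [Finset.sum_sub_distrib, Finset.sum_const, Finset.card_univ, Fintype.card_fin,
          nsmul_eq_mul, hc]
        field_simp; simp) (by
        by_contra! h
        exact hij (by linarith [h i₀, h j₀]))
    have h2 : ∑ i, ∑ j, a i j * (x i - x j) ^ 2 = 2 * (∑ i, (∑ j, a i j) * (x i - c) ^ 2 -
        ∑ i, ∑ j, a i j * ((x i - c) * (x j - c))) := by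
      have h3 : ∑ i, ∑ j, a i j * (x j - c) ^ 2 = ∑ i, ∑ j, a i j * (x i - c) ^ 2 := by
        rw [Finset.sum_comm]
        exact Finset.sum_congr rfl fun i _ => Finset.sum_congr rfl fun j _ => by rw [hsymm]
      have h4 : ∀ i j, a i j * (x i - x j) ^ 2 = a i j * (x i - c) ^ 2 + a i j * (x j - c) ^ 2 -
          2 * (a i j * ((x i - c) * (x j - c))) := fun i j => by ring
      simp only [h4, Finset.sum_sub_distrib, Finset.sum_add_distrib, h3, Finset.sum_mul,
        ← Finset.mul_sum]
      ring
    rw [h2]; linarith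
  intro x hx0 ⟨i₀, hi₀⟩
  have hn : (0 : ℝ) < n := by exact_mod_cast (Fin.pos i₀)
  set y : Fin n → ℝ := fun i => if i ∈ B then 0 else x i with hy
  set N := ∑ i, y i ^ 2 with hN
  set NB := ∑ i ∈ B, x i ^ 2 with hNB
  have hN0 : 0 ≤ N := Finset.sum_nonneg fun i _ => sq_nonneg _
  have hNB0 : 0 ≤ NB := Finset.sum_nonneg fun i _ => sq_nonneg _
  set T := 128 / κ with hT
  have hT1 : 1 ≤ T := by rw [hT, le_div_iff₀ hκ]; linarith
  -- With this cutoff, Markov's inequality bounds the number of entries with `θ < c y²` by `η c n`.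
  -- For `c = T²` this is the size up to which local sparsity is assumed.
  set θ := N / (η * n) with hθ
  have hθ0 : 0 ≤ θ := by positivity
  have hlevel : ∀ c : ℝ, 0 < c →
      ((Finset.univ.filter fun i => θ < c * y i ^ 2).card : ℝ) ≤ η * c * n := by
    intro c hc
    rcases hN0.eq_or_lt with h0 | hNpos
    · have hy0 : ∀ i, y i ^ 2 = 0 := fun i =>
        (Finset.sum_eq_zero_iff_of_nonneg fun i _ => sq_nonneg (y i)).1 h0.symm i
          (Finset.mem_univ i)
      have : (Finset.univ.filter fun i => θ < c * y i ^ 2) = ∅ := by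
        refine Finset.filter_eq_empty_iff.2 fun i _ => ?_
        rw [hy0, mul_zero]; exact not_lt.2 hθ0
      rw [this]; simp; positivity
    · have h1 : ((Finset.univ.filter fun i => θ < c * y i ^ 2).card : ℝ) * θ ≤ c * N := by
        rw [← nsmul_eq_mul, ← Finset.sum_const, hN, Finset.mul_sum]
        refine (Finset.sum_le_sum fun i hi => (Finset.mem_filter.1 hi).2.le).trans ?_
        exact Finset.sum_le_univ_sum_of_nonneg fun i => by positivity
      have h2 : 0 < θ := by positivity
      have h3 : c * N = η * c * n * θ := by rw [hθ]; field_simp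
      rw [h3] at h1
      exact le_of_mul_le_mul_right h1 h2
  have hlevel1 : ((Finset.univ.filter fun i => θ < y i ^ 2).card : ℝ) ≤ η * n := by
    have := hlevel 1 one_pos
    simpa using this
  have hquad := quadForm_le_of_sparse hdiag hsymm hμ hθ0 hT1 hcut hdeg y
    (C := κ ^ 2 / 2048 * d) (fun R hR => hsparse R (by
      have h1 : (R.card : ℝ) ≤ (Finset.univ.filter fun i => θ < T ^ 2 * y i ^ 2).card := by
        exact_mod_cast Finset.card_le_card hR
      exact h1.trans (hlevel (T ^ 2) (by positivity)))) (by positivity)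
  -- This weight spends `κ d / 16` per unit of `N` and, since degrees are at most `4 d`, only the
  -- constant `64 / κ` per unit of `NB`.
  have hcross := cross_le (a := a) (α := 16 / (κ * d)) (by positivity) habs hdeg (B := B)
    (fun i hi k hk hik => hdisj i k hik (Finset.mem_filter.1 hi).2 (Finset.mem_filter.1 hk).2) x y
  rw [← hN, ← hNB] at hcross
  have hite : ∀ f : Fin n → ℝ, ∑ i, (if i ∈ B then f i else 0) = ∑ i ∈ B, f i := fun f => by
    simp
  have hsplit : ∑ i, ∑ j, a i j * (x i * x j) =
      ∑ i, ∑ j, a i j * (y i * y j) + 2 * ∑ i ∈ B, ∑ j, a i j * (x i * y j) := by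
    have h1 : ∀ i j, a i j * (x i * x j) = a i j * (y i * y j) +
        (if i ∈ B then a i j * (x i * y j) else 0) + (if j ∈ B then a i j * (y i * x j) else 0) := by
      intro i j
      by_cases hi : i ∈ B <;> by_cases hj : j ∈ B
      · have := hindep i j (Finset.mem_filter.1 hi).2 (Finset.mem_filter.1 hj).2
        simp [this]
      · simp [hy, hi, hj]
      · simp [hy, hi, hj]
      · simp [hy, hi, hj]
    have h2 : ∑ i, ∑ j, (if j ∈ B then a i j * (y i * x j) else 0) =
        ∑ i ∈ B, ∑ j, a i j * (x i * y j) := by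
      rw [Finset.sum_comm, ← hite fun i => ∑ j, a i j * (x i * y j)]
      refine Finset.sum_congr rfl fun i _ => ?_
      split_ifs
      · exact Finset.sum_congr rfl fun j _ => by rw [hsymm, mul_comm (x i)]
      · simp
    have h3 : ∑ i, ∑ j, (if i ∈ B then a i j * (x i * y j) else 0) =
        ∑ i ∈ B, ∑ j, a i j * (x i * y j) := by
      rw [← hite fun i => ∑ j, a i j * (x i * y j)]
      refine Finset.sum_congr rfl fun i _ => ?_
      split_ifs <;> simp
    simp only [h1, Finset.sum_add_distrib]
    rw [h2, h3]; ring
  have hyB : ∑ i, y i = -∑ i ∈ B, x i := by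
    have : ∀ i, y i = x i - if i ∈ B then x i else 0 := fun i => by
      simp only [hy]; split_ifs <;> simp
    simp only [this, Finset.sum_sub_distrib, hite, hx0, zero_sub]
  set S := Finset.univ.filter fun i => θ < y i ^ 2 with hS
  have hs : ∑ i, (if θ < y i ^ 2 then 0 else y i) = -∑ i ∈ B, x i - ∑ i ∈ S, y i := by
    rw [← hyB, hS, Finset.sum_filter, ← Finset.sum_sub_distrib]
    refine Finset.sum_congr rfl fun i _ => ?_
    split_ifs <;> simp
  have hsB : (∑ i ∈ B, x i) ^ 2 ≤ B.card * NB := sq_sum_le_card_mul_sum_sq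
  have hsS : (∑ i ∈ S, y i) ^ 2 ≤ η * n * N := by
    refine sq_sum_le_card_mul_sum_sq.trans ?_
    have : ∑ i ∈ S, y i ^ 2 ≤ N := Finset.sum_le_univ_sum_of_nonneg fun i => sq_nonneg _
    gcongr
  -- The sum of the small entries is minus the sums over `B` and over the large entries, because `x`
  -- is centred. Both index sets are small, so Cauchy-Schwarz suffices.
  have hsum : μ * (∑ i, if θ < y i ^ 2 then 0 else y i) ^ 2 ≤ κ * d / 16 * N + NB := by
    have h1 : (-∑ i ∈ B, x i - ∑ i ∈ S, y i) ^ 2 ≤ 2 * (B.card * NB) + 2 * (η * n * N) := by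
      nlinarith [sq_nonneg (∑ i ∈ B, x i - ∑ i ∈ S, y i)]
    rw [hs]
    refine (mul_le_mul_of_nonneg_left h1 hμ).trans ?_
    have h2 : 2 * μ * B.card * NB ≤ 1 * NB := mul_le_mul_of_nonneg_right hcard hNB0
    have h3 : 2 * η * (μ * n) * N ≤ 2 * (κ / 32) * d * N := by gcongr
    linarith
  have hθt : θ * (4 * n * √d) ≤ κ * d / 16 * N := by
    have h1 : θ * (4 * n * √d) = 4 * √d / η * N := by rw [hθ]; field_simp
    rw [h1]
    refine mul_le_mul_of_nonneg_right ?_ hN0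
    rw [div_le_iff₀ (by positivity)] at hd ⊢
    have h2 : √d * √d = d := Real.mul_self_sqrt hd0.le
    have h3 := mul_le_mul_of_nonneg_left hd (Real.sqrt_nonneg d)
    have h4 : √d * (√d * (κ * η)) = κ * d * η := by linear_combination κ * η * h2
    linarith
  have hTC : T * (κ ^ 2 / 2048 * d) + 2 * (4 * d) / T = κ * d / 8 := by
    rw [hT]; field_simp; norm_num
  have hα : 16 / (κ * d) * (4 * d) = 64 / κ := by field_simp; norm_num
  have hα' : N / (16 / (κ * d)) = κ * d / 16 * N := by field_simp
  have hD : (64 / κ + 2) * NB + κ * d * N ≤ ∑ i, (∑ j, a i j) * x i ^ 2 := by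
    have h1 : (64 / κ + 2) * NB = ∑ i, if i ∈ B then (64 / κ + 2) * x i ^ 2 else 0 := by
      rw [hite, hNB, Finset.mul_sum]
    rw [h1, hN, Finset.mul_sum, ← Finset.sum_add_distrib]
    refine Finset.sum_le_sum fun i _ => ?_
    by_cases hi : i ∈ B
    · simp only [hy, hi, if_true]
      have := mul_le_mul_of_nonneg_right (hmin i) (sq_nonneg (x i))
      simpa using this
    · simp only [hy, hi, if_false, zero_add]
      have : κ * d ≤ ∑ j, a i j := by
        by_contra h
        exact hi (Finset.mem_filter.2 ⟨Finset.mem_univ _, not_le.1 h⟩)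
      exact mul_le_mul_of_nonneg_right this (sq_nonneg _)
  have hpos : 0 < NB + κ * d * N := by
    have hx2 : 0 < x i₀ ^ 2 := by positivity
    by_cases hi : i₀ ∈ B
    · have : x i₀ ^ 2 ≤ NB :=
        Finset.single_le_sum (f := fun i => x i ^ 2) (fun i _ => sq_nonneg _) hi
      have : 0 ≤ κ * d * N := by positivity
      linarith
    · have h1 : y i₀ ^ 2 ≤ N :=
        Finset.single_le_sum (f := fun i => y i ^ 2) (fun i _ => sq_nonneg _) (Finset.mem_univ i₀)
      simp only [hy, hi, if_false] at h1
      have : 0 < κ * d * N := by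
        have : 0 < N := by linarith
        positivity
      linarith
  -- Balance: the adjacency form costs `κ d (1/16 + 1/16 + 1/8 + 1/16)` per unit of `N` and `1 + 64
  -- / κ` per unit of `NB`. The degrees supply `κ d` and `64 / κ + 2`.
  rw [hTC] at hquad
  rw [hα, hα'] at hcross
  have h64 : 0 ≤ κ * d * N := by positivity
  rw [hsplit]
  linarith

/-! ### Sums over pairs of vertices -/

theorem sum_sum_eq_two_mul_sum_pairs {n : ℕ} {F : Fin n → Fin n → ℝ}
    (hsymm : ∀ i j, F i j = F j i) (hdiag : ∀ i, F i i = 0) :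
    ∑ i, ∑ j, F i j = 2 * ∑ e : VertexPair n, F e.1.1 e.1.2 := by
  have h1 : ∑ e : VertexPair n, F e.1.1 e.1.2 = ∑ i, ∑ j, if i < j then F i j else 0 := by
    rw [← Fintype.sum_prod_type' (f := fun i j => if i < j then F i j else 0),
      ← Finset.sum_filter]
    exact (Finset.sum_subtype (Finset.univ.filter fun x : Fin n × Fin n => x.1 < x.2)
      (by simp) fun x => F x.1 x.2).symm
  have h2 : ∑ e : VertexPair n, F e.1.1 e.1.2 = ∑ i, ∑ j, if j < i then F i j else 0 := by
    rw [h1, Finset.sum_comm]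
    exact Finset.sum_congr rfl fun i _ => Finset.sum_congr rfl fun j _ => by rw [hsymm]
  rw [two_mul]
  nth_rewrite 1 [h1]
  rw [h2, ← Finset.sum_add_distrib]
  refine Finset.sum_congr rfl fun i _ => ?_
  rw [← Finset.sum_add_distrib]
  refine Finset.sum_congr rfl fun j _ => ?_
  rcases lt_trichotomy i j with h | h | h
  · simp [h, not_lt.2 h.le]
  · subst h; simp [hdiag]
  · simp [h, not_lt.2 h.le]

/-- The indicator of the incidence of a vertex and a pair. -/
noncomputable def incidence {n : ℕ} (i : Fin n) (e : VertexPair n) : ℝ :=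
  (if e.1.1 = i then 1 else 0) + if e.1.2 = i then 1 else 0

theorem incidence_eq_zero_or_one {n : ℕ} (i : Fin n) (e : VertexPair n) :
    incidence i e = 0 ∨ incidence i e = 1 := by
  have h := e.2.ne
  unfold incidence
  by_cases h1 : e.1.1 = i <;> by_cases h2 : e.1.2 = i
  · exact absurd (h1.trans h2.symm) h
  · simp [h1, h2]
  · simp [h1, h2]
  · simp [h1, h2]

theorem sum_eq_sum_incidence {n : ℕ} {F : Fin n → Fin n → ℝ}
    (hsymm : ∀ i j, F i j = F j i) (hdiag : ∀ i, F i i = 0) (i : Fin n) :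
    ∑ j, F i j = ∑ e : VertexPair n, incidence i e * F e.1.1 e.1.2 := by
  have h := sum_sum_eq_two_mul_sum_pairs
    (F := fun k l => ((if k = i then 1 else 0) + if l = i then 1 else 0) * F k l)
    (fun k l => by rw [hsymm, add_comm]) fun k => by simp [hdiag]
  have h2 : ∑ k, ∑ l, ((if k = i then 1 else 0) + if l = i then 1 else 0) * F k l =
      2 * ∑ j, F i j := by
    simp only [add_mul, Finset.sum_add_distrib, ite_mul, one_mul, zero_mul, Finset.sum_ite_eq',
      Finset.mem_univ, if_true]
    rw [two_mul]
    congr 1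
    · rw [Finset.sum_comm]; simp
    · exact Finset.sum_congr rfl fun j _ => hsymm _ _
  unfold incidence
  linarith

theorem sum_incidence {n : ℕ} (i : Fin n) : ∑ e : VertexPair n, incidence i e = n - 1 := by
  have h := sum_eq_sum_incidence (F := fun k l : Fin n => if k = l then 0 else 1)
    (fun k l => by simp [eq_comm]) (by simp) i
  have h1 : ∑ e : VertexPair n, incidence i e * (if e.1.1 = e.1.2 then 0 else 1) =
      ∑ e, incidence i e :=
    Finset.sum_congr rfl fun e _ => by simp [e.2.ne]
  have h2 : ∀ j : Fin n, (if i = j then (0 : ℝ) else 1) = 1 - if i = j then 1 else 0 := fun j => by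
    split_ifs <;> simp
  rw [h1] at h
  rw [← h]
  simp [h2]

theorem adjMatrix_pair {n : ℕ} (X : CensoredGraph n) (e : VertexPair n) :
    adjMatrix X e.1.1 e.1.2 = ((X e : SignType) : ℝ) := by
  simp [adjMatrix, e.2]

/-- The signed degree of a vertex. -/
noncomputable def signedDegree {n : ℕ} (X : CensoredGraph n) (i : Fin n) : ℝ :=
  ∑ j, adjMatrix X i j

theorem signedDegree_eq {n : ℕ} (X : CensoredGraph n) (i : Fin n) :
    signedDegree X i = ∑ e, incidence i e * ((X e : SignType) : ℝ) := by
  rw [signedDegree, sum_eq_sum_incidence (adjMatrix_symm X) (adjMatrix_self X)]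
  simp only [adjMatrix_pair]

theorem sum_abs_adjMatrix_eq {n : ℕ} (X : CensoredGraph n) (i : Fin n) :
    ∑ j, |adjMatrix X i j| = ∑ e, incidence i e * |((X e : SignType) : ℝ)| := by
  rw [sum_eq_sum_incidence (F := fun i j => |adjMatrix X i j|)
    (fun i j => by rw [adjMatrix_symm]) fun i => by rw [adjMatrix_self, abs_zero]]
  simp only [adjMatrix_pair]

/-! ### Expectations of products over pairs -/

section
variable {n : ℕ} {p ζ : ℝ}

theorem integral_edgeMeasure_one {E : Type*} [NormedAddCommGroup E] [NormedSpace ℝ E]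
    [CompleteSpace E] (hp0 : 0 ≤ p) (hp1 : p ≤ 1) (h0 : 0 ≤ ζ) (h1 : ζ ≤ 1) (f : SignType → E) :
    ∫ t, f t ∂(edgeMeasure 1 p ζ) = (p * (1 - ζ)) • f 1 + (p * ζ) • f (-1) + (1 - p) • f 0 := by
  have hf : ∀ (c : ℝ) (t : SignType), IsFiniteMeasure (ENNReal.ofReal c • Measure.dirac t) :=
    fun c t => Measure.smul_finite _ ENNReal.ofReal_ne_top
  unfold edgeMeasure
  rw [integral_add_measure .of_finite .of_finite, integral_add_measure .of_finite .of_finite,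
    integral_smul_measure, integral_smul_measure, integral_smul_measure, integral_dirac,
    integral_dirac, integral_dirac, ENNReal.toReal_ofReal (by nlinarith),
    ENNReal.toReal_ofReal (by positivity), ENNReal.toReal_ofReal (by linarith)]
  simp

theorem isProbabilityMeasure_edgeMeasure (hp0 : 0 ≤ p) (hp1 : p ≤ 1) (h0 : 0 ≤ ζ) (h1 : ζ ≤ 1)
    (s : ℤˣ) : IsProbabilityMeasure (edgeMeasure s p ζ) := by
  constructor
  simp only [edgeMeasure, Measure.coe_add, Measure.coe_smul, Pi.add_apply, Pi.smul_apply,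
    measure_univ, smul_eq_mul, mul_one]
  rw [← ENNReal.ofReal_add (by nlinarith) (by positivity),
    ← ENNReal.ofReal_add (by nlinarith) (by linarith)]
  ring_nf
  simp

theorem isProbabilityMeasure_cbm (hp0 : 0 ≤ p) (hp1 : p ≤ 1) (h0 : 0 ≤ ζ) (h1 : ζ ≤ 1)
    (σ : Labeling n) : IsProbabilityMeasure (cbm σ p ζ) := by
  have := isProbabilityMeasure_edgeMeasure hp0 hp1 h0 h1
  unfold cbm
  infer_instance

theorem cbm_one : cbm (1 : Labeling n) p ζ = Measure.pi fun _ => edgeMeasure 1 p ζ := by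
  simp [cbm]

theorem integral_cbm_one_prod {𝕜 : Type*} [RCLike 𝕜] (hp0 : 0 ≤ p) (hp1 : p ≤ 1) (h0 : 0 ≤ ζ)
    (h1 : ζ ≤ 1) (f : VertexPair n → SignType → 𝕜) :
    ∫ X, ∏ e, f e (X e) ∂(cbm (1 : Labeling n) p ζ) =
      ∏ e, ((p * (1 - ζ)) • f e 1 + (p * ζ) • f e (-1) + (1 - p) • f e 0) := by
  have := isProbabilityMeasure_edgeMeasure hp0 hp1 h0 h1
  rw [cbm_one, integral_fintype_prod_eq_prod]
  exact Finset.prod_congr rfl fun e _ => integral_edgeMeasure_one hp0 hp1 h0 h1 _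

/-- Markov's inequality for a product of functions of the independent entries. -/
theorem measureReal_cbm_one_le_prod (hp0 : 0 ≤ p) (hp1 : p ≤ 1) (h0 : 0 ≤ ζ) (h1 : ζ ≤ 1)
    {S : Set (CensoredGraph n)} {c : ℝ} (hc : 0 ≤ c) (f : VertexPair n → SignType → ℝ)
    (b : VertexPair n → ℝ) (hf : ∀ e t, 0 ≤ f e t)
    (hb : ∀ e, p * (1 - ζ) * f e 1 + p * ζ * f e (-1) + (1 - p) * f e 0 ≤ b e)
    (hS : ∀ X ∈ S, 1 ≤ c * ∏ e, f e (X e)) :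
    (cbm (1 : Labeling n) p ζ).real S ≤ c * ∏ e, b e := by
  have := isProbabilityMeasure_cbm (n := n) hp0 hp1 h0 h1 1
  calc (cbm (1 : Labeling n) p ζ).real S
      = ∫ X, S.indicator 1 X ∂(cbm (1 : Labeling n) p ζ) := by
        rw [integral_indicator_one .of_discrete]
    _ ≤ ∫ X, c * ∏ e, f e (X e) ∂(cbm (1 : Labeling n) p ζ) := by
        refine integral_mono .of_finite .of_finite fun X => ?_
        by_cases hX : X ∈ S
        · simpa [hX] using hS X hX
        · simp only [Set.indicator_of_notMem hX]
          exact mul_nonneg hc (Finset.prod_nonneg fun e _ => hf e _)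
    _ = c * ∏ e, (p * (1 - ζ) * f e 1 + p * ζ * f e (-1) + (1 - p) * f e 0) := by
        rw [integral_const_mul, integral_cbm_one_prod hp0 hp1 h0 h1]
        simp only [smul_eq_mul]
    _ ≤ _ := by
        refine mul_le_mul_of_nonneg_left (Finset.prod_le_prod (fun e _ => ?_) fun e _ => hb e) hc
        have h2 := hf e 1
        have h3 := hf e (-1)
        have h4 := hf e 0
        have : 0 ≤ 1 - ζ := by linarith
        have : 0 ≤ 1 - p := by linarith
        positivity

end

/-! ### Bounds for the bad events -/

section
variable {n : ℕ} {p ζ : ℝ}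

/-- The union bound over a finite index type. -/
theorem measureReal_exists_le {Ω ι : Type*} [MeasurableSpace Ω] [Fintype ι] (P : Measure Ω)
    [IsFiniteMeasure P] (S : ι → Set Ω) :
    P.real {x | ∃ i, x ∈ S i} ≤ ∑ i, P.real (S i) := by
  have : {x | ∃ i, x ∈ S i} = ⋃ i ∈ (Finset.univ : Finset ι), S i := by
    ext x; simp
  rw [this]
  exact measureReal_biUnion_finset_le _ _

theorem card_vertexPair_le (n : ℕ) : (Fintype.card (VertexPair n) : ℝ) ≤ (n : ℝ) ^ 2 := by
  have := Fintype.card_subtype_le fun e : Fin n × Fin n => e.1 < e.2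
  rw [Fintype.card_prod, Fintype.card_fin] at this
  rw [sq]
  exact_mod_cast this

theorem exp_le_one_add_add_sq {x : ℝ} (hx : |x| ≤ 1) : Real.exp x ≤ 1 + x + x ^ 2 := by
  have := (abs_le.1 (Real.abs_exp_sub_one_sub_id_le hx)).2
  linarith

/-- The law of the entries is centred sub-Gaussian with variance proxy of order `p`. -/
theorem edge_mgf_le (hp0 : 0 ≤ p) (hp1 : p ≤ 1) (h0 : 0 ≤ ζ) (h1 : ζ ≤ 1 / 2) {l : ℝ}
    (hl : |l| ≤ 1 / 2) :
    p * (1 - ζ) * Real.exp (l * (1 - p * (1 - 2 * ζ))) +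
      p * ζ * Real.exp (l * (-1 - p * (1 - 2 * ζ))) +
        (1 - p) * Real.exp (l * (0 - p * (1 - 2 * ζ))) ≤ Real.exp (p * l ^ 2) := by
  set m := p * (1 - 2 * ζ) with hm
  have hm0 : 0 ≤ m := mul_nonneg hp0 (by linarith)
  have hm1 : m ≤ 1 := by nlinarith
  have hb : ∀ x : ℝ, |x| ≤ 2 → Real.exp (l * x) ≤ 1 + l * x + (l * x) ^ 2 := fun x hx =>
    exp_le_one_add_add_sq (by
      rw [abs_mul]
      nlinarith [abs_nonneg l, abs_nonneg x])
  have e1 := hb (1 - m) (abs_le.2 ⟨by linarith, by linarith⟩)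
  have e2 := hb (-1 - m) (abs_le.2 ⟨by linarith, by linarith⟩)
  have e3 := hb (0 - m) (abs_le.2 ⟨by linarith, by linarith⟩)
  have hz : 0 ≤ 1 - ζ := by linarith
  have hq : 0 ≤ 1 - p := by linarith
  calc _ ≤ p * (1 - ζ) * (1 + l * (1 - m) + (l * (1 - m)) ^ 2) +
      p * ζ * (1 + l * (-1 - m) + (l * (-1 - m)) ^ 2) +
        (1 - p) * (1 + l * (0 - m) + (l * (0 - m)) ^ 2) := by gcongr
    _ = 1 + l ^ 2 * (p - m ^ 2) := by rw [hm]; ring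
    _ ≤ p * l ^ 2 + 1 := by nlinarith [sq_nonneg l, sq_nonneg m, mul_nonneg (sq_nonneg l) (sq_nonneg m)]
    _ ≤ _ := Real.add_one_le_exp _

/-- Discrepancy with respect to all sign vectors. -/
theorem measureReal_cut_le (hp0 : 0 < p) (hp1 : p ≤ 1) (h0 : 0 ≤ ζ) (h1 : ζ ≤ 1 / 2)
    (hd : 4 ≤ n * p) :
    (cbm (1 : Labeling n) p ζ).real {X | ∃ s : Fin n → ℝ, (∀ i, s i = 1 ∨ s i = -1) ∧
      4 * n * √(n * p) < ∑ i, ∑ j, (adjMatrix X i j - if i = j then 0 else p * (1 - 2 * ζ)) *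
        (s i * s j)} ≤ (2 * Real.exp (-1)) ^ n := by
  have hprob := isProbabilityMeasure_cbm (n := n) hp0.le hp1 h0 (by linarith : ζ ≤ 1) 1
  set d := (n : ℝ) * p with hdd
  have hd0 : 0 < d := by linarith
  set μ := p * (1 - 2 * ζ) with hμ
  set val : Labeling n → Fin n → ℝ := fun s i => ((s i : ℤ) : ℝ) with hval
  set ev : Labeling n → Set (CensoredGraph n) := fun s =>
    {X | 2 * n * √d < ∑ e : VertexPair n, (val s e.1.1 * val s e.1.2) *
      (((X e : SignType) : ℝ) - μ)} with hev
  have hsub : {X : CensoredGraph n | ∃ s : Fin n → ℝ, (∀ i, s i = 1 ∨ s i = -1) ∧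
      4 * n * √d < ∑ i, ∑ j, (adjMatrix X i j - if i = j then 0 else μ) * (s i * s j)} ⊆
      {X | ∃ s, X ∈ ev s} := by
    rintro X ⟨s, hs, hX⟩
    refine ⟨fun i => if s i = 1 then 1 else -1, ?_⟩
    have hvs : val (fun i => if s i = 1 then 1 else -1) = s := by
      funext i
      rcases hs i with h | h
      · simp [hval, h]
      · simp [hval, h]; norm_num
    simp only [hev, Set.mem_ofPred_eq, hvs]
    rw [sum_sum_eq_two_mul_sum_pairs
      (F := fun i j => (adjMatrix X i j - if i = j then 0 else μ) * (s i * s j))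
      (fun i j => by rw [adjMatrix_symm, mul_comm (s i)]; simp only [eq_comm])
      (fun i => by simp [adjMatrix_self])] at hX
    have : ∀ e : VertexPair n, (adjMatrix X e.1.1 e.1.2 - if e.1.1 = e.1.2 then 0 else μ) *
        (s e.1.1 * s e.1.2) = (s e.1.1 * s e.1.2) * (((X e : SignType) : ℝ) - μ) := fun e => by
      rw [adjMatrix_pair, if_neg e.2.ne, mul_comm]
    simp only [this] at hX
    linarith
  have hone : ∀ s, (cbm (1 : Labeling n) p ζ).real (ev s) ≤ Real.exp (-n) := by
    intro s
    have hvv : ∀ e : VertexPair n, (val s e.1.1 * val s e.1.2) ^ 2 = 1 := fun e => by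
      simp only [hval]
      rcases Int.units_eq_one_or (s e.1.1) with h | h <;>
        rcases Int.units_eq_one_or (s e.1.2) with h' | h' <;> simp [h, h']
    have hsd : 2 ≤ √d := Real.le_sqrt_of_sq_le (by linarith)
    -- Exponential Markov with tilt `1 / √d`, which is at most `1/2` as `d ≥ 4`. The deviation
    -- contributes `exp (-2n)` and the variance at most `exp n`; the resulting `exp (-n)` beats the
    -- `2ⁿ` sign vectors.
    refine (measureReal_cbm_one_le_prod hp0.le hp1 h0 (by linarith)
      (c := Real.exp (-(2 * n))) (Real.exp_pos _).le
      (fun e t => Real.exp ((val s e.1.1 * val s e.1.2 / √d) * ((t : ℝ) - μ)))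
      (fun _ => Real.exp (p / d)) (fun e t => (Real.exp_pos _).le) ?_ ?_).trans ?_
    · intro e
      have habs : |val s e.1.1 * val s e.1.2 / √d| ≤ 1 / 2 := by
        have hv1 : |val s e.1.1 * val s e.1.2| = 1 := by
          rcases mul_self_eq_one_iff.1 ((sq _).symm.trans (hvv e)) with h | h <;> simp [h]
        rw [abs_div, abs_of_pos (by linarith : 0 < √d), hv1]
        exact one_div_le_one_div_of_le two_pos hsd
      have := edge_mgf_le hp0.le hp1 h0 h1 habs
      have h2 : p * (val s e.1.1 * val s e.1.2 / √d) ^ 2 = p / d := by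
        rw [div_pow, hvv, Real.sq_sqrt hd0.le]; ring
      rw [h2] at this
      simpa using this
    · intro X hX
      rw [← Real.exp_sum, ← Real.exp_add]
      refine Real.one_le_exp ?_
      have h3 : ∑ e : VertexPair n, (val s e.1.1 * val s e.1.2 / √d) * (((X e : SignType) : ℝ) - μ)
          = (∑ e : VertexPair n, (val s e.1.1 * val s e.1.2) * (((X e : SignType) : ℝ) - μ)) / √d := by
        rw [Finset.sum_div]
        exact Finset.sum_congr rfl fun e _ => by ring
      rw [h3]
      have h4 : 2 * (n : ℝ) ≤ (∑ e : VertexPair n, (val s e.1.1 * val s e.1.2) *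
          (((X e : SignType) : ℝ) - μ)) / √d := by
        rw [le_div_iff₀ (by linarith)]
        exact (le_of_lt hX)
      linarith
    · rw [Finset.prod_const, ← Real.exp_nat_mul, ← Real.exp_add, Finset.card_univ]
      refine Real.exp_le_exp.2 ?_
      have hn : (0 : ℝ) < n := by
        by_contra h
        have : (n : ℝ) = 0 := le_antisymm (not_lt.1 h) (Nat.cast_nonneg n)
        rw [hdd, this] at hd; linarith
      have h5 : p / d = 1 / n := by rw [hdd]; field_simp
      have h6 := card_vertexPair_le n
      rw [h5]
      have h7 : (Fintype.card (VertexPair n) : ℝ) * (1 / n) ≤ n := by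
        rw [mul_one_div, div_le_iff₀ hn, ← sq]; exact h6
      linarith
  calc _ ≤ (cbm (1 : Labeling n) p ζ).real {X | ∃ s, X ∈ ev s} := measureReal_mono hsub
    _ ≤ ∑ s : Labeling n, (cbm (1 : Labeling n) p ζ).real (ev s) := measureReal_exists_le _ _
    _ ≤ ∑ s : Labeling n, Real.exp (-n) := Finset.sum_le_sum fun s _ => hone s
    _ = _ := by
        rw [Finset.sum_const, Finset.card_univ, Fintype.card_fun, Fintype.card_fin,
          Fintype.card_units_int, nsmul_eq_mul, mul_pow, ← Real.exp_nat_mul]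
        push_cast
        ring_nf

/-- Maximal degree. -/
theorem measureReal_degree_le (hp0 : 0 ≤ p) (hp1 : p ≤ 1) (h0 : 0 ≤ ζ) (h1 : ζ ≤ 1) :
    (cbm (1 : Labeling n) p ζ).real {X | ∃ i, 4 * (n * p) < ∑ j, |adjMatrix X i j|} ≤
      n * Real.exp (-(2 * (n * p))) := by
  have hprob := isProbabilityMeasure_cbm (n := n) hp0 hp1 h0 h1 1
  have hone : ∀ i : Fin n, (cbm (1 : Labeling n) p ζ).real
      {X | 4 * (n * p) < ∑ j, |adjMatrix X i j|} ≤ Real.exp (-(2 * (n * p))) := by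
    intro i
    refine (measureReal_cbm_one_le_prod hp0 hp1 h0 h1 (c := Real.exp (-(4 * (n * p))))
      (Real.exp_pos _).le (fun e t => Real.exp (incidence i e * |(t : ℝ)|))
      (fun e => Real.exp (2 * p * incidence i e)) (fun e t => (Real.exp_pos _).le) ?_ ?_).trans ?_
    · intro e
      rcases incidence_eq_zero_or_one i e with h | h
      · simp [h]; linarith
      · have h2 : Real.exp 1 ≤ 3 := (Real.exp_one_lt_d9.le).trans (by norm_num)
        have h3 := Real.add_one_le_exp (2 * p)
        simp only [h, SignType.coe_one, SignType.coe_neg, SignType.coe_zero, abs_neg, abs_one,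
          abs_zero, mul_one, mul_zero, Real.exp_zero]
        nlinarith
    · intro X hX
      simp only [Set.mem_ofPred_eq, sum_abs_adjMatrix_eq] at hX
      rw [← Real.exp_sum, ← Real.exp_add]
      exact Real.one_le_exp (by linarith)
    · rw [← Real.exp_sum, ← Finset.mul_sum, sum_incidence, ← Real.exp_add]
      exact Real.exp_le_exp.2 (by linarith)
  calc _ ≤ ∑ i : Fin n, _ := measureReal_exists_le _ _
    _ ≤ ∑ i : Fin n, Real.exp (-(2 * (n * p))) := Finset.sum_le_sum fun i _ => hone i
    _ = _ := by simp

end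

/-! ### Local sparsity. -/

section
variable {n : ℕ} {p ζ : ℝ}

theorem sum_abs_adjMatrix_subset_eq (X : CensoredGraph n) (R : Finset (Fin n)) :
    ∑ i ∈ R, ∑ j ∈ R, |adjMatrix X i j| =
      2 * ∑ e : VertexPair n, (if e.1.1 ∈ R ∧ e.1.2 ∈ R then 1 else 0) *
        |((X e : SignType) : ℝ)| := by
  have h := sum_sum_eq_two_mul_sum_pairs
    (F := fun i j => (if i ∈ R ∧ j ∈ R then 1 else 0) * |adjMatrix X i j|)
    (fun i j => by rw [adjMatrix_symm]; simp only [and_comm]) (fun i => by simp [adjMatrix_self])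
  simp only [adjMatrix_pair] at h
  rw [← h]
  have hR : ∀ f : Fin n → ℝ, ∑ i ∈ R, f i = ∑ i, if i ∈ R then f i else 0 := fun f => by simp
  rw [hR]
  refine Finset.sum_congr rfl fun i _ => ?_
  rw [hR]
  by_cases hi : i ∈ R <;> simp [hi]

theorem sum_pairs_subset_le (R : Finset (Fin n)) :
    ∑ e : VertexPair n, (if e.1.1 ∈ R ∧ e.1.2 ∈ R then (1 : ℝ) else 0) ≤ (R.card : ℝ) ^ 2 := by
  have h := sum_sum_eq_two_mul_sum_pairs
    (F := fun i j => if i ∈ R ∧ j ∈ R then if i = j then 0 else (1 : ℝ) else 0)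
    (fun i j => by simp only [and_comm, eq_comm]) (fun i => by simp)
  have h1 : ∀ e : VertexPair n, (if e.1.1 ∈ R ∧ e.1.2 ∈ R then
      if e.1.1 = e.1.2 then 0 else (1 : ℝ) else 0) = if e.1.1 ∈ R ∧ e.1.2 ∈ R then 1 else 0 :=
    fun e => by simp [e.2.ne]
  simp only [h1] at h
  have h2 : ∑ i, ∑ j, (if i ∈ R ∧ j ∈ R then if i = j then 0 else (1 : ℝ) else 0) ≤
      ∑ i, ∑ j, (if i ∈ R then 1 else 0) * (if j ∈ R then 1 else 0) := by
    refine Finset.sum_le_sum fun i _ => Finset.sum_le_sum fun j _ => ?_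
    by_cases hi : i ∈ R <;> by_cases hj : j ∈ R <;> simp [hi, hj]
    split_ifs <;> norm_num
  rw [← Finset.sum_mul_sum, ← sq] at h2
  have h3 : (∑ i, if i ∈ R then (1 : ℝ) else 0) = R.card := by simp
  have h4 : 0 ≤ ∑ e : VertexPair n, (if e.1.1 ∈ R ∧ e.1.2 ∈ R then (1 : ℝ) else 0) :=
    Finset.sum_nonneg fun e _ => by split_ifs <;> norm_num
  rw [h3] at h2
  linarith

/-- Local sparsity: a set of `s` vertices spans few edges. -/
theorem measureReal_sparse_le (hp0 : 0 < p) (hp1 : p ≤ 1) (h0 : 0 ≤ ζ) (h1 : ζ ≤ 1) {c : ℝ}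
    (hc : 0 < c) (hcd : 2 ≤ c * (n * p)) (hnp : 1 ≤ n * p) :
    (cbm (1 : Labeling n) p ζ).real {X | ∃ R : Finset (Fin n),
      (R.card : ℝ) ≤ Real.exp (-(6 / c)) * n ∧
        2 * c * (n * p) * R.card < ∑ i ∈ R, ∑ j ∈ R, |adjMatrix X i j|} ≤
      n * Real.exp (1 - 2 * (n * p)) := by
  have hprob := isProbabilityMeasure_cbm (n := n) hp0.le hp1 h0 h1 1
  set d := (n : ℝ) * p with hd
  have hd0 : 0 < d := by
    by_contra h
    nlinarith [not_lt.1 h]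
  have hn : (0 : ℝ) < n := by
    by_contra h
    nlinarith [not_lt.1 h]
  set ev : Finset (Fin n) → Set (CensoredGraph n) := fun R =>
    {X | (R.card : ℝ) ≤ Real.exp (-(6 / c)) * n ∧
        2 * c * d * R.card < ∑ i ∈ R, ∑ j ∈ R, |adjMatrix X i j|} with hev
  have hone : ∀ R : Finset (Fin n), (cbm (1 : Labeling n) p ζ).real (ev R) ≤
      if R.card = 0 then 0 else
        Real.exp (-2 * d * R.card) * (R.card / n) ^ R.card := by
    intro R
    split_ifs with hR
    · have : ev R = ∅ := by
        rw [Finset.card_eq_zero] at hR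
        subst hR
        ext X; simp [hev]
      rw [this]; simp
    by_cases hRn : (R.card : ℝ) ≤ Real.exp (-(6 / c)) * n
    swap
    · have : ev R = ∅ := by ext X; simp [hev, hRn]
      rw [this]; simp; positivity
    have hs0 : (0 : ℝ) < R.card := by exact_mod_cast Nat.pos_of_ne_zero hR
    set s : ℝ := (R.card : ℝ) with hs
    -- This tilt makes the moment generating function of the edges inside `R` at most `exp (d s)`,
    -- while the deviation gains powers of `s / n` that pay for the choice of `R`.
    set l := Real.log (n / s) with hl
    have hexpl : Real.exp l = n / s := Real.exp_log (by positivity)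
    have hl6 : 6 ≤ c * l := by
      have : 6 / c ≤ l := by
        rw [hl, Real.le_log_iff_exp_le (by positivity), le_div_iff₀ hs0]
        calc Real.exp (6 / c) * s ≤ Real.exp (6 / c) * (Real.exp (-(6 / c)) * n) := by gcongr
          _ = n := by rw [← mul_assoc, ← Real.exp_add]; simp
      rw [div_le_iff₀ hc] at this; linarith
    have hl0 : 0 ≤ l := by
      by_contra h
      nlinarith [not_le.1 h]
    refine (measureReal_cbm_one_le_prod hp0.le hp1 h0 h1 (c := Real.exp (-(l * (c * d * s))))
      (Real.exp_pos _).le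
      (fun e t => Real.exp (l * ((if e.1.1 ∈ R ∧ e.1.2 ∈ R then 1 else 0) * |(t : ℝ)|)))
      (fun e => Real.exp (p * (n / s) * (if e.1.1 ∈ R ∧ e.1.2 ∈ R then 1 else 0)))
      (fun e t => (Real.exp_pos _).le) ?_ ?_).trans ?_
    · intro e
      by_cases he : e.1.1 ∈ R ∧ e.1.2 ∈ R
      · have h3 := Real.add_one_le_exp (p * (n / s))
        simp only [he, and_self, if_true, SignType.coe_one, SignType.coe_neg, SignType.coe_zero,
          abs_neg, abs_one, abs_zero, mul_one, mul_zero, Real.exp_zero, hexpl]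
        nlinarith
      · simp only [he, if_false, zero_mul, mul_zero, Real.exp_zero]
        linarith
    · intro X hX
      have h2 := hX.2
      rw [sum_abs_adjMatrix_subset_eq] at h2
      rw [← Real.exp_sum, ← Real.exp_add, ← Finset.mul_sum]
      refine Real.one_le_exp ?_
      have h3 : c * d * s ≤ ∑ e : VertexPair n, (if e.1.1 ∈ R ∧ e.1.2 ∈ R then 1 else 0) *
        |((X e : SignType) : ℝ)| := by linarith
      nlinarith [mul_le_mul_of_nonneg_left h3 hl0]
    · have h4 : (s / n) ^ R.card = Real.exp (-(s * l)) := by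
        rw [hs, ← mul_neg, Real.exp_nat_mul, Real.exp_neg, hexpl, inv_div]
      rw [h4, ← Real.exp_sum, ← Finset.mul_sum, ← Real.exp_add, ← Real.exp_add]
      refine Real.exp_le_exp.2 ?_
      have h5 := mul_le_mul_of_nonneg_left (sum_pairs_subset_le R)
        (by positivity : 0 ≤ p * (n / s))
      have h6 : p * (n / s) * s ^ 2 = d * s := by rw [hd]; field_simp
      rw [← hs, h6] at h5
      -- Half of the exponent `c d s l` is spent on `3 d s`, the other half on `s l`. After paying
      -- `d s` for the moments, `exp (-2 d s) (s / n)^s` remains.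
      have h7 : 6 * (d * s) ≤ c * l * (d * s) := mul_le_mul_of_nonneg_right hl6 (by positivity)
      have h8 : 2 * (s * l) ≤ c * d * (s * l) := mul_le_mul_of_nonneg_right hcd (by positivity)
      linarith
  -- The left side is one term of the binomial expansion of `(1 + s / n)ⁿ`.
  have hchoose : ∀ s : ℕ, (n.choose s : ℝ) * ((s : ℝ) / n) ^ s ≤ Real.exp s := by
    intro s
    rcases lt_or_ge n s with hns | hns
    · rw [Nat.choose_eq_zero_of_lt hns]; simp; positivity
    calc (n.choose s : ℝ) * ((s : ℝ) / n) ^ s ≤ ((s : ℝ) / n + 1) ^ n := by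
          rw [add_pow]
          refine le_trans (le_of_eq ?_) (Finset.single_le_sum
            (f := fun m => ((s : ℝ) / n) ^ m * 1 ^ (n - m) * (n.choose m : ℝ))
            (fun m _ => by positivity) (Finset.mem_range.2 (Nat.lt_succ_of_le hns)))
          simp; ring
      _ ≤ Real.exp ((s : ℝ) / n) ^ n := by
          gcongr
          exact Real.add_one_le_exp _
      _ = Real.exp s := by
          rw [← Real.exp_nat_mul]; congr 1; field_simp
  calc _ ≤ ∑ R : Finset (Fin n), (cbm (1 : Labeling n) p ζ).real (ev R) :=
        measureReal_exists_le _ ev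
    _ ≤ ∑ R : Finset (Fin n), (if R.card = 0 then 0 else
        Real.exp (-2 * d * R.card) * ((R.card : ℝ) / n) ^ R.card) :=
        Finset.sum_le_sum fun R _ => hone R
    _ = ∑ s ∈ Finset.range (n + 1), (n.choose s : ℝ) * (if s = 0 then 0 else
        Real.exp (-2 * d * s) * ((s : ℝ) / n) ^ s) := by
        have := Finset.sum_powerset_apply_card (fun s : ℕ => (if s = 0 then 0 else
          Real.exp (-2 * d * s) * ((s : ℝ) / n) ^ s)) (x := (Finset.univ : Finset (Fin n)))
        rw [Finset.powerset_univ, Finset.card_univ, Fintype.card_fin] at this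
        rw [this]
        simp only [nsmul_eq_mul]
    _ ≤ ∑ s ∈ Finset.range (n + 1), (if s = 0 then 0 else Real.exp (1 - 2 * d)) := by
        refine Finset.sum_le_sum fun s _ => ?_
        split_ifs with hs
        · simp
        · have hs1 : (1 : ℝ) ≤ s := by exact_mod_cast Nat.one_le_iff_ne_zero.2 hs
          calc _ = Real.exp (-2 * d * s) * ((n.choose s : ℝ) * ((s : ℝ) / n) ^ s) := by ring
            _ ≤ Real.exp (-2 * d * s) * Real.exp s := by gcongr; exact hchoose s
            _ ≤ _ := by
              rw [← Real.exp_add]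
              refine Real.exp_le_exp.2 ?_
              nlinarith
    _ = _ := by
        rw [Finset.sum_range_succ']
        simp

end

/-! ### Vertices of small signed degree -/

section
variable {n : ℕ} {p ζ ρ h : ℝ}

/-- The Cramér transform of an entry at the optimal tilt. -/
theorem edge_tilt (hρ1 : Real.exp (-ρ) * (1 - ζ) = h) (hρ2 : Real.exp ρ * ζ = h) :
    p * (1 - ζ) * Real.exp (-ρ) + p * ζ * Real.exp ρ + (1 - p) = 1 - p * (1 - 2 * h) := by
  linear_combination p * hρ1 + p * hρ2

/-- Chernoff's bound with the tilt that gives the values `1` and `-1` equal weight `p h`; each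
incident pair contributes `1 - p (1 - 2h)`. -/
theorem measureReal_signedDegree_le (hp0 : 0 ≤ p) (hp1 : p ≤ 1) (h0 : 0 ≤ ζ) (h1 : ζ ≤ 1)
    (hρ : 0 ≤ ρ) (hρ1 : Real.exp (-ρ) * (1 - ζ) = h) (hρ2 : Real.exp ρ * ζ = h) (i : Fin n)
    (t : ℝ) :
    (cbm (1 : Labeling n) p ζ).real {X | signedDegree X i ≤ t} ≤
      Real.exp (ρ * t) * Real.exp (-(p * (1 - 2 * h) * (n - 1))) := by
  refine (measureReal_cbm_one_le_prod hp0 hp1 h0 h1 (c := Real.exp (ρ * t))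
    (Real.exp_pos _).le (fun e t => Real.exp (-ρ * (incidence i e * (t : ℝ))))
    (fun e => Real.exp (-(p * (1 - 2 * h)) * incidence i e)) (fun e t => (Real.exp_pos _).le)
    ?_ ?_).trans ?_
  · intro e
    rcases incidence_eq_zero_or_one i e with he | he
    · simp [he]; linarith
    · simp only [he, SignType.coe_one, SignType.coe_neg, SignType.coe_zero, mul_one, mul_zero,
        Real.exp_zero, mul_neg, neg_neg]
      rw [edge_tilt hρ1 hρ2]
      have := Real.add_one_le_exp (-(p * (1 - 2 * h)))
      linarith
  · intro X hX
    simp only [Set.mem_ofPred_eq, signedDegree_eq] at hX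
    rw [← Real.exp_sum, ← Real.exp_add, ← Finset.mul_sum]
    refine Real.one_le_exp ?_
    nlinarith
  · rw [← Real.exp_sum, ← Finset.mul_sum, sum_incidence]
    refine le_of_eq ?_
    ring_nf

theorem eq_of_incidence_eq_one {e₀ e : VertexPair n} (h1 : incidence e₀.1.1 e = 1)
    (h2 : incidence e₀.1.2 e = 1) : e = e₀ := by
  obtain ⟨⟨a, b⟩, hab⟩ := e
  obtain ⟨⟨i, k⟩, hik⟩ := e₀
  simp only [incidence] at h1 h2 hab hik
  have hia : a = i ∨ b = i := by
    by_contra! hne; simp [hne.1, hne.2] at h1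
  have hka : a = k ∨ b = k := by
    by_contra! hne; simp [hne.1, hne.2] at h2
  have : a = i ∧ b = k := by
    rcases hia with rfl | rfl <;> rcases hka with rfl | rfl
    · exact absurd hik (lt_irrefl _)
    · exact ⟨rfl, rfl⟩
    · exact absurd hik (lt_asymm hab)
    · exact absurd hik (lt_irrefl _)
  obtain ⟨rfl, rfl⟩ := this
  rfl

/-- Two vertices of small signed degree in the presence of prescribed edges. -/
theorem measureReal_two_signedDegree_le (hp0 : 0 ≤ p) (hp1 : p ≤ 1) (h0 : 0 ≤ ζ) (h1 : ζ ≤ 1)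
    (hρ : 0 ≤ ρ) (hρ1 : Real.exp (-ρ) * (1 - ζ) = h) (hρ2 : Real.exp ρ * ζ = h) (hh0 : 0 ≤ h)
    (hh1 : h ≤ 1 / 2) (e₀ : VertexPair n) (Q : Finset (VertexPair n)) (t : ℝ) :
    (cbm (1 : Labeling n) p ζ).real {X | (∀ e ∈ Q, X e ≠ 0) ∧ signedDegree X e₀.1.1 < t ∧
        signedDegree X e₀.1.2 < t} ≤
      Real.exp (2 * ρ * t) * (p * Real.exp (2 * ρ + 2)) ^ Q.card * Real.exp (2 * ρ + 2) *
        Real.exp (-(2 * (p * (1 - 2 * h)) * (n - 1))) := by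
  set H := 1 - 2 * h with hH
  have hH0 : 0 ≤ H := by linarith
  have hpH : p * H ≤ 1 := by nlinarith
  have hpH0 : 0 ≤ p * H := by positivity
  set i := e₀.1.1 with hi
  set k := e₀.1.2 with hk
  have hz : 0 ≤ 1 - ζ := by linarith
  have hp : 0 ≤ 1 - p := by linarith
  have hbig : ∀ u : ℝ, |u| ≤ 2 → Real.exp (ρ * u) ≤ Real.exp (2 * ρ) := fun u hu =>
    Real.exp_le_exp.2 (by nlinarith [(abs_le.1 hu).2])
  -- For the prescribed pairs and for `e₀`, which is incident to both vertices, the tilt is bounded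
  -- crudely. The factor `exp 2` restores their share of the decay, so that the product runs over
  -- all pairs uniformly.
  have hcomp : ∀ u : ℝ, u ≤ 2 → Real.exp (2 * ρ) ≤ Real.exp (2 * ρ + 2) * Real.exp (-(p * H) * u) :=
    fun u hu => by
      rw [← Real.exp_add]
      exact Real.exp_le_exp.2 (by nlinarith)
  refine (measureReal_cbm_one_le_prod hp0 hp1 h0 h1 (c := Real.exp (2 * ρ * t))
    (Real.exp_pos _).le
    (fun e x => (if e ∈ Q ∧ x = 0 then 0 else 1) *
      Real.exp (-ρ * ((incidence i e + incidence k e) * (x : ℝ))))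
    (fun e => (if e ∈ Q then p * Real.exp (2 * ρ + 2) else 1) *
      (if e = e₀ then Real.exp (2 * ρ + 2) else 1) *
        Real.exp (-(p * H) * (incidence i e + incidence k e)))
    (fun e x => by positivity) ?_ ?_).trans ?_
  · intro e
    set u := incidence i e + incidence k e with hu
    have hu2 : 0 ≤ u ∧ u ≤ 2 := by
      rcases incidence_eq_zero_or_one i e with h2 | h2 <;>
        rcases incidence_eq_zero_or_one k e with h3 | h3 <;> (simp [hu, h2, h3]; try norm_num)
    have e1 : Real.exp (-ρ * (u * 1)) ≤ Real.exp (2 * ρ) := by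
      have := hbig (-u) (by rw [abs_neg, abs_of_nonneg hu2.1]; exact hu2.2)
      simpa using this
    have e2 : Real.exp (-ρ * (u * -1)) ≤ Real.exp (2 * ρ) := by
      have := hbig u (by rw [abs_of_nonneg hu2.1]; exact hu2.2)
      simpa using this
    have e3 : (1 : ℝ) ≤ Real.exp (2 * ρ) := Real.one_le_exp (by positivity)
    have e4 := hcomp u hu2.2
    have hone : (1 : ℝ) ≤ if e = e₀ then Real.exp (2 * ρ + 2) else 1 := by
      split_ifs
      · exact Real.one_le_exp (by positivity)
      · rfl
    simp only [SignType.coe_one, SignType.coe_neg, SignType.coe_zero, mul_zero, Real.exp_zero]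
    by_cases he : e ∈ Q
    · simp only [he, true_and, if_true, one_ne_zero, if_false, one_mul,
        show (-1 : SignType) ≠ 0 by decide, mul_one]
      rw [mul_one] at e1
      calc p * (1 - ζ) * Real.exp (-ρ * u) + p * ζ * Real.exp (-ρ * (u * -1)) + (1 - p) * 0
          ≤ p * (1 - ζ) * Real.exp (2 * ρ) + p * ζ * Real.exp (2 * ρ) + (1 - p) * 0 := by
            gcongr
        _ = p * Real.exp (2 * ρ) := by ring
        _ ≤ p * (Real.exp (2 * ρ + 2) * Real.exp (-(p * H) * u)) := by gcongr
        _ ≤ p * (Real.exp (2 * ρ + 2) * Real.exp (-(p * H) * u)) *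
            (if e = e₀ then Real.exp (2 * ρ + 2) else 1) :=
            le_mul_of_one_le_right (by positivity) hone
        _ = _ := by ring
    · simp only [he, false_and, if_false, one_mul]
      by_cases hee : e = e₀
      · simp only [hee, if_true]
        calc p * (1 - ζ) * Real.exp (-ρ * (u * 1)) + p * ζ * Real.exp (-ρ * (u * -1)) + (1 - p) * 1
            ≤ p * (1 - ζ) * Real.exp (2 * ρ) + p * ζ * Real.exp (2 * ρ) +
              (1 - p) * Real.exp (2 * ρ) := by
              gcongr
          _ = Real.exp (2 * ρ) := by ring
          _ ≤ _ := e4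
      · simp only [hee, if_false, one_mul]
        have hu01 : u = 0 ∨ u = 1 := by
          rcases incidence_eq_zero_or_one i e with h2 | h2 <;>
            rcases incidence_eq_zero_or_one k e with h3 | h3
          · left; simp [hu, h2, h3]
          · right; simp [hu, h2, h3]
          · right; simp [hu, h2, h3]
          · exact absurd (eq_of_incidence_eq_one h2 h3) hee
        rcases hu01 with h2 | h2
        · rw [h2]; simp; linarith
        · rw [h2]
          have h3 := edge_tilt (p := p) hρ1 hρ2
          have h4 := Real.add_one_le_exp (-(p * H))
          simp only [mul_one, mul_neg, neg_neg]
          linarith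
  · intro X hX
    obtain ⟨hQ, hi', hk'⟩ := hX
    rw [signedDegree_eq] at hi' hk'
    have h2 : ∀ e, (if e ∈ Q ∧ X e = 0 then (0 : ℝ) else 1) = 1 := fun e =>
      if_neg fun ⟨h3, h4⟩ => hQ e h3 h4
    simp only [h2, one_mul, add_mul]
    rw [← Real.exp_sum, ← Real.exp_add, ← Finset.mul_sum, Finset.sum_add_distrib]
    refine Real.one_le_exp ?_
    nlinarith
  · rw [Finset.prod_mul_distrib, Finset.prod_mul_distrib, ← Real.exp_sum, ← Finset.mul_sum,
      Finset.sum_add_distrib, sum_incidence, sum_incidence, Finset.prod_ite_mem_eq]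
    rw [Finset.prod_const, Finset.prod_ite_eq' Finset.univ e₀, if_pos (Finset.mem_univ _)]
    refine le_of_eq ?_
    ring_nf

/-- Fejér-kernel bound for the point probabilities of a signed degree. -/
theorem measureReal_signedDegree_eq_le (hp0 : 0 ≤ p) (hp1 : p ≤ 1 / 2) (h0 : 0 ≤ ζ) (h1 : ζ ≤ 1)
    (hρ1 : Real.exp (-ρ) * (1 - ζ) = h) (hρ2 : Real.exp ρ * ζ = h) (hh0 : 0 ≤ h)
    (hh1 : h ≤ 1 / 2) (i : Fin n) (x θ : ℝ) {M : ℕ} (hM : 0 < M) :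
    (cbm (1 : Labeling n) p ζ).real {X | signedDegree X i = x} ≤
      Real.exp (ρ * x) * Real.exp (-(p * (1 - 2 * h) * (n - 1))) *
        ((∑ j ∈ Finset.range M, ∑ l ∈ Finset.range M,
          Real.exp (-(2 * h * (p * (n - 1)) * (1 - Real.cos (((j : ℝ) - l) * θ))))) / (M : ℝ) ^ 2) := by
  have hprob := isProbabilityMeasure_cbm (n := n) hp0 (by linarith : p ≤ 1) h0 h1 1
  set P := cbm (1 : Labeling n) p ζ with hP
  have hM' : (0 : ℝ) < M := by exact_mod_cast hM
  set z : ℝ → ℂ := fun φ => ((-ρ : ℝ) : ℂ) + ((φ : ℝ) : ℂ) * Complex.I with hz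
  have hchar : ∀ φ : ℝ, ‖∫ X, Complex.exp (z φ * (signedDegree X i : ℂ)) ∂P‖ ≤
      Real.exp (-(p * (1 - 2 * h) * (n - 1))) *
        Real.exp (-(2 * h * (p * (n - 1)) * (1 - Real.cos φ))) := by
    intro φ
    have hprodX : ∀ X : CensoredGraph n, Complex.exp (z φ * (signedDegree X i : ℂ)) =
        ∏ e, Complex.exp (z φ * ((incidence i e * ((X e : SignType) : ℝ) : ℝ) : ℂ)) := fun X => by
      rw [signedDegree_eq, ← Complex.exp_sum, ← Finset.mul_sum, Complex.ofReal_sum]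
    have hfac : ∀ e : VertexPair n,
        ‖(p * (1 - ζ)) • Complex.exp (z φ * ((incidence i e * ((1 : SignType) : ℝ) : ℝ) : ℂ)) +
          (p * ζ) • Complex.exp (z φ * ((incidence i e * ((-1 : SignType) : ℝ) : ℝ) : ℂ)) +
          (1 - p) • Complex.exp (z φ * ((incidence i e * ((0 : SignType) : ℝ) : ℝ) : ℂ))‖ ≤
        Real.exp (-(p * (1 - 2 * h * Real.cos φ)) * incidence i e) := by
      intro e
      rcases incidence_eq_zero_or_one i e with he | he
      · simp only [he, zero_mul, Complex.ofReal_zero, mul_zero, Complex.exp_zero, Real.exp_zero,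
          Complex.real_smul, mul_one]
        rw [← Complex.ofReal_add, ← Complex.ofReal_add, Complex.norm_real, Real.norm_eq_abs]
        have : p * (1 - ζ) + p * ζ + (1 - p) = 1 := by ring
        rw [this, abs_one]
      · have h2 : (p * (1 - ζ)) • Complex.exp (z φ) + (p * ζ) • Complex.exp (-z φ) +
            (1 - p) • (1 : ℂ) = ((1 - p * (1 - 2 * h * Real.cos φ) : ℝ) : ℂ) := by
          have h3 : Complex.exp (z φ) = (Real.exp (-ρ) : ℂ) * Complex.exp (φ * Complex.I) := by
            rw [hz, Complex.exp_add, Complex.ofReal_exp]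
          have h4 : Complex.exp (-z φ) = (Real.exp ρ : ℂ) * Complex.exp (-φ * Complex.I) := by
            rw [hz, neg_add, Complex.exp_add, Complex.ofReal_exp]
            simp
          have h5 : 2 * Complex.cos φ = Complex.exp (φ * Complex.I) + Complex.exp (-φ * Complex.I) := by
            rw [Complex.cos]; ring
          have h6 : (Real.exp (-ρ) : ℂ) * (1 - ζ) = h := by exact_mod_cast congrArg Complex.ofReal hρ1
          have h7 : (Real.exp ρ : ℂ) * ζ = h := by exact_mod_cast congrArg Complex.ofReal hρ2
          rw [h3, h4]
          simp only [Complex.real_smul]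
          push_cast at h6 h7 ⊢
          linear_combination p * Complex.exp (φ * Complex.I) * h6 +
            p * Complex.exp (-φ * Complex.I) * h7 - p * h * h5
        simp only [he, SignType.coe_one, SignType.coe_neg, SignType.coe_zero, mul_one, mul_zero,
          Complex.ofReal_one, Complex.ofReal_neg, Complex.ofReal_zero, Complex.exp_zero,
          mul_neg]
        rw [h2, Complex.norm_real, Real.norm_eq_abs, abs_of_nonneg]
        · have := Real.add_one_le_exp (-(p * (1 - 2 * h * Real.cos φ)))
          linarith
        · have h8 := Real.neg_one_le_cos φ
          have h9 : -1 ≤ 2 * h * Real.cos φ := by nlinarith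
          nlinarith
    simp only [hprodX]
    rw [hP, integral_cbm_one_prod (n := n) hp0 (by linarith) h0 h1
      (fun e t => Complex.exp (z φ * ((incidence i e * ((t : SignType) : ℝ) : ℝ) : ℂ))), norm_prod]
    refine (Finset.prod_le_prod (fun e _ => norm_nonneg _) fun e _ => hfac e).trans (le_of_eq ?_)
    rw [← Real.exp_sum, ← Finset.mul_sum, sum_incidence, ← Real.exp_add]
    congr 1; ring
  -- A nonnegative majorant equal to `M²` where the signed degree is `x`. Expanding the square
  -- reduces its mean to the characteristic function of the tilted law at the frequencies `(j - l)
  -- θ`.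
  set g : CensoredGraph n → ℝ := fun X => Real.exp (ρ * (x - signedDegree X i)) *
    ‖∑ j ∈ Finset.range M, Complex.exp (((j * θ * (signedDegree X i - x) : ℝ) : ℂ) * Complex.I)‖ ^ 2
    with hg
  have hgC : ∀ X, ((g X : ℝ) : ℂ) = ∑ j ∈ Finset.range M, ∑ l ∈ Finset.range M,
      (Real.exp (ρ * x) * Complex.exp (((-((j : ℝ) - l) * θ * x : ℝ) : ℂ) * Complex.I)) *
        Complex.exp (z (((j : ℝ) - l) * θ) * (signedDegree X i : ℂ)) := by
    intro X
    set D := signedDegree X i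
    have h2 : ∀ w : ℂ, ((‖w‖ ^ 2 : ℝ) : ℂ) = w * (starRingEnd ℂ) w := fun w => by
      rw [Complex.mul_conj, Complex.normSq_eq_norm_sq]
    rw [hg]
    simp only [Complex.ofReal_mul]
    rw [h2, map_sum, Finset.sum_mul_sum, Finset.mul_sum]
    refine Finset.sum_congr rfl fun j _ => ?_
    rw [Finset.mul_sum]
    refine Finset.sum_congr rfl fun l _ => ?_
    rw [← Complex.exp_conj, Complex.ofReal_exp, Complex.ofReal_exp, ← Complex.exp_add,
      ← Complex.exp_add, ← Complex.exp_add, ← Complex.exp_add]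
    congr 1
    simp only [map_mul, Complex.conj_I, Complex.conj_ofReal, hz]
    push_cast
    ring
  have hint : ∫ X, g X ∂P ≤ Real.exp (ρ * x) * (Real.exp (-(p * (1 - 2 * h) * (n - 1))) *
      ∑ j ∈ Finset.range M, ∑ l ∈ Finset.range M,
          Real.exp (-(2 * h * (p * (n - 1)) * (1 - Real.cos (((j : ℝ) - l) * θ))))) := by
    have h2 : ∫ X, g X ∂P = ‖∫ X, ((g X : ℝ) : ℂ) ∂P‖ := by
      rw [integral_complex_ofReal, Complex.norm_real, Real.norm_eq_abs, abs_of_nonneg]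
      exact integral_nonneg fun X => by positivity
    rw [h2]
    simp only [hgC]
    rw [integral_finsetSum _ fun _ _ => .of_finite, Finset.mul_sum, Finset.mul_sum]
    refine (norm_sum_le _ _).trans (Finset.sum_le_sum fun j _ => ?_)
    rw [integral_finsetSum _ fun _ _ => .of_finite, Finset.mul_sum, Finset.mul_sum]
    refine (norm_sum_le _ _).trans (Finset.sum_le_sum fun l _ => ?_)
    rw [integral_const_mul, norm_mul, norm_mul, Complex.norm_exp_ofReal_mul_I, mul_one,
      Complex.norm_real, Real.norm_eq_abs, abs_of_pos (Real.exp_pos _)]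
    exact mul_le_mul_of_nonneg_left (hchar _) (Real.exp_pos _).le
  have hmarkov : P.real {X | signedDegree X i = x} ≤ (∫ X, g X ∂P) / (M : ℝ) ^ 2 := by
    rw [← integral_indicator_one .of_discrete, ← integral_div]
    refine integral_mono .of_finite .of_finite fun X => ?_
    by_cases hX : signedDegree X i = x
    · have : g X = (M : ℝ) ^ 2 := by simp [hg, hX]
      simp [hX, this]
      rw [div_self (by positivity)]
    · have : 0 ≤ g X := by positivity
      simp [hX]
      positivity
  refine hmarkov.trans ?_
  rw [mul_assoc, mul_div_assoc', mul_div_assoc']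
  gcongr

end

/-! ### The exceptional vertices: adjacency, common neighbours, number, minimal signed degree. -/

section
variable {n : ℕ} {p ζ ρ h : ℝ}

/-- The unordered pair of two distinct vertices. -/
def pairOf {i j : Fin n} (hij : i ≠ j) : VertexPair n :=
  if h : i < j then ⟨(i, j), h⟩ else ⟨(j, i), lt_of_le_of_ne (not_lt.1 h) hij.symm⟩

theorem adjMatrix_eq_pairOf (X : CensoredGraph n) {i j : Fin n} (hij : i ≠ j) :
    adjMatrix X i j = ((X (pairOf hij) : SignType) : ℝ) := by
  unfold pairOf adjMatrix
  rcases lt_or_gt_of_ne hij with h | h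
  · simp [h]
  · simp [h, not_lt.2 h.le]

theorem pairOf_ne_pairOf {i k j : Fin n} (hik : i ≠ k) (hij : i ≠ j) (hkj : k ≠ j) :
    pairOf hij ≠ pairOf hkj := by
  unfold pairOf
  intro heq
  split_ifs at heq <;> simp [Subtype.ext_iff] at heq <;> simp_all

theorem adjMatrix_ne_zero {X : CensoredGraph n} {i j : Fin n} (h : adjMatrix X i j ≠ 0) :
    ∃ hij : i ≠ j, X (pairOf hij) ≠ 0 := by
  have hij : i ≠ j := by
    rintro rfl
    exact h (adjMatrix_self X i)
  refine ⟨hij, fun h0 => h ?_⟩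
  rw [adjMatrix_eq_pairOf X hij, h0, SignType.coe_zero]

/-- The tilted bound `exp (-p H (n - 1))` in terms of the mean degree `n p`. -/
theorem exp_neg_mul_sub_one_le (hp0 : 0 ≤ p) (hp1 : p ≤ 1) {H : ℝ}
    (hH1 : H ≤ 1) :
    Real.exp (-(p * H * (n - 1))) ≤ Real.exp 1 * Real.exp (-(H * (n * p))) := by
  rw [← Real.exp_add]
  refine Real.exp_le_exp.2 ?_
  nlinarith

/-- Two low signed degrees cost about `exp (-2Hd)`, of which the slack in `κ` returns `exp (Hd/4)`.
The edge costs `p`, so the union bound over at most `n²` pairs leaves `d n exp (-7Hd/4)`, and `n ≤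
exp (Hd)`. -/
theorem measureReal_adjacent_le (hp0 : 0 ≤ p) (hp1 : p ≤ 1) (h0 : 0 ≤ ζ) (h1 : ζ ≤ 1)
    (hρ : 0 ≤ ρ) (hρ1 : Real.exp (-ρ) * (1 - ζ) = h) (hρ2 : Real.exp ρ * ζ = h) (hh0 : 0 ≤ h)
    (hh1 : h ≤ 1 / 2) {κ : ℝ} (hκ : ρ * κ ≤ (1 - 2 * h) / 8)
    (hn : (n : ℝ) ≤ Real.exp ((1 - 2 * h) * (n * p))) :
    (cbm (1 : Labeling n) p ζ).real {X | ∃ e₀ : VertexPair n, X e₀ ≠ 0 ∧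
        signedDegree X e₀.1.1 < κ * (n * p) ∧ signedDegree X e₀.1.2 < κ * (n * p)} ≤
      Real.exp (2 * ρ + 2) ^ 2 * Real.exp 2 *
        ((n * p) * Real.exp (-(3 / 4 * (1 - 2 * h) * (n * p)))) := by
  have hprob := isProbabilityMeasure_cbm (n := n) hp0 hp1 h0 h1 1
  set d := (n : ℝ) * p with hd
  set H := 1 - 2 * h with hH
  have hd0 : 0 ≤ d := by positivity
  have hone : ∀ e₀ : VertexPair n, (cbm (1 : Labeling n) p ζ).real {X | X e₀ ≠ 0 ∧
        signedDegree X e₀.1.1 < κ * d ∧ signedDegree X e₀.1.2 < κ * d} ≤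
      p * Real.exp (2 * ρ + 2) ^ 2 * Real.exp 2 * Real.exp (-(7 / 4 * H * d)) := by
    intro e₀
    have := measureReal_two_signedDegree_le hp0 hp1 h0 h1 hρ hρ1 hρ2 hh0 hh1 e₀ {e₀} (κ * d)
    simp only [Finset.mem_singleton, forall_eq, Finset.card_singleton, pow_one] at this
    refine this.trans ?_
    have e1 : Real.exp (2 * ρ * (κ * d)) * Real.exp (-(2 * (p * H) * (n - 1))) ≤
        Real.exp 2 * Real.exp (-(7 / 4 * H * d)) := by
      rw [← Real.exp_add, ← Real.exp_add]
      refine Real.exp_le_exp.2 ?_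
      have : ρ * κ * d ≤ H / 8 * d := mul_le_mul_of_nonneg_right hκ hd0
      have h2 : p * H ≤ 1 := by nlinarith
      rw [hd] at this ⊢
      nlinarith
    calc _ = p * Real.exp (2 * ρ + 2) ^ 2 *
          (Real.exp (2 * ρ * (κ * d)) * Real.exp (-(2 * (p * H) * (n - 1)))) := by ring
      _ ≤ p * Real.exp (2 * ρ + 2) ^ 2 * (Real.exp 2 * Real.exp (-(7 / 4 * H * d))) := by gcongr
      _ = _ := by ring
  calc _ ≤ ∑ e₀ : VertexPair n, _ := measureReal_exists_le _ fun e₀ : VertexPair n =>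
        {X | X e₀ ≠ 0 ∧ signedDegree X e₀.1.1 < κ * d ∧ signedDegree X e₀.1.2 < κ * d}
    _ ≤ ∑ e₀ : VertexPair n, _ := Finset.sum_le_sum fun e₀ _ => hone e₀
    _ = Fintype.card (VertexPair n) *
        (p * Real.exp (2 * ρ + 2) ^ 2 * Real.exp 2 * Real.exp (-(7 / 4 * H * d))) := by
        rw [Finset.sum_const, Finset.card_univ, nsmul_eq_mul]
    _ ≤ (n : ℝ) ^ 2 *
        (p * Real.exp (2 * ρ + 2) ^ 2 * Real.exp 2 * Real.exp (-(7 / 4 * H * d))) := by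
        gcongr
        exact card_vertexPair_le n
    _ = Real.exp (2 * ρ + 2) ^ 2 * Real.exp 2 * d * (n * Real.exp (-(7 / 4 * H * d))) := by
        rw [hd]; ring
    _ ≤ Real.exp (2 * ρ + 2) ^ 2 * Real.exp 2 * d *
        (Real.exp (H * d) * Real.exp (-(7 / 4 * H * d))) := by gcongr
    _ = _ := by
        rw [← Real.exp_add]; ring_nf

/-- As for adjacent vertices, with two prescribed edges: `n³ p² = d² n`, so the additional choice of
`j` costs only one more factor `d`. -/
theorem measureReal_common_neighbour_le (hp0 : 0 ≤ p) (hp1 : p ≤ 1) (h0 : 0 ≤ ζ) (h1 : ζ ≤ 1)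
    (hρ : 0 ≤ ρ) (hρ1 : Real.exp (-ρ) * (1 - ζ) = h) (hρ2 : Real.exp ρ * ζ = h) (hh0 : 0 ≤ h)
    (hh1 : h ≤ 1 / 2) {κ : ℝ} (hκ : ρ * κ ≤ (1 - 2 * h) / 8)
    (hn : (n : ℝ) ≤ Real.exp ((1 - 2 * h) * (n * p))) :
    (cbm (1 : Labeling n) p ζ).real {X | ∃ ej : VertexPair n × Fin n,
        adjMatrix X ej.1.1.1 ej.2 ≠ 0 ∧ adjMatrix X ej.1.1.2 ej.2 ≠ 0 ∧
        signedDegree X ej.1.1.1 < κ * (n * p) ∧ signedDegree X ej.1.1.2 < κ * (n * p)} ≤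
      Real.exp (2 * ρ + 2) ^ 3 * Real.exp 2 *
        ((n * p) ^ 2 * Real.exp (-(3 / 4 * (1 - 2 * h) * (n * p)))) := by
  have hprob := isProbabilityMeasure_cbm (n := n) hp0 hp1 h0 h1 1
  set d := (n : ℝ) * p with hd
  set H := 1 - 2 * h with hH
  have hd0 : 0 ≤ d := by positivity
  have hone : ∀ ej : VertexPair n × Fin n, (cbm (1 : Labeling n) p ζ).real
      {X | adjMatrix X ej.1.1.1 ej.2 ≠ 0 ∧ adjMatrix X ej.1.1.2 ej.2 ≠ 0 ∧
        signedDegree X ej.1.1.1 < κ * d ∧ signedDegree X ej.1.1.2 < κ * d} ≤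
      p ^ 2 * Real.exp (2 * ρ + 2) ^ 3 * Real.exp 2 * Real.exp (-(7 / 4 * H * d)) := by
    rintro ⟨e₀, j⟩
    by_cases hj : e₀.1.1 ≠ j ∧ e₀.1.2 ≠ j
    swap
    · have : {X : CensoredGraph n | adjMatrix X e₀.1.1 j ≠ 0 ∧ adjMatrix X e₀.1.2 j ≠ 0 ∧
          signedDegree X e₀.1.1 < κ * d ∧ signedDegree X e₀.1.2 < κ * d} = ∅ := by
        ext X
        simp only [Set.mem_ofPred_eq, Set.mem_empty_iff_false, iff_false]
        rintro ⟨h2, h3, -⟩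
        exact hj ⟨(adjMatrix_ne_zero h2).1, (adjMatrix_ne_zero h3).1⟩
      rw [this]
      simp; positivity
    have := measureReal_two_signedDegree_le hp0 hp1 h0 h1 hρ hρ1 hρ2 hh0 hh1 e₀
      {pairOf hj.1, pairOf hj.2} (κ * d)
    rw [Finset.card_pair (pairOf_ne_pairOf e₀.2.ne hj.1 hj.2)] at this
    refine (measureReal_mono ?_).trans (this.trans ?_)
    · rintro X ⟨h2, h3, h4⟩
      refine ⟨?_, h4⟩
      simp only [Finset.mem_insert, Finset.mem_singleton, forall_eq_or_imp, forall_eq]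
      exact ⟨(adjMatrix_ne_zero h2).2, (adjMatrix_ne_zero h3).2⟩
    have e1 : Real.exp (2 * ρ * (κ * d)) * Real.exp (-(2 * (p * H) * (n - 1))) ≤
        Real.exp 2 * Real.exp (-(7 / 4 * H * d)) := by
      rw [← Real.exp_add, ← Real.exp_add]
      refine Real.exp_le_exp.2 ?_
      have : ρ * κ * d ≤ H / 8 * d := mul_le_mul_of_nonneg_right hκ hd0
      have h2 : p * H ≤ 1 := by nlinarith
      rw [hd] at this ⊢
      nlinarith
    calc _ = p ^ 2 * Real.exp (2 * ρ + 2) ^ 3 *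
          (Real.exp (2 * ρ * (κ * d)) * Real.exp (-(2 * (p * H) * (n - 1)))) := by ring
      _ ≤ p ^ 2 * Real.exp (2 * ρ + 2) ^ 3 * (Real.exp 2 * Real.exp (-(7 / 4 * H * d))) := by
          gcongr
      _ = _ := by ring
  calc _ ≤ ∑ ej : VertexPair n × Fin n, _ := measureReal_exists_le _
        fun ej : VertexPair n × Fin n =>
        {X | adjMatrix X ej.1.1.1 ej.2 ≠ 0 ∧ adjMatrix X ej.1.1.2 ej.2 ≠ 0 ∧
          signedDegree X ej.1.1.1 < κ * d ∧ signedDegree X ej.1.1.2 < κ * d}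
    _ ≤ ∑ ej : VertexPair n × Fin n, _ := Finset.sum_le_sum fun ej _ => hone ej
    _ = Fintype.card (VertexPair n) * n *
        (p ^ 2 * Real.exp (2 * ρ + 2) ^ 3 * Real.exp 2 * Real.exp (-(7 / 4 * H * d))) := by
        rw [Finset.sum_const, Finset.card_univ, nsmul_eq_mul, Fintype.card_prod, Fintype.card_fin]
        push_cast; rfl
    _ ≤ (n : ℝ) ^ 2 * n *
        (p ^ 2 * Real.exp (2 * ρ + 2) ^ 3 * Real.exp 2 * Real.exp (-(7 / 4 * H * d))) := by
        gcongr
        exact card_vertexPair_le n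
    _ = Real.exp (2 * ρ + 2) ^ 3 * Real.exp 2 * d ^ 2 * (n * Real.exp (-(7 / 4 * H * d))) := by
        rw [hd]; ring
    _ ≤ Real.exp (2 * ρ + 2) ^ 3 * Real.exp 2 * d ^ 2 *
        (Real.exp (H * d) * Real.exp (-(7 / 4 * H * d))) := by gcongr
    _ = _ := by
        rw [← Real.exp_add]; ring_nf

/-- Markov's inequality for the expected number of low vertices; the factor `p` turns the `n`
summands into `d`. -/
theorem measureReal_card_low_le (hp0 : 0 ≤ p) (hp1 : p ≤ 1) (h0 : 0 ≤ ζ) (h1 : ζ ≤ 1)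
    (hρ : 0 ≤ ρ) (hρ1 : Real.exp (-ρ) * (1 - ζ) = h) (hρ2 : Real.exp ρ * ζ = h) (hh0 : 0 ≤ h)
    (hh1 : h ≤ 1 / 2) {κ : ℝ} (hκ : ρ * κ ≤ (1 - 2 * h) / 8) :
    (cbm (1 : Labeling n) p ζ).real {X | 1 <
        2 * p * ((Finset.univ.filter fun i => signedDegree X i < κ * (n * p)).card : ℝ)} ≤
      2 * Real.exp 1 * ((n * p) * Real.exp (-(3 / 4 * (1 - 2 * h) * (n * p)))) := by
  have hprob := isProbabilityMeasure_cbm (n := n) hp0 hp1 h0 h1 1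
  set P := cbm (1 : Labeling n) p ζ with hP
  set d := (n : ℝ) * p with hd
  set H := 1 - 2 * h with hH
  have hd0 : 0 ≤ d := by positivity
  have hH0 : 0 ≤ H := by linarith
  have hone : ∀ i : Fin n, P.real {X | signedDegree X i < κ * d} ≤
      Real.exp 1 * Real.exp (-(3 / 4 * H * d)) := by
    intro i
    have := measureReal_signedDegree_le hp0 hp1 h0 h1 hρ hρ1 hρ2 i (κ * d)
    have hsub : {X : CensoredGraph n | signedDegree X i < κ * d} ⊆
        {X | signedDegree X i ≤ κ * d} := fun X hX => by
      simp only [Set.mem_ofPred_eq] at hX ⊢; exact hX.le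
    refine (measureReal_mono hsub).trans (this.trans ?_)
    have h2 := exp_neg_mul_sub_one_le (n := n) (H := H) hp0 hp1 (by linarith)
    calc _ ≤ Real.exp (ρ * (κ * d)) * (Real.exp 1 * Real.exp (-(H * d))) := by gcongr
      _ ≤ Real.exp (H / 8 * d) * (Real.exp 1 * Real.exp (-(H * d))) := by
          rw [← mul_assoc ρ]; gcongr
      _ = Real.exp 1 * Real.exp (-(7 / 8 * H * d)) := by
          rw [← Real.exp_add, ← Real.exp_add, ← Real.exp_add]; ring_nf
      _ ≤ _ := by
          gcongr ?_ * Real.exp ?_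
          nlinarith [mul_nonneg hH0 hd0]
  have hcard : ∀ X : CensoredGraph n,
      ((Finset.univ.filter fun i => signedDegree X i < κ * d).card : ℝ) =
        ∑ i, {X | signedDegree X i < κ * d}.indicator (1 : CensoredGraph n → ℝ) X := fun X => by
    simp [Set.indicator_apply]
  calc _ ≤ ∫ X, 2 * p * ((Finset.univ.filter fun i => signedDegree X i < κ * d).card : ℝ) ∂P := by
        rw [← integral_indicator_one .of_discrete]
        refine integral_mono .of_finite .of_finite fun X => ?_
        by_cases hX : 1 < 2 * p *
          ((Finset.univ.filter fun i => signedDegree X i < κ * d).card : ℝ)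
        · simpa [hX] using hX.le
        · simp only [Set.indicator_apply, Set.mem_ofPred_eq, hX, if_false]
          positivity
    _ = 2 * p * ∑ i, P.real {X | signedDegree X i < κ * d} := by
        rw [integral_const_mul]
        simp only [hcard]
        rw [integral_finsetSum _ fun _ _ => .of_finite]
        simp only [integral_indicator_one MeasurableSet.of_discrete]
    _ ≤ 2 * p * ∑ i : Fin n, Real.exp 1 * Real.exp (-(3 / 4 * H * d)) := by
        gcongr with i
        exact hone i
    _ = _ := by
        rw [Finset.sum_const, Finset.card_univ, Fintype.card_fin, nsmul_eq_mul, hd]; ring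

theorem exists_int_signedDegree (X : CensoredGraph n) (i : Fin n) :
    ∃ z : ℤ, signedDegree X i = z := by
  refine ⟨∑ e, ((if e.1.1 = i then 1 else 0) + if e.1.2 = i then 1 else 0) *
    ((X e : SignType) : ℤ), ?_⟩
  rw [signedDegree_eq]
  push_cast
  refine Finset.sum_congr rfl fun e _ => ?_
  congr 1

/-- The minimal signed degree exceeds a constant, even at the critical threshold. -/
theorem measureReal_min_signedDegree_le (hp0 : 0 ≤ p) (hp1 : p ≤ 1 / 2) (h0 : 0 ≤ ζ) (h1 : ζ ≤ 1)
    (hρ : 0 ≤ ρ) (hρ1 : Real.exp (-ρ) * (1 - ζ) = h) (hρ2 : Real.exp ρ * ζ = h) (hh0 : 0 ≤ h)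
    (hh1 : h ≤ 1 / 2) (hn : (n : ℝ) ≤ Real.exp ((1 - 2 * h) * (n * p))) (K J : ℕ) {M : ℕ}
    (hM : 0 < M) :
    (cbm (1 : Labeling n) p ζ).real {X | ∃ i, signedDegree X i ≤ K} ≤
      Real.exp (1 + ρ * K) * (Real.exp (-(ρ * J)) +
        J * ((∑ j ∈ Finset.range M, ∑ l ∈ Finset.range M,
          Real.exp (-(2 * h * (n * p - 1) * (1 - Real.cos (((j : ℝ) - l) * (1 / M)))))) /
            (M : ℝ) ^ 2)) := by
  have hprob := isProbabilityMeasure_cbm (n := n) hp0 (by linarith : p ≤ 1) h0 h1 1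
  set P := cbm (1 : Labeling n) p ζ with hP
  set d := (n : ℝ) * p with hd
  set H := 1 - 2 * h with hH
  have hH0 : 0 ≤ H := by linarith
  set F := (∑ j ∈ Finset.range M, ∑ l ∈ Finset.range M,
    Real.exp (-(2 * h * (d - 1) * (1 - Real.cos (((j : ℝ) - l) * (1 / M)))))) / (M : ℝ) ^ 2 with hF
  have hF0 : 0 ≤ F := by positivity
  have hexp := exp_neg_mul_sub_one_le (n := n) (H := H) hp0 (by linarith : p ≤ 1) (by linarith)
  have hone : ∀ i : Fin n, P.real {X | signedDegree X i ≤ K} ≤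
      Real.exp (-(H * d)) * (Real.exp (1 + ρ * K) * (Real.exp (-(ρ * J)) + J * F)) := by
    intro i
    -- The signed degree is an integer: either it is at most `K - J`, where Chernoff gains `exp (-ρ
    -- J)`, or it is one of the `J` values just above, each handled by the Fejér bound.
    have hsub : {X : CensoredGraph n | signedDegree X i ≤ K} ⊆
        {X | signedDegree X i ≤ K - J} ∪ {X | ∃ m : Fin J, X ∈ {X : CensoredGraph n |
          signedDegree X i = (K : ℝ) - (m : ℕ)}} := by
      intro X hX
      obtain ⟨z, hz⟩ := exists_int_signedDegree X i
      simp only [Set.mem_union, Set.mem_ofPred_eq, hz] at hX ⊢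
      have hzK : z ≤ K := by exact_mod_cast hX
      by_cases hzJ : z ≤ K - J
      · left
        exact_mod_cast hzJ
      · right
        refine ⟨⟨(K - z).toNat, by omega⟩, ?_⟩
        have : (((K - z).toNat : ℤ) : ℝ) = ((K - z : ℤ) : ℝ) := by
          rw [Int.toNat_of_nonneg (by omega)]
        push_cast at this ⊢
        rw [this]; ring
    have htail := measureReal_signedDegree_le hp0 (by linarith : p ≤ 1) h0 h1 hρ hρ1 hρ2 i
      ((K : ℝ) - J)
    have hpoint : ∀ m : Fin J, P.real {X : CensoredGraph n | signedDegree X i = (K : ℝ) - (m : ℕ)} ≤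
        Real.exp (ρ * K) * (Real.exp 1 * Real.exp (-(H * d))) * F := by
      intro m
      refine (measureReal_signedDegree_eq_le hp0 hp1 h0 h1 hρ1 hρ2 hh0 hh1 i _ (1 / M) hM).trans ?_
      have hm : (0 : ℝ) ≤ (m : ℕ) := Nat.cast_nonneg _
      have hcos : ∀ x : ℝ, 0 ≤ 1 - Real.cos x := fun x => by linarith [Real.cos_le_one x]
      have hpd : d - 1 ≤ p * (n - 1) := by rw [hd]; linarith
      rw [hF]
      gcongr
      · linarith
      · exact hcos _
    calc _ ≤ P.real {X | signedDegree X i ≤ K - J} + P.real {X | ∃ m : Fin J, X ∈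
            {X : CensoredGraph n | signedDegree X i = (K : ℝ) - (m : ℕ)}} :=
          (measureReal_mono hsub).trans (measureReal_union_le _ _)
      _ ≤ Real.exp (ρ * (K - J)) * (Real.exp 1 * Real.exp (-(H * d))) +
          ∑ m : Fin J, Real.exp (ρ * K) * (Real.exp 1 * Real.exp (-(H * d))) * F := by
          refine add_le_add (htail.trans (by gcongr)) ?_
          exact (measureReal_exists_le _ _).trans (Finset.sum_le_sum fun m _ => hpoint m)
      _ = _ := by
          rw [Finset.sum_const, Finset.card_univ, Fintype.card_fin, nsmul_eq_mul, mul_sub, sub_eq_add_neg,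
            Real.exp_add (ρ * K), Real.exp_add 1]
          ring
  calc _ ≤ ∑ i : Fin n, P.real {X | signedDegree X i ≤ K} :=
        measureReal_exists_le _ fun i => {X | signedDegree X i ≤ K}
    _ ≤ ∑ i : Fin n, _ := Finset.sum_le_sum fun i _ => hone i
    _ = (n * Real.exp (-(H * d))) * (Real.exp (1 + ρ * K) * (Real.exp (-(ρ * J)) + J * F)) := by
        rw [Finset.sum_const, Finset.card_univ, Fintype.card_fin, nsmul_eq_mul, mul_assoc]
    _ ≤ 1 * (Real.exp (1 + ρ * K) * (Real.exp (-(ρ * J)) + J * F)) := by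
        gcongr
        rw [Real.exp_neg, ← div_eq_mul_inv]
        exact div_le_one_of_le₀ hn (Real.exp_pos _).le
    _ = _ := one_mul _

end

/-! ### Assembly of the bad events. -/

theorem abs_adjMatrix_le_one {n : ℕ} (X : CensoredGraph n) (i j : Fin n) :
    |adjMatrix X i j| ≤ 1 := by
  have h : ∀ t : SignType, |(t : ℝ)| ≤ 1 := fun t => by cases t <;> simp
  unfold adjMatrix
  simp only [Matrix.of_apply]
  split_ifs
  · exact h _
  · exact h _
  · simp

/-- Rigidity fails with small probability: a bound in terms of the mean degree `n p`. -/
theorem measureReal_not_isRigid_le {n : ℕ} {p ζ ρ h κ : ℝ} (hp0 : 0 < p) (hp1 : p ≤ 1 / 2)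
    (h0 : 0 ≤ ζ) (h1 : ζ ≤ 1 / 2) (hρ : 0 ≤ ρ) (hρ1 : Real.exp (-ρ) * (1 - ζ) = h)
    (hρ2 : Real.exp ρ * ζ = h) (hh0 : 0 ≤ h) (hh1 : h ≤ 1 / 2) (hκ0 : 0 < κ) (hκ1 : κ ≤ 1)
    (hκ : ρ * κ ≤ (1 - 2 * h) / 8) (hn : (n : ℝ) ≤ Real.exp ((1 - 2 * h) * (n * p)))
    (hd4 : 4 ≤ n * p) (hdc : 2 ≤ κ ^ 2 / 4096 * (n * p))
    (hdη : 64 / (κ * (Real.exp (-(6 / (κ ^ 2 / 4096))) * κ ^ 2 / 16384)) ≤ √(n * p))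
    {K : ℕ} (hK : 64 / κ + 2 ≤ K) (J : ℕ) {M : ℕ} (hM : 0 < M) :
    (cbm (1 : Labeling n) p ζ).real {X | ¬ IsRigid (adjMatrix X)} ≤
      (2 * Real.exp (-1)) ^ n + Real.exp (1 - n * p) + Real.exp (-(n * p)) +
      Real.exp (2 * ρ + 2) ^ 2 * Real.exp 2 *
        ((n * p) * Real.exp (-(3 / 4 * (1 - 2 * h) * (n * p)))) +
      Real.exp (2 * ρ + 2) ^ 3 * Real.exp 2 *
        ((n * p) ^ 2 * Real.exp (-(3 / 4 * (1 - 2 * h) * (n * p)))) +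
      Real.exp (1 + ρ * K) * (Real.exp (-(ρ * J)) +
        J * ((∑ j ∈ Finset.range M, ∑ l ∈ Finset.range M,
          Real.exp (-(2 * h * (n * p - 1) * (1 - Real.cos (((j : ℝ) - l) * (1 / M)))))) /
            (M : ℝ) ^ 2)) +
      2 * Real.exp 1 * ((n * p) * Real.exp (-(3 / 4 * (1 - 2 * h) * (n * p)))) := by
  have hp1' : p ≤ 1 := by linarith
  have h1' : ζ ≤ 1 := by linarith
  have hprob := isProbabilityMeasure_cbm (n := n) hp0.le hp1' h0 h1' 1
  have hcut := measureReal_cut_le hp0 hp1' h0 h1 hd4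
  have hsparse := measureReal_sparse_le hp0 hp1' h0 h1' (by positivity : 0 < κ ^ 2 / 4096) hdc
    (by linarith)
  have hdeg := measureReal_degree_le (n := n) hp0.le hp1' h0 h1'
  have hadj := measureReal_adjacent_le hp0.le hp1' h0 h1' hρ hρ1 hρ2 hh0 hh1 hκ hn
  have hcom := measureReal_common_neighbour_le hp0.le hp1' h0 h1' hρ hρ1 hρ2 hh0 hh1 hκ hn
  have hmin := measureReal_min_signedDegree_le hp0.le hp1 h0 h1' hρ hρ1 hρ2 hh0 hh1 hn K J hM
  have hcard := measureReal_card_low_le (n := n) hp0.le hp1' h0 h1' hρ hρ1 hρ2 hh0 hh1 hκ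
  set d := (n : ℝ) * p with hd
  have hnd : (n : ℝ) ≤ Real.exp d := hn.trans (Real.exp_le_exp.2 (by nlinarith))
  have hsparse' : (n : ℝ) * Real.exp (1 - 2 * d) ≤ Real.exp (1 - d) := by
    calc (n : ℝ) * Real.exp (1 - 2 * d) ≤ Real.exp d * Real.exp (1 - 2 * d) := by gcongr
      _ = _ := by rw [← Real.exp_add]; ring_nf
  have hdeg' : (n : ℝ) * Real.exp (-(2 * d)) ≤ Real.exp (-d) := by
    calc (n : ℝ) * Real.exp (-(2 * d)) ≤ Real.exp d * Real.exp (-(2 * d)) := by gcongr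
      _ = _ := by rw [← Real.exp_add]; ring_nf
  set η := Real.exp (-(6 / (κ ^ 2 / 4096))) * κ ^ 2 / 16384 with hη
  have hηκ : η ≤ κ / 32 := by
    have : Real.exp (-(6 / (κ ^ 2 / 4096))) ≤ 1 :=
      Real.exp_le_one_iff.2 (neg_nonpos.2 (by positivity))
    have h2 : κ ^ 2 ≤ κ := by nlinarith
    have h3 : Real.exp (-(6 / (κ ^ 2 / 4096))) * κ ^ 2 ≤ 1 * κ := by gcongr
    rw [hη]
    linarith
  -- The constant `η` was chosen so that the sets in the rigidity criterion are exactly those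
  -- covered by local sparsity with `c = κ² / 4096`.
  have hη' : η * (128 / κ) ^ 2 = Real.exp (-(6 / (κ ^ 2 / 4096))) := by
    rw [hη]; field_simp; norm_num
  refine (measureReal_mono (μ := cbm (1 : Labeling n) p ζ) (fun X hX => ?_)).trans
    ((measureReal_union_le _ _).trans (add_le_add ((measureReal_union_le _ _).trans (add_le_add
      ((measureReal_union_le _ _).trans (add_le_add ((measureReal_union_le _ _).trans (add_le_add
      ((measureReal_union_le _ _).trans (add_le_add ((measureReal_union_le _ _).trans (add_le_add
      hcut (hsparse.trans hsparse'))) (hdeg.trans hdeg'))) hadj)) hcom)) hmin)) hcard))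
  by_contra hgood
  simp only [Set.mem_union, Set.mem_ofPred_eq, not_or, not_exists, not_and, not_lt, not_le]
    at hgood hX
  obtain ⟨⟨⟨⟨⟨⟨g1, g2⟩, g3⟩, g4⟩, g5⟩, g6⟩, g7⟩ := hgood
  refine hX (isRigid_of_pseudorandom (κ := κ) (η := η) (d := d) (μ := p * (1 - 2 * ζ))
    (adjMatrix_symm X) (adjMatrix_self X) (abs_adjMatrix_le_one X) hκ0 hκ1 (by positivity) hηκ hdη
    (mul_nonneg hp0.le (by linarith)) ?_ g1 ?_ g3 ?_ ?_ ?_ ?_)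
  · rw [hd]
    have : 0 ≤ (n : ℝ) * p * ζ := by positivity
    linarith
  · intro R hR
    rw [hη'] at hR
    have := g2 R hR
    linarith
  · intro i k hi hk
    by_contra hne
    obtain ⟨hik, hX0⟩ := adjMatrix_ne_zero hne
    have hg := g4 (pairOf hik) hX0
    unfold pairOf at hg
    split_ifs at hg with hlt
    · exact absurd hk (not_lt.2 (hg hi))
    · exact absurd hi (not_lt.2 (hg hk))
  · intro i k hik hi hk j
    by_contra! hne
    have hg := g5 (pairOf hik, j)
    unfold pairOf at hg
    split_ifs at hg with hlt
    · exact absurd hk (not_lt.2 (hg hne.1 hne.2 hi))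
    · exact absurd hi (not_lt.2 (hg hne.2 hne.1 hk))
  · intro i
    exact hK.trans (g6 i).le
  · have hset : (Finset.univ.filter fun i => ∑ j, adjMatrix X i j < κ * d) =
        Finset.univ.filter fun i => signedDegree X i < κ * d := rfl
    rw [hset]
    refine le_trans ?_ g7
    have : 2 * (p * (1 - 2 * ζ)) ≤ 2 * p := by
      linarith only [mul_nonneg hp0.le h0]
    exact mul_le_mul_of_nonneg_right this (Nat.cast_nonneg _)

/-! ### Asymptotics above the information-theoretic threshold. -/

theorem tendsto_pow_mul_exp_neg_mul (k : ℕ) {b : ℝ} (hb : 0 < b) :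
    Tendsto (fun x : ℝ => x ^ k * Real.exp (-(b * x))) atTop (𝓝 0) := by
  have h := (Real.tendsto_pow_mul_exp_neg_atTop_nhds_zero k).comp (tendsto_id.const_mul_atTop hb)
  have h2 := h.const_mul ((b ^ k)⁻¹)
  rw [mul_zero] at h2
  refine h2.congr fun x => ?_
  simp only [Function.comp, id, mul_pow]
  field_simp

/-- The Fejér averages of a spreading lattice distribution. -/
theorem tendsto_fejer {h : ℝ} (hh : 0 < h) {d : ℕ → ℝ} (hd : Tendsto d atTop atTop) {M : ℕ}
    (hM : 0 < M) :
    Tendsto (fun n => (∑ j ∈ Finset.range M, ∑ l ∈ Finset.range M,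
      Real.exp (-(2 * h * (d n - 1) * (1 - Real.cos (((j : ℝ) - l) * (1 / M)))))) / (M : ℝ) ^ 2)
      atTop (𝓝 (1 / M)) := by
  have hM' : (0 : ℝ) < M := by exact_mod_cast hM
  have hterm : ∀ j ∈ Finset.range M, ∀ l ∈ Finset.range M, Tendsto (fun n =>
      Real.exp (-(2 * h * (d n - 1) * (1 - Real.cos (((j : ℝ) - l) * (1 / M)))))) atTop
      (𝓝 (if j = l then 1 else 0)) := by
    intro j hj l hl
    split_ifs with hjl
    · subst hjl; simp
    · rw [Finset.mem_range] at hj hl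
      have hj' : (j : ℝ) < M := by exact_mod_cast hj
      have hl' : (l : ℝ) < M := by exact_mod_cast hl
      have hj0 : (0 : ℝ) ≤ j := Nat.cast_nonneg _
      have hl0 : (0 : ℝ) ≤ l := Nat.cast_nonneg _
      have hx1 : ((j : ℝ) - l) * (1 / M) < 1 := by
        rw [mul_one_div, div_lt_one hM']; linarith
      have hx2 : -1 < ((j : ℝ) - l) * (1 / M) := by
        rw [mul_one_div, lt_div_iff₀ hM']; linarith
      have hx0 : ((j : ℝ) - l) * (1 / M) ≠ 0 := by
        refine mul_ne_zero (sub_ne_zero.2 ?_) (by positivity)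
        exact_mod_cast hjl
      have hpi := Real.pi_gt_three
      -- The step `1 / M` keeps all frequencies in `(-1, 1)`, so the cosine is one only on the
      -- diagonal. Only the `M` diagonal terms out of `M²` survive.
      have hcos : Real.cos (((j : ℝ) - l) * (1 / M)) < 1 := by
        refine lt_of_le_of_ne (Real.cos_le_one _) fun heq => hx0 ?_
        exact (Real.cos_eq_one_iff_of_lt_of_lt (by linarith) (by linarith)).1 heq
      refine Real.tendsto_exp_neg_atTop_nhds_zero.comp ?_
      refine Tendsto.atTop_mul_const (by linarith) ?_
      exact Tendsto.const_mul_atTop (by positivity) (tendsto_atTop_add_const_right _ _ hd)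
  have hsum := (tendsto_finsetSum (Finset.range M) fun j hj =>
    tendsto_finsetSum (Finset.range M) fun l hl => hterm j hj l hl).div_const ((M : ℝ) ^ 2)
  have hlim : (∑ j ∈ Finset.range M, ∑ l ∈ Finset.range M, if j = l then (1 : ℝ) else 0) /
      (M : ℝ) ^ 2 = 1 / M := by
    have : ∀ j ∈ Finset.range M, (∑ l ∈ Finset.range M, if j = l then (1 : ℝ) else 0) = 1 :=
      fun j hj => by rw [Finset.sum_ite_eq, if_pos hj]
    rw [Finset.sum_congr rfl this, Finset.sum_const, Finset.card_range, nsmul_eq_mul]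
    field_simp
  rwa [hlim] at hsum

/-- Above the information-theoretic threshold the true labels are certified by the dual of the
semidefinite program with high probability. -/
theorem tendsto_measureReal_not_isRigid {ζ : ℝ} (h0 : 0 < ζ) (h1 : ζ < 1 / 2) {p : ℕ → ℝ}
    (hp0 : ∀ᶠ n in atTop, 0 < p n) (hp1 : ∀ᶠ n in atTop, p n ≤ 1 / 2)
    (hlog : ∀ᶠ n : ℕ in atTop, Real.log n ≤ (√(1 - ζ) - √ζ) ^ 2 * (n * p n)) :
    Tendsto (fun n => (cbm (1 : Labeling n) (p n) ζ).real {X | ¬ IsRigid (adjMatrix X)}) atTop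
      (𝓝 0) := by
  set u := √(1 - ζ) with hu
  set v := √ζ with hv
  have hu2 : u ^ 2 = 1 - ζ := Real.sq_sqrt (by linarith)
  have hv2 : v ^ 2 = ζ := Real.sq_sqrt h0.le
  have hv0 : 0 < v := Real.sqrt_pos.2 h0
  have huv : v < u := Real.sqrt_lt_sqrt h0.le (by linarith)
  have hu0 : 0 < u := hv0.trans huv
  set h := u * v with hh
  set H := (u - v) ^ 2 with hH
  have hHh : H = 1 - 2 * h := by rw [hH, hh]; linear_combination hu2 + hv2
  have hH0 : 0 < H := by rw [hH]; have := sub_pos.2 huv; positivity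
  have hh0 : 0 < h := by positivity
  set ρ := Real.log (u / v) with hρ
  have hρ0 : 0 < ρ := Real.log_pos (by rwa [one_lt_div hv0])
  have hexp : Real.exp ρ = u / v := Real.exp_log (by positivity)
  have hρ1 : Real.exp (-ρ) * (1 - ζ) = h := by
    rw [Real.exp_neg, hexp, ← hu2, hh]; field_simp
  have hρ2 : Real.exp ρ * ζ = h := by
    rw [hexp, ← hv2, hh]; field_simp
  -- The order of choices matters: `κ` fixes the required minimal degree `K`, then `J` makes the
  -- Chernoff tail small, then `M` the `J` point probabilities, and only then `n` grows.
  set κ := min 1 (H / (8 * ρ)) with hκ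
  have hκ0 : 0 < κ := by positivity
  have hκ1 : κ ≤ 1 := min_le_left _ _
  have hκH : ρ * κ ≤ (1 - 2 * h) / 8 := by
    have : κ ≤ H / (8 * ρ) := min_le_right _ _
    rw [le_div_iff₀ (by positivity)] at this
    rw [← hHh]; linarith
  obtain ⟨K, hK⟩ := exists_nat_ge (64 / κ + 2)
  set d : ℕ → ℝ := fun n => n * p n with hd
  have hdlog : ∀ᶠ n : ℕ in atTop, Real.log n ≤ d n := by
    filter_upwards [hlog, hp0] with n hn hpn
    refine hn.trans (mul_le_of_le_one_left (by positivity) (by rw [hHh]; linarith))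
  have hdtop : Tendsto d atTop atTop :=
    tendsto_atTop_mono' _ hdlog (Real.tendsto_log_atTop.comp tendsto_natCast_atTop_atTop)
  refine tendsto_order.2 ⟨fun a ha => Eventually.of_forall fun n => ha.trans_le measureReal_nonneg,
    fun ε hε => ?_⟩
  set G := Real.exp (1 + ρ * K) with hG
  have hG0 : 0 < G := Real.exp_pos _
  obtain ⟨J, hJ⟩ : ∃ J : ℕ, G * Real.exp (-(ρ * J)) < ε / 3 := by
    have : Tendsto (fun J : ℕ => G * Real.exp (-(ρ * J))) atTop (𝓝 (G * 0)) :=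
      (Real.tendsto_exp_neg_atTop_nhds_zero.comp
        (tendsto_natCast_atTop_atTop.const_mul_atTop hρ0)).const_mul G
    rw [mul_zero] at this
    exact (this.eventually_lt_const (by positivity)).exists
  obtain ⟨M, hM0, hM⟩ : ∃ M : ℕ, 0 < M ∧ G * (J * (1 / (M : ℝ))) < ε / 3 := by
    have : Tendsto (fun M : ℕ => G * (J * (1 / (M : ℝ)))) atTop (𝓝 (G * (J * 0))) :=
      (tendsto_one_div_atTop_nhds_zero_nat.const_mul _).const_mul _
    rw [mul_zero, mul_zero] at this
    obtain ⟨M, hM⟩ := ((this.eventually_lt_const (by positivity : (0 : ℝ) < ε / 3)).and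
      (eventually_gt_atTop 0)).exists
    exact ⟨M, hM.2, hM.1⟩
  set b : ℕ → ℝ := fun n => (2 * Real.exp (-1)) ^ n + Real.exp (1 - d n) + Real.exp (-(d n)) +
      Real.exp (2 * ρ + 2) ^ 2 * Real.exp 2 *
        ((d n) * Real.exp (-(3 / 4 * (1 - 2 * h) * (d n)))) +
      Real.exp (2 * ρ + 2) ^ 3 * Real.exp 2 *
        ((d n) ^ 2 * Real.exp (-(3 / 4 * (1 - 2 * h) * (d n)))) +
      G * (Real.exp (-(ρ * J)) +
        J * ((∑ j ∈ Finset.range M, ∑ l ∈ Finset.range M,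
          Real.exp (-(2 * h * (d n - 1) * (1 - Real.cos (((j : ℝ) - l) * (1 / M)))))) /
            (M : ℝ) ^ 2)) +
      2 * Real.exp 1 * ((d n) * Real.exp (-(3 / 4 * (1 - 2 * h) * (d n)))) with hb
  have hb3 : 0 < 3 / 4 * (1 - 2 * h) := by rw [← hHh]; positivity
  have hblim : Tendsto b atTop (𝓝 (0 + Real.exp 1 * 0 + 0 + Real.exp (2 * ρ + 2) ^ 2 * Real.exp 2 * 0 +
      Real.exp (2 * ρ + 2) ^ 3 * Real.exp 2 * 0 + G * (Real.exp (-(ρ * J)) + J * (1 / M)) +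
      2 * Real.exp 1 * 0)) := by
    have t1 : Tendsto (fun n : ℕ => (2 * Real.exp (-1)) ^ n) atTop (𝓝 0) := by
      refine tendsto_pow_atTop_nhds_zero_of_lt_one (by positivity) ?_
      rw [Real.exp_neg, ← div_eq_mul_inv, div_lt_one (Real.exp_pos _)]
      have := Real.exp_one_gt_d9
      linarith
    have t3 : Tendsto (fun n : ℕ => Real.exp (-(d n))) atTop (𝓝 0) :=
      Real.tendsto_exp_neg_atTop_nhds_zero.comp hdtop
    have t2 : Tendsto (fun n : ℕ => Real.exp (1 - d n)) atTop (𝓝 (Real.exp 1 * 0)) := by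
      refine (t3.const_mul (Real.exp 1)).congr fun n => ?_
      rw [← Real.exp_add]; ring_nf
    have t4 : Tendsto (fun n : ℕ => d n * Real.exp (-(3 / 4 * (1 - 2 * h) * (d n)))) atTop
        (𝓝 0) := by
      simpa [Function.comp_def] using (tendsto_pow_mul_exp_neg_mul 1 hb3).comp hdtop
    have t5 : Tendsto (fun n : ℕ => d n ^ 2 * Real.exp (-(3 / 4 * (1 - 2 * h) * (d n)))) atTop
        (𝓝 0) := (tendsto_pow_mul_exp_neg_mul 2 hb3).comp hdtop
    have t6 := tendsto_fejer hh0 hdtop hM0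
    exact (((((t1.add t2).add t3).add (t4.const_mul _)).add (t5.const_mul _)).add
      (((t6.const_mul _).const_add _).const_mul _)).add (t4.const_mul _)
  have hbε : ∀ᶠ n in atTop, b n < ε := by
    refine hblim.eventually_lt_const ?_
    have : G * (Real.exp (-(ρ * J)) + J * (1 / M)) =
      G * Real.exp (-(ρ * J)) + G * (J * (1 / (M : ℝ))) := by ring
    rw [this]
    linarith
  have hsqrt : Tendsto (fun n => √(d n)) atTop atTop := Real.tendsto_sqrt_atTop.comp hdtop
  filter_upwards [hp0, hp1, hlog, hbε, hdtop.eventually_ge_atTop 4,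
    (hdtop.const_mul_atTop (by positivity : 0 < κ ^ 2 / 4096)).eventually_ge_atTop 2,
    hsqrt.eventually_ge_atTop
      (64 / (κ * (Real.exp (-(6 / (κ ^ 2 / 4096))) * κ ^ 2 / 16384))), eventually_gt_atTop 0]
    with n g0 g1 g2 g3 g4 g5 g6 g7
  refine (measureReal_not_isRigid_le g0 g1 h0.le h1.le hρ0.le hρ1 hρ2 hh0.le (by linarith) hκ0 hκ1
    hκH ?_ g4 g5 g6 hK J hM0).trans_lt g3
  rw [← hHh, ← Real.log_le_iff_le_exp (by exact_mod_cast g7)]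
  exact g2

/-! ### Subsampled graphs -/

/-- Keeping the entries with probability `q` and gauging turns the model with density `p` into the
homogeneous model with density `q p`. -/
theorem map_edgeMeasure_prod {p ζ q : ℝ} (hp0 : 0 ≤ p) (hp1 : p ≤ 1) (h0 : 0 ≤ ζ) (h1 : ζ ≤ 1)
    (hq0 : 0 ≤ q) (hq1 : q ≤ 1) (s : ℤˣ) :
    Measure.map (fun x : SignType × Bool => SignType.sign (s : ℤ) * if x.2 then x.1 else 0)
      ((edgeMeasure s p ζ).prod (ENNReal.ofReal q • Measure.dirac true +
        ENNReal.ofReal (1 - q) • Measure.dirac false)) = edgeMeasure 1 (q * p) ζ := by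
  have hb := isProbabilityMeasure_bernoulli hq0 hq1
  have he := isProbabilityMeasure_edgeMeasure hp0 hp1 h0 h1 s
  have hm : Measurable fun x : SignType × Bool =>
      SignType.sign (s : ℤ) * if x.2 then x.1 else 0 := .of_discrete
  have hp : 0 ≤ 1 - p := by linarith
  have hz : 0 ≤ 1 - ζ := by linarith
  have hq : 0 ≤ 1 - q := by linarith
  have hs : SignType.sign (s : ℤ) * SignType.sign (s : ℤ) = 1 := by
    rcases Int.units_eq_one_or s with rfl | rfl <;> rfl
  -- A zero arises from a discarded entry of any value or from a kept entry that was already zero.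
  have hcoef : ENNReal.ofReal (1 - q) * (ENNReal.ofReal (p * (1 - ζ)) + ENNReal.ofReal (p * ζ) +
      ENNReal.ofReal (1 - p)) + ENNReal.ofReal q * ENNReal.ofReal (1 - p) =
      ENNReal.ofReal (1 - q * p) := by
    rw [← ENNReal.ofReal_add (by positivity) (by positivity),
      ← ENNReal.ofReal_add (by positivity) (by positivity), ← ENNReal.ofReal_mul hq,
      ← ENNReal.ofReal_mul hq0, ← ENNReal.ofReal_add (by
        have : p * (1 - ζ) + p * ζ + (1 - p) = 1 := by ring
        rw [this]; positivity) (by positivity)]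
    congr 1; ring
  ext S -
  rw [Measure.map_apply hm .of_discrete, Measure.prod_apply_symm .of_discrete]
  simp only [lintegral_add_measure, lintegral_smul_measure, lintegral_dirac]
  simp only [edgeMeasure, Measure.coe_add, Measure.coe_smul, Pi.add_apply, Pi.smul_apply,
    smul_eq_mul, Measure.dirac_apply' _ (MeasurableSet.of_discrete)]
  have hind : ∀ (t : SignType) (b : Bool), ((fun x => (x, b)) ⁻¹' ((fun x : SignType × Bool =>
      SignType.sign (s : ℤ) * if x.2 = true then x.1 else 0) ⁻¹' S)).indicator 1 t =
      S.indicator (1 : SignType → ENNReal) (SignType.sign (s : ℤ) * if b = true then t else 0) :=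
    fun _ _ => rfl
  simp only [hind, if_true, hs, mul_neg, mul_zero, Units.val_one, sign_one, Bool.false_eq_true,
    if_false]
  rw [mul_assoc q p, mul_assoc q p, ENNReal.ofReal_mul hq0, ENNReal.ofReal_mul hq0, ← hcoef]
  ring

/-- Graph and mask are independent over pairs, so after regrouping them pair by pair the claim is
the one for a single entry. -/
theorem measurePreserving_gauge_subsample {n : ℕ} {p ζ q : ℝ} (hp0 : 0 ≤ p) (hp1 : p ≤ 1)
    (h0 : 0 ≤ ζ) (h1 : ζ ≤ 1) (hq0 : 0 ≤ q) (hq1 : q ≤ 1) (σ : Labeling n) :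
    MeasurePreserving (fun x : CensoredGraph n × (VertexPair n → Bool) =>
        gauge σ (subsample x.1 x.2))
      ((cbm σ p ζ).prod (Measure.pi fun _ => ENNReal.ofReal q • Measure.dirac true +
        ENNReal.ofReal (1 - q) • Measure.dirac false)) (cbm (1 : Labeling n) (q * p) ζ) := by
  have hb := isProbabilityMeasure_bernoulli hq0 hq1
  have he := isProbabilityMeasure_edgeMeasure hp0 hp1 h0 h1
  have hqp := isProbabilityMeasure_edgeMeasure (p := q * p) (by positivity)
    (mul_le_one₀ hq1 hp0 hp1) h0 h1
  have h2 := (measurePreserving_arrowProdEquivProdArrow SignType Bool (VertexPair n)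
    (fun e => edgeMeasure (σ e.1.1 * σ e.1.2) p ζ) (fun _ => ENNReal.ofReal q • Measure.dirac true +
        ENNReal.ofReal (1 - q) • Measure.dirac false)).symm
  have h3 := measurePreserving_pi
    (fun e : VertexPair n => (edgeMeasure (σ e.1.1 * σ e.1.2) p ζ).prod
      (ENNReal.ofReal q • Measure.dirac true + ENNReal.ofReal (1 - q) • Measure.dirac false))
    (fun _ => edgeMeasure 1 (q * p) ζ)
    (f := fun e x => SignType.sign ((σ e.1.1 * σ e.1.2 : ℤˣ) : ℤ) * if x.2 then x.1 else 0)
    fun e => ⟨.of_discrete, map_edgeMeasure_prod hp0 hp1 h0 h1 hq0 hq1 _⟩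
  rw [cbm_one]
  exact h3.comp h2

/-! ### Utility -/

/-- All estimates on rigid graphs coincide. -/
theorem exists_estimate_of_isRigid {n : ℕ} (hn : 0 < n) {est : CensoredGraph n → Labeling n}
    (hest : ∀ A, IsSDPEstimate A (est A)) (σ : Labeling n) :
    ∃ s, (s = σ ∨ s = -σ) ∧ ∀ A, IsRigid (adjMatrix (gauge σ A)) → est A = s := by
  -- Normalization of the first label selects the same representative of `{σ, -σ}` on every rigid
  -- graph, so that the votes do not split between the two signs.
  have key : ∀ A, IsRigid (adjMatrix (gauge σ A)) → est A = fun i => σ ⟨0, hn⟩ * σ i := by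
    intro A hA
    obtain ⟨hnorm, Y, hY, hround⟩ := hest A
    have h0 := hnorm ⟨0, hn⟩ rfl
    rcases hround σ (eq_outer_of_isRigid hA hY) with h | h
    · rw [h] at h0 ⊢
      rw [h0]; simp
    · rw [h, Pi.neg_apply, neg_eq_iff_eq_neg] at h0
      rw [h, h0]; funext i; simp
  refine ⟨_, ?_, key⟩
  rcases Int.units_eq_one_or (σ ⟨0, hn⟩) with h | h
  · left; rw [h]; simp
  · right; rw [h]; funext i; simp

/-- The vote when most of the estimates agree. -/
theorem mode_eq_of_card_ne_le {n m : ℕ} {v : Fin m → Labeling n} {s : Labeling n} {η q : ℝ}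
    (hm : 0 < m) (hq : 0 < q) (hη : η < 1 / 2)
    (hv : ((Finset.univ.filter fun k => v k ≠ s).card : ℝ) ≤ η * m) :
    mode v = s ∧ (1 - 2 * η) / (4 * q) - 1 ≤ stabilityProxy q v := by
  have hm' : (0 : ℝ) < m := by exact_mod_cast hm
  have hsum : (count v s : ℝ) + (Finset.univ.filter fun k => v k ≠ s).card = m := by
    have := Finset.card_filter_add_card_filter_not (s := (Finset.univ : Finset (Fin m)))
      (fun k => v k = s)
    rw [Finset.card_univ, Fintype.card_fin] at this
    unfold count
    exact_mod_cast this
  have hother : ∀ t ≠ s, (count v t : ℝ) ≤ η * m := by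
    intro t ht
    refine le_trans ?_ hv
    unfold count
    gcongr with k
    intro hk
    rw [hk]; exact ht
  have hmode : mode v = s := by
    by_contra hne
    have h1 := hother _ hne
    have h2 : (count v s : ℝ) ≤ count v (mode v) := by exact_mod_cast count_le_count₁ v s
    nlinarith
  refine ⟨hmode, ?_⟩
  have h1 : (1 - η) * m ≤ count₁ v := by
    unfold count₁; rw [hmode]; linarith
  have h2 : (count₂ v : ℝ) ≤ η * m := by
    have hη0 : 0 ≤ η * m := le_trans (Nat.cast_nonneg _) hv
    have : count₂ v ≤ ⌊η * m⌋₊ := Finset.sup_le fun t ht =>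
      Nat.le_floor (hother t (hmode ▸ (Finset.mem_erase.1 ht).1))
    exact (Nat.le_floor_iff hη0).1 this
  unfold stabilityProxy
  have h3 : (1 - 2 * η) / (4 * q) = ((1 - 2 * η) * m) / (4 * m * q) := by field_simp
  rw [h3]
  gcongr
  linarith

theorem log_one_div_zpow (n : ℕ) : Real.log (1 / (n : ℝ) ^ (-2 : ℤ)) = 2 * Real.log n := by
  rw [one_div, ← zpow_neg, Real.log_zpow]
  norm_num

theorem numSubgraphs_pos {n : ℕ} (hn : 2 ≤ n) {ε : ℝ} (hε : 0 < ε) :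
    0 < numSubgraphs n ε ((n : ℝ) ^ (-2 : ℤ)) := by
  have hn' : (1 : ℝ) < n := by exact_mod_cast hn
  have hq := sampleProb_pos hn hε
  refine Nat.ceil_pos.2 (div_pos (Real.log_pos ?_) (by positivity))
  rw [zpow_neg, div_inv_eq_mul]
  have : (1 : ℝ) ≤ (n : ℝ) ^ (2 : ℤ) := one_le_zpow₀ hn'.le (by norm_num)
  exact one_lt_mul_of_lt_of_le hn' this

/-- Recovery in terms of the probability that a single subsampled graph is not rigid. -/
theorem one_sub_le_recoveryProb {n : ℕ} (hn : 2 ≤ n) {est : CensoredGraph n → Labeling n}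
    (hest : ∀ A, IsSDPEstimate A (est A)) {p ζ ε C : ℝ} (hp0 : 0 ≤ p) (hp1 : p ≤ 1) (h0 : 0 ≤ ζ)
    (h1 : ζ ≤ 1) (hε : 0 < ε) (hC0 : 0 ≤ C) (hC : C < 6) (hεC : ε ≤ C * Real.log n)
    (σ : Labeling n) :
    1 - (cbm (1 : Labeling n) (sampleProb n ε * p) ζ).real {X | ¬ IsRigid (adjMatrix X)} /
        ((6 - C) / 32) - Real.exp (-((6 - C) / 2 * Real.log n)) ≤
      recoveryProb (mechanismMeasure n ε ((n : ℝ) ^ (-2 : ℤ)))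
        (mechanism est ε ((n : ℝ) ^ (-2 : ℤ))) σ p ζ := by
  set δ := (n : ℝ) ^ (-2 : ℤ) with hδ
  set q := sampleProb n ε with hq
  set m := numSubgraphs n ε δ with hm
  set η := (6 - C) / 32 with hη
  set l := Real.log n with hl
  have hq0 : 0 < q := sampleProb_pos hn hε
  have hq1 : q ≤ 1 := sampleProb_le_one n ε
  have hm0 : 0 < m := numSubgraphs_pos hn hε
  have hm' : (0 : ℝ) < m := by exact_mod_cast hm0
  have hl0 : 0 < l := Real.log_pos (by exact_mod_cast hn)
  have hη0 : 0 < η := by rw [hη]; linarith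
  have hη1 : η < 1 / 2 := by rw [hη]; linarith
  have hqeq : q = ε / (32 * l) := by
    refine min_eq_left ?_
    rw [div_le_one (by positivity)]
    nlinarith
  have hP := isProbabilityMeasure_cbm (n := n) hp0 hp1 h0 h1 σ
  have hμ := isProbabilityMeasure_mechanismMeasure hn hε δ
  have hmask := isProbabilityMeasure_maskMeasure hq0.le hq1 n m
  have hlap := isProbabilityMeasure_laplace hε
  have hbern := isProbabilityMeasure_bernoulli hq0.le hq1
  set Q := (cbm σ p ζ).prod (mechanismMeasure n ε δ) with hQ
  obtain ⟨s, hs, hrigid⟩ := exists_estimate_of_isRigid (by omega : 0 < n) hest σ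
  set bad : Fin m → Set (CensoredGraph n × Randomness n m) := fun k =>
    {x | ¬ IsRigid (adjMatrix (gauge σ (subsample x.1 (x.2.1 k))))} with hbad
  set f := (cbm (1 : Labeling n) (q * p) ζ).real {X | ¬ IsRigid (adjMatrix X)} with hf
  have hpres : ∀ k : Fin m, MeasurePreserving
      (fun x : CensoredGraph n × Randomness n m => gauge σ (subsample x.1 (x.2.1 k))) Q
      (cbm (1 : Labeling n) (q * p) ζ) := by
    intro k
    have e1 : MeasurePreserving (fun ω : Randomness n m => ω.1 k) (mechanismMeasure n ε δ)
        (Measure.pi fun _ => ENNReal.ofReal q • Measure.dirac true +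
          ENNReal.ofReal (1 - q) • Measure.dirac false) :=
      (measurePreserving_eval _ k).comp measurePreserving_fst
    exact (measurePreserving_gauge_subsample hp0 hp1 h0 h1 hq0.le hq1 σ).comp
      ((MeasurePreserving.id _).prod e1)
  have hbadm : ∀ k, MeasurableSet (bad k) := fun k =>
    (hpres k).measurable (MeasurableSet.of_discrete (s := {X | ¬ IsRigid (adjMatrix X)}))
  have hbadP : ∀ k, Q.real (bad k) = f := fun k =>
    (hpres k).measureReal_preimage (s := {X | ¬ IsRigid (adjMatrix X)}) MeasurableSet.of_discrete.nullMeasurableSet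
  set N : CensoredGraph n × Randomness n m → ℝ := fun x =>
    ∑ k, (bad k).indicator (1 : CensoredGraph n × Randomness n m → ℝ) x with hN
  -- The subgraphs share the same `A` and are dependent, but Markov's inequality needs only the
  -- expected number of failures.
  have hmany : Q.real {x | η * m ≤ N x} ≤ f / η := by
    have hint : ∀ k ∈ (Finset.univ : Finset (Fin m)),
        Integrable ((bad k).indicator (1 : CensoredGraph n × Randomness n m → ℝ)) Q :=
      fun k _ => (integrable_const (1 : ℝ)).indicator (hbadm k)
    have hmk := mul_meas_ge_le_integral_of_nonneg (μ := Q) (f := N)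
      (Eventually.of_forall fun x => Finset.sum_nonneg fun k _ =>
        Set.indicator_nonneg (fun _ _ => zero_le_one) x)
      (integrable_finsetSum _ hint) (η * m)
    have hI : ∫ x, N x ∂Q = m * f := by
      rw [hN, integral_finsetSum _ hint]
      simp only [integral_indicator_one (hbadm _), hbadP]
      simp
    rw [hI] at hmk
    rw [le_div_iff₀ hη0]
    nlinarith
  -- The margin `6 - C` is halved: one half absorbs the votes lost through `η`, the other the
  -- negative noise.
  set t := (6 - C) / 2 * l / ε with ht
  have ht0 : 0 ≤ t := by
    have : 0 ≤ 6 - C := by linarith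
    positivity
  have htail : Q.real {x | x.2.2.1 ≤ -t} ≤ Real.exp (-((6 - C) / 2 * l)) := by
    have e1 : MeasurePreserving (fun x : CensoredGraph n × Randomness n m => x.2.2.1) Q
        (laplace (1 / ε)) :=
      measurePreserving_fst.comp (measurePreserving_snd.comp measurePreserving_snd)
    have e2 : Q {x | x.2.2.1 ≤ -t} = laplace (1 / ε) (Set.Iic (-t)) :=
      e1.measure_preimage measurableSet_Iic.nullMeasurableSet
    have e3 : ε * t = (6 - C) / 2 * l := by rw [ht]; field_simp
    rw [measureReal_def, e2, ← e3]
    exact ENNReal.toReal_le_of_le_ofReal (Real.exp_pos _).le (laplace_Iic_neg_le hε ht0)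
  have hcover : (Set.univ : Set (CensoredGraph n × Randomness n m)) ⊆
      {x | mechanism est ε δ x.1 x.2 = σ ∨ mechanism est ε δ x.1 x.2 = -σ} ∪
        ({x | η * m ≤ N x} ∪ {x | x.2.2.1 ≤ -t}) := by
    intro x _
    by_contra hx
    simp only [Set.mem_union, Set.mem_ofPred_eq, not_or, not_le] at hx
    obtain ⟨⟨hx1, hx2⟩, hxN, hxt⟩ := hx
    set v : Fin m → Labeling n := fun k => est (subsample x.1 (x.2.1 k)) with hv
    have hcard : ((Finset.univ.filter fun k => v k ≠ s).card : ℝ) ≤ η * m := by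
      refine le_trans ?_ hxN.le
      rw [Finset.card_filter]
      push_cast
      refine Finset.sum_le_sum fun k _ => ?_
      by_cases hk : v k = s
      · simp only [hk, ne_eq, not_true_eq_false, if_false]
        exact Set.indicator_nonneg (fun _ _ => zero_le_one) x
      · have : x ∈ bad k := fun hr => hk (hrigid _ hr)
        simp [hk, this]
    obtain ⟨hmode, hproxy⟩ := mode_eq_of_card_ne_le hm0 hq0 hη1 hcard
    have hthr : Real.log (1 / δ) / ε < stabilityProxy q v + x.2.2.1 := by
      rw [hδ, log_one_div_zpow]
      have e1 : (1 - 2 * η) / (4 * q) = (8 - 16 * η) * l / ε := by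
        rw [hqeq]; field_simp; ring
      -- Here `8` is `32 / 4` from the sampling rate and the proxy, and `2` comes from `δ = n⁻²`.
      -- What remains is nonnegative by `ε ≤ C log n`.
      have e2 : (8 - 16 * η) * l / ε - 1 - t - 2 * l / ε = (C * l - ε) / ε := by
        rw [ht, hη]; field_simp; ring
      have e3 : 0 ≤ (C * l - ε) / ε := div_nonneg (by linarith) hε.le
      rw [e1] at hproxy
      linarith
    have hout : mechanism est ε δ x.1 x.2 = s := by
      unfold mechanism
      rw [← hmode]
      exact if_pos hthr
    rcases hs with hs | hs
    · exact hx1 (hout.trans hs)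
    · exact hx2 (hout.trans hs)
  have htotal : (1 : ℝ) ≤ recoveryProb (mechanismMeasure n ε δ) (mechanism est ε δ) σ p ζ +
      (f / η + Real.exp (-((6 - C) / 2 * l))) := by
    have e1 : Q.real Set.univ = 1 := probReal_univ
    rw [← e1]
    refine (measureReal_mono hcover).trans ((measureReal_union_le _ _).trans ?_)
    exact add_le_add le_rfl ((measureReal_union_le _ _).trans (add_le_add hmany htail))
  linarith

end CensoredBlockModel

theorem mainTheorem3
    (est : ∀ n : ℕ, CensoredBlockModel.CensoredGraph n → CensoredBlockModel.Labeling n)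
    (hest : ∀ (n : ℕ) (A : CensoredBlockModel.CensoredGraph n),
      CensoredBlockModel.IsSDPEstimate A (est n A)) :
    (∀ n : ℕ, 2 ≤ n → ∀ ε δ : ℝ, 0 < ε → 0 < δ →
      CensoredBlockModel.IsEdgeCDP (CensoredBlockModel.mechanismMeasure n ε δ)
        (CensoredBlockModel.mechanism (est n) ε δ) ε (2 * δ)) ∧
    (∀ ζ : ℝ, 0 < ζ → ζ < 1 / 2 → ∀ (ε a : ℕ → ℝ) (σ : ∀ n : ℕ, CensoredBlockModel.Labeling n),
      (∀ n : ℕ, 0 < ε n) →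
      (∃ C : ℝ, C < 6 ∧ ∀ᶠ n : ℕ in atTop, ε n ≤ C * Real.log n) →
      (∀ᶠ n : ℕ in atTop, a n * Real.log n / n ≤ 1) →
      (∀ᶠ n : ℕ in atTop,
        max (32 * Real.log n / ε n) 1 < a n * (√(1 - ζ) - √ζ) ^ 2) →
      Tendsto
        (fun n : ℕ =>
          CensoredBlockModel.recoveryProb
            (CensoredBlockModel.mechanismMeasure n (ε n) ((n : ℝ) ^ (-2 : ℤ)))
            (CensoredBlockModel.mechanism (est n) (ε n) ((n : ℝ) ^ (-2 : ℤ)))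
            (σ n) (a n * Real.log n / n) ζ)
        atTop (𝓝 1)) := by
  open CensoredBlockModel in
  refine ⟨fun n hn ε δ hε hδ => isEdgeCDP_mechanism hn (est n) hε hδ, ?_⟩
  intro ζ h0 h1 ε a σ hε ⟨C, hC, hεC⟩ hp1 ha
  set H := (√(1 - ζ) - √ζ) ^ 2 with hH
  have hH0 : 0 ≤ H := sq_nonneg _
  have hlogpos : ∀ᶠ n : ℕ in atTop, 0 < Real.log n := by
    filter_upwards [eventually_ge_atTop 2] with n hn
    exact Real.log_pos (by exact_mod_cast hn)
  have hC0 : 0 ≤ C := by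
    obtain ⟨n, h2, h3⟩ := (hεC.and hlogpos).exists
    have := hε n
    by_contra h
    nlinarith [not_le.1 h]
  have ha0 : ∀ᶠ n : ℕ in atTop, 0 < a n := by
    filter_upwards [ha] with n hn
    have : 1 < a n * H := (le_max_right _ _).trans_lt hn
    by_contra h
    nlinarith [not_lt.1 h]
  have hq : ∀ᶠ n : ℕ in atTop, CensoredBlockModel.sampleProb n (ε n) = ε n / (32 * Real.log n) ∧
      CensoredBlockModel.sampleProb n (ε n) ≤ 1 / 2 := by
    filter_upwards [hεC, hlogpos] with n h2 h3
    have h4 : ε n / (32 * Real.log n) ≤ 1 / 2 := by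
      rw [div_le_iff₀ (by positivity)]
      nlinarith
    have h5 : CensoredBlockModel.sampleProb n (ε n) = ε n / (32 * Real.log n) :=
      min_eq_left (h4.trans (by norm_num))
    exact ⟨h5, h5 ▸ h4⟩
  have hlim := CensoredBlockModel.tendsto_measureReal_not_isRigid h0 h1
    (p := fun n => CensoredBlockModel.sampleProb n (ε n) * (a n * Real.log n / n)) (by
      filter_upwards [ha0, hlogpos, eventually_ge_atTop 2] with n h2 h3 h4
      have := CensoredBlockModel.sampleProb_pos h4 (hε n)
      positivity) (by
      filter_upwards [ha0, hlogpos, eventually_ge_atTop 2, hq, hp1] with n h2 h3 h4 h5 h6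
      have := CensoredBlockModel.sampleProb_pos h4 (hε n)
      have h7 : 0 ≤ a n * Real.log n / n := by positivity
      nlinarith [h5.2]) (by
      filter_upwards [hlogpos, eventually_ge_atTop 2, hq, ha] with n h3 h4 h5 h6
      have h7 : 32 * Real.log n / ε n < a n * H := (le_max_left _ _).trans_lt h6
      have hn0 : (0 : ℝ) < n := by exact_mod_cast (by omega : 0 < n)
      have hεn := hε n
      rw [div_lt_iff₀ hεn] at h7
      -- The logarithms cancel, so the first entry of the maximum is exactly the threshold condition
      -- `log n ≤ H d` for the subsampled graph.
      have h8 : (n : ℝ) * (CensoredBlockModel.sampleProb n (ε n) * (a n * Real.log n / n)) =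
          ε n * a n / 32 := by
        rw [h5.1]; field_simp
      rw [h8]
      linarith)
  have hexp : Tendsto (fun n : ℕ => Real.exp (-((6 - C) / 2 * Real.log n))) atTop (𝓝 0) :=
    Real.tendsto_exp_neg_atTop_nhds_zero.comp
      ((Real.tendsto_log_atTop.comp tendsto_natCast_atTop_atTop).const_mul_atTop (by linarith))
  have hlow := ((hlim.div_const ((6 - C) / 32)).const_sub 1).sub hexp
  rw [zero_div, sub_zero, sub_zero] at hlow
  refine tendsto_of_tendsto_of_tendsto_of_le_of_le' hlow tendsto_const_nhds ?_ ?_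
  · filter_upwards [ha0, hlogpos, eventually_ge_atTop 2, hεC, hp1] with n h2 h3 h4 h5 h6
    exact CensoredBlockModel.one_sub_le_recoveryProb h4 (hest n) (by positivity) h6 h0.le
      (by linarith) (hε n) hC0 hC h5 (σ n)
  · filter_upwards [ha0, hlogpos, eventually_ge_atTop 2, hp1] with n h2 h3 h4 h5
    have := CensoredBlockModel.isProbabilityMeasure_cbm (n := n) (by positivity) h5 h0.le
      (by linarith) (σ n)
    have := CensoredBlockModel.isProbabilityMeasure_mechanismMeasure h4 (hε n)
      ((n : ℝ) ^ (-2 : ℤ))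
    exact measureReal_le_one
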